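/- Let $\Omega=\{(x,y)\in\mathbb R^2 : x^2+y^2<1\}$, $r^2=x^2+y^2$, and let $\gamma\ge 0$. For $\beta\in\mathbb R$ put $\|f\|_\beta=\big(\int_\Omega(1-r^2)^\beta f^2\,dx\,dy\big)^{1/2}$, let $L^2_\beta(\Omega)$ be the space of (classes of) real functions with $\|f\|_\beta<\infty$, and let $(\cdot,\cdot)_\beta$ be its inner product. **The spaces $H^s_\gamma(\Omega)$.** For $s\in\mathbb N_0$, $H^s_\gamma(\Omega)$ is the set of all $f\in L^2_\gamma(\Omega)$ whose weak derivatives of order $s$ exist in $\Omega$ and satisfy $$|f|_{H^s_\gamma}^2:=\sum_{j=0}^s\binom sj\left\|\frac{\partial^s f}{\partial y^j\,\partial x^{s-j}}\right\|_{\gamma+s}^2<\infty,\qquad \|f\|_{H^s_\gamma}:=\big(\|f\|_\gamma^2+|f|_{H^s_\gamma}^2\big)^{1/2}.$$ For $s>0$, $s\notin\mathbb N$, $H^s_\gamma(\Omega)$ is defined by the K-method: choose integers $0\le k<s<m$, write $s=(1-\theta)k+\theta m$, and put $$\|u\|_{H^s_\gamma}:=\Big(\int_0^\infty t^{-2\theta}K(t,u)^2\,\frac{dt}{t}\Big)^{1/2},\qquad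 K(t,u)=\inf_{v\in H^m_\gamma}\big(\|u-v\|_{H^k_\gamma}+t\,\|v\|_{H^m_\gamma}\big),$$ where $\|\cdot\|_{H^k_\gamma}:=\infty$ outside $H^k_\gamma(\Omega)$; $H^s_\gamma(\Omega)$ consists of the $u\in L^2_\gamma(\Omega)$ for which this norm is finite. **The spaces $\widetilde H^s_\gamma(\Omega)$.** In polar coordinates $(r,\varphi)$ let $\mathcal V_{0,1}=\tfrac12$ and, for $l\ge1$, $\mathcal V_{l,1}=r^l\cos(l\varphi)$, $\mathcal V_{l,-1}=r^l\sin(l\varphi)$. Let $P_n^{(\gamma,l)}$ be the Jacobi polynomials and $e_{l,n,\mu}=\mathcal V_{l,\mu}\,P_n^{(\gamma,l)}(2r^2-1)$ for $l,n\ge0$, $\mu=\pm1$, $(l,\mu)\ne(0,-1)$; these form an orthogonal basis of $L^2_\gamma(\Omega)$. Let $h_{l,n}=\|e_{l,n,\mu}\|_\gamma$ (it does not depend on $\mu$), and for $u\in L^2_\gamma(\Omega)$ let $a_{l,n,\mu}=(u,e_{l,n,\mu})_\gamma/h_{l,n}^2$ be its Fourier–Jacobi coefficients. For real $s\ge0$,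 $\widetilde H^s_\gamma(\Omega)$ is the set of all $u\in L^2_\gamma(\Omega)$ with $$\|u\|_{\widetilde H^s_\gamma}^2:=\sum_{l,n,\mu}(n+1)^s(n+l+1)^s\,a_{l,n,\mu}^2\,h_{l,n}^2<\infty.$$ **Theorem.** For every $\gamma\ge0$ and every real $s\ge0$ we have $H^s_\gamma(\Omega)=\widetilde H^s_\gamma(\Omega)$, with equivalent norms: there are constants $c,C>0$, independent of $u$, such that $c\,\|u\|_{\widetilde H^s_\gamma}\le\|u\|_{H^s_\gamma}\le C\,\|u\|_{\widetilde H^s_\gamma}$ for all $u$ in this space. For $s\notin\mathbb N_0$ this holds for every choice of the integers $0\le k<s<m$ in the definition of $H^s_\gamma(\Omega)$ (with $c,C$ depending on this choice). -/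

import Mathlib

open MeasureTheory Set
open scoped ENNReal

noncomputable section

namespace DiskSobolev

/-- The open unit disk of the plane; a point is `p = (x, y) = (p.1, p.2)`. -/
def Disk : Set (ℝ × ℝ) := {p | p.1 ^ 2 + p.2 ^ 2 < 1}

/-- The measure `(1 - r²)^β dx dy` on the unit disk. -/
def wMeasure (β : ℝ) : Measure (ℝ × ℝ) :=
  (volume.restrict Disk).withDensity
    fun p => ENNReal.ofReal ((1 - (p.1 ^ 2 + p.2 ^ 2)) ^ β)

/-- The weighted space `L²_β` of real functions on the disk (modulo equality a.e.). -/
abbrev L2w (β : ℝ) := Lp ℝ 2 (wMeasure β)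

/-- The weighted norm `‖f‖_β = (∫_Ω (1 - r²)^β f²)^{1/2}`, with values in `[0, ∞]`. -/
def wNorm (β : ℝ) (f : ℝ × ℝ → ℝ) : ℝ≥0∞ := eLpNorm f 2 (wMeasure β)

/-! ### The Sobolev spaces of integer order -/

/-- `∂φ/∂x`. -/
def partialX (φ : ℝ × ℝ → ℝ) : ℝ × ℝ → ℝ := fun p => fderiv ℝ φ p (1, 0)

/-- `∂φ/∂y`. -/
def partialY (φ : ℝ × ℝ → ℝ) : ℝ × ℝ → ℝ := fun p => fderiv ℝ φ p (0, 1)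

/-- `g` is the weak derivative `∂^{i+j} u / ∂y^j ∂x^i` of `u` on the open unit disk. -/
def IsWeakDeriv (i j : ℕ) (u g : ℝ × ℝ → ℝ) : Prop :=
  LocallyIntegrableOn u Disk volume ∧ LocallyIntegrableOn g Disk volume ∧
    ∀ φ : ℝ × ℝ → ℝ, ContDiff ℝ (⊤ : ℕ∞) φ → HasCompactSupport φ → tsupport φ ⊆ Disk →
      ∫ p in Disk, u p * (partialY^[j] (partialX^[i] φ)) p
        = (-1) ^ (i + j) * ∫ p in Disk, g p * φ p

/-- The norm `‖∂^{i+j} u / ∂y^j ∂x^i‖_β` of the weak derivative. It is `∞` if there is no weak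
derivative; otherwise weak derivatives agree almost everywhere on the disk and the infimum is
taken over a single value, see `derivNorm_eq`. -/
def derivNorm (β : ℝ) (i j : ℕ) (u : ℝ × ℝ → ℝ) : ℝ≥0∞ :=
  ⨅ (g : ℝ × ℝ → ℝ) (_ : IsWeakDeriv i j u g), wNorm β g

theorem isOpen_disk : IsOpen Disk :=
  isOpen_lt (by fun_prop) continuous_const

theorem IsWeakDeriv.ae_eq {i j : ℕ} {u g g' : ℝ × ℝ → ℝ} (h : IsWeakDeriv i j u g)
    (h' : IsWeakDeriv i j u g') : g =ᵐ[volume.restrict Disk] g' := by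
  have key : ∀ᵐ p ∂(volume : Measure (ℝ × ℝ)), p ∈ Disk → (g - g') p = 0 := by
    apply isOpen_disk.ae_eq_zero_of_integral_contDiff_smul_eq_zero (h.2.1.sub h'.2.1)
    intro φ hφ hc hs
    have hint : ∀ f : ℝ × ℝ → ℝ, LocallyIntegrableOn f Disk volume →
        IntegrableOn (fun p => f p * φ p) Disk volume := by
      intro f hf
      have h1 : IntegrableOn (fun p => f p * φ p) (tsupport φ) volume :=
        (hf.integrableOn_compact_subset hs hc).mul_continuousOn hφ.continuous.continuousOn hc
      have h2 : Function.support (fun p => f p * φ p) ⊆ tsupport φ := fun p hp =>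
        subset_tsupport φ fun h0 => hp (by simp [h0])
      exact ((integrableOn_iff_integrable_of_support_subset h2).1 h1).integrableOn
    have e : ∫ p in Disk, g p * φ p = ∫ p in Disk, g' p * φ p := by
      have := (h.2.2 φ hφ hc hs).symm.trans (h'.2.2 φ hφ hc hs)
      exact mul_left_cancel₀ (pow_ne_zero _ (by norm_num)) this
    have e2 : ∫ p, φ p • (g - g') p = ∫ p in Disk, φ p • (g - g') p := by
      rw [setIntegral_eq_integral_of_forall_compl_eq_zero]
      intro p hp
      rw [image_eq_zero_of_notMem_tsupport fun hx => hp (hs hx), zero_smul]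
    rw [e2]
    calc ∫ p in Disk, φ p • (g - g') p = ∫ p in Disk, (g p * φ p - g' p * φ p) := by
          congr 1; ext p; simp; ring
      _ = 0 := by rw [integral_sub (hint _ h.2.1) (hint _ h'.2.1), e, sub_self]
  rw [Filter.EventuallyEq, ae_restrict_iff' isOpen_disk.measurableSet]
  filter_upwards [key] with p hp hd
  exact sub_eq_zero.1 (hp hd)

theorem derivNorm_eq {i j : ℕ} {u g : ℝ × ℝ → ℝ} (β : ℝ) (h : IsWeakDeriv i j u g) :
    derivNorm β i j u = wNorm β g := by
  apply le_antisymm (iInf₂_le g h)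
  refine le_iInf₂ fun g' h' => le_of_eq (eLpNorm_congr_ae ?_)
  exact (withDensity_absolutelyContinuous _ _).ae_eq (h.ae_eq h')

/-- The seminorm `|u|_{H^s_γ}`, `s` a natural number; it is `∞` exactly if some weak derivative of
order `s` fails to exist in `L²_{γ+s}`. -/
def sobolevSeminorm (γ : ℝ) (s : ℕ) (u : L2w γ) : ℝ≥0∞ :=
  (∑ j ∈ Finset.range (s + 1),
    (s.choose j : ℝ≥0∞) * derivNorm (γ + s) (s - j) j u ^ 2) ^ (1 / 2 : ℝ)

/-- The norm of `H^s_γ`, `s` a natural number, extended by `∞` to all of `L²_γ`. -/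
def sobolevNorm (γ : ℝ) (s : ℕ) (u : L2w γ) : ℝ≥0∞ :=
  (wNorm γ u ^ 2 + sobolevSeminorm γ s u ^ 2) ^ (1 / 2 : ℝ)

/-! ### The K-method of interpolation -/

/-- The K-functional `K(t, u) = inf_{v ∈ X₁} (‖u - v‖_{X₀} + t ‖v‖_{X₁})`, where `X₀` and `X₁` are
the subspaces of `E` on which the `[0, ∞]`-valued norms `N₀` and `N₁` are finite. -/
def kFunctional {E : Type*} [AddCommGroup E] (N₀ N₁ : E → ℝ≥0∞) (t : ℝ) (u : E) : ℝ≥0∞ :=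
  ⨅ (v : E) (_ : N₁ v < ⊤), (N₀ (u - v) + ENNReal.ofReal t * N₁ v)

/-- The norm `(∫_0^∞ t^{-2θ} K(t, u)² dt/t)^{1/2}` of the interpolation space `[X₀, X₁]_{θ,2}`. -/
def interpNorm {E : Type*} [AddCommGroup E] (N₀ N₁ : E → ℝ≥0∞) (θ : ℝ) (u : E) : ℝ≥0∞ :=
  (∫⁻ t in Ioi (0 : ℝ),
    ENNReal.ofReal (t ^ (-2 * θ)) * kFunctional N₀ N₁ t u ^ 2 * ENNReal.ofReal t⁻¹) ^ (1 / 2 : ℝ)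

/-- The norm of `H^s_γ` for non-integer `s`, obtained by interpolation between `H^k_γ` and `H^m_γ`,
where `k < s < m` are natural numbers and `s = (1 - θ) k + θ m`. -/
def fracSobolevNorm (γ : ℝ) (k m : ℕ) (s : ℝ) (u : L2w γ) : ℝ≥0∞ :=
  interpNorm (sobolevNorm γ k) (sobolevNorm γ m) ((s - k) / (m - k)) u

/-! ### The spaces defined through Fourier-Jacobi coefficients -/

/-- The Jacobi polynomial `P_n^{(a,b)}(t)`. -/
def jacobiP (n : ℕ) (a b t : ℝ) : ℝ :=
  (-1) ^ n * (Real.Gamma (n + 1 + b) / (n.factorial * Real.Gamma (n + 1 + a + b))) *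
    ∑ j ∈ Finset.range (n + 1), (-1) ^ j * (2 ^ j)⁻¹ * (n.choose j : ℝ) *
      (Real.Gamma (n + j + 1 + a + b) / Real.Gamma (j + 1 + b)) * (1 + t) ^ j

/-- The solid harmonic `V_{l,μ}`, in polar coordinates `r = √(x² + y²)`, `φ = arg (x + i y)`:
`V_{0,1} = 1/2`, and `V_{l,1} = r^l cos(lφ)`, `V_{l,-1} = r^l sin(lφ)` for `l ≥ 1`. -/
def solidHarmonic (l : ℕ) (μ : ℤˣ) (p : ℝ × ℝ) : ℝ :=
  if μ = 1 then
    if l = 0 then 1 / 2 else √(p.1 ^ 2 + p.2 ^ 2) ^ l * Real.cos (l * Complex.arg ⟨p.1, p.2⟩)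
  else √(p.1 ^ 2 + p.2 ^ 2) ^ l * Real.sin (l * Complex.arg ⟨p.1, p.2⟩)

/-- The index set of the triples `(l, n, μ)` with `l, n ≥ 0`, `μ = ±1`, without the triples
`(0, n, -1)`. -/
abbrev BasisIndex := {i : ℕ × ℕ × ℤˣ // ¬(i.1 = 0 ∧ i.2.2 = -1)}

/-- The orthogonal basis function `V_{l,μ} P_n^{(γ,l)}(2r² - 1)` of `L²_γ`. -/
def basisFun (γ : ℝ) (l n : ℕ) (μ : ℤˣ) (p : ℝ × ℝ) : ℝ :=
  solidHarmonic l μ p * jacobiP n γ l (2 * (p.1 ^ 2 + p.2 ^ 2) - 1)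

/-- `h = ‖V_{l,μ} P_n^{(γ,l)}(2r² - 1)‖_γ` (which does not depend on `μ`). -/
def basisNorm (γ : ℝ) (l n : ℕ) (μ : ℤˣ) : ℝ := (wNorm γ (basisFun γ l n μ)).toReal

/-- The Fourier-Jacobi coefficient `a_{l,n,μ}` of `u`, that is, its coefficient with respect to the
orthogonal basis: `(u, V_{l,μ} P_n^{(γ,l)})_γ / h²`. -/
def coeff (γ : ℝ) (u : L2w γ) (l n : ℕ) (μ : ℤˣ) : ℝ :=
  (∫ p, u p * basisFun γ l n μ p ∂wMeasure γ) / basisNorm γ l n μ ^ 2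

/-- The norm `(∑ (n+1)^s (n+l+1)^s a² h²)^{1/2}` of the space `H̃^s_γ`, extended by `∞` to all of
`L²_γ`. -/
def jacobiNorm (γ : ℝ) (s : ℝ) (u : L2w γ) : ℝ≥0∞ :=
  (∑' i : BasisIndex,
    let l := i.1.1
    let n := i.1.2.1
    let μ := i.1.2.2
    ENNReal.ofReal (((n : ℝ) + 1) ^ s * ((n : ℝ) + l + 1) ^ s *
      coeff γ u l n μ ^ 2 * basisNorm γ l n μ ^ 2)) ^ (1 / 2 : ℝ)

/-! ### Equality of spaces with equivalent norms -/

/-- The subspaces of `E` on which the `[0, ∞]`-valued norms `N` and `N'` are finite coincide, and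
on this subspace the norms are equivalent. -/
def SpacesEquivalent {E : Type*} (N N' : E → ℝ≥0∞) : Prop :=
  {u | N u < ⊤} = {u | N' u < ⊤} ∧
    ∃ c C : ℝ, 0 < c ∧ 0 < C ∧ ∀ u, N u < ⊤ →
      ENNReal.ofReal c * N' u ≤ N u ∧ N u ≤ ENNReal.ofReal C * N' u

end DiskSobolev

end

/-!
The theorem holds because the norms of all the spaces involved are diagonal in one and the same
orthogonal basis.

*Eigenfunctions.* In the complex coordinate `z = x + iy` the basis function `V_{l,μ} P_n^{(γ,l)}` is
a multiple of the real or the imaginary part of the disk polynomial `Q^γ_{n+l,n}(z, conj z)`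
(`diskPoly_eq_jacobiP`, `basisFun_eq`). With the normalization chosen here, `∂/∂z` maps `Q^γ_{p,q}`
to `p Q^{γ+1}_{p-1,q}`, and `∂/∂(conj z)` maps `(1 - r²)^{γ+1} Q^{γ+1}_{p,q}` to
`-(q + γ + 1) (1 - r²)^γ Q^γ_{p+1,q}`; the same holds with the variables exchanged
(`sum_deriv_left`, `diskPoly_raise`). Lowering and raising again reproduces the polynomial up to a
factor. By induction on `s`, with Pascal's rule for the binomial weights (`formOp_succ`), the disk
polynomials are eigenfunctions of the operator
`(-1)^s ∑ s!/(i! j!) ∂x^i ∂y^j ((1 - r²)^{γ+s} ∂x^i ∂y^j)` relative to the weight `(1 - r²)^γ`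
(`formOp_diskFun`). A recursion for the eigenvalue shows that, increased by one, it is comparable to
`((n + 1)(n + l + 1))^s` (`eigenvalue_le`, `le_one_add_eigenvalue`).

*Integer order.* The weak derivatives of order `s` of a function `u` may be tested against
`(1 - r²)^{γ+s}` times a smooth function (`IsWeakDeriv.integral_rpow_mul`). So the eigenvalue
equation holds in weak form: the form `∑ s!/(i! j!) ∫ (1 - r²)^{γ+s} ∂x^i ∂y^j u · ∂x^i ∂y^j e`,
evaluated at `u` and a basis function `e`, is the eigenvalue times `(u, e)_γ`
(`sum_integral_mixedDeriv_eq`). For `s = 1` and two basis functions this is the orthogonality in the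
radial index; the angular part follows from rotation invariance, and completeness from the
Stone-Weierstrass theorem (`diskBasis`). For general `s` it says that the tuples of the derivatives
of the basis functions are orthogonal as well. Hence the square of the seminorm is the sum of
eigenvalue times squared coefficient (`sobolevSeminorm_sq`): one inequality is Bessel's, and for the
other one differentiates the Fourier-Jacobi series term by term.

*Non-integer order.* For two weighted `ℓ²` norms with weights `w^k` and `w^m`, the square of the
K-functional is comparable to `∑ min (w^k) (t² w^m) a²` (`kFunctional_sq_le`,
`kSum_le_kFunctional_sq`). Integrating term by term against `t^{-2θ-1} dt` gives a multiple of
`∑ w^{(1-θ)k+θm} a²` (`lintegral_kSum`).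
-/

noncomputable section

namespace DiskSobolev

/-! ### Iterated partial derivatives on open sets -/

section Derivatives

variable {E F : Type*} [NormedAddCommGroup E] [NormedSpace ℝ E] [NormedAddCommGroup F]
  [NormedSpace ℝ F] {U : Set (ℝ × ℝ)}

/-- The directional derivative of a function on the plane. -/
def dirDeriv (v : ℝ × ℝ) (f : ℝ × ℝ → E) : ℝ × ℝ → E := fun p => fderiv ℝ f p v

/-- The mixed partial derivative `∂^{i+j} f / ∂y^j ∂x^i`. -/
def mixedDeriv (i j : ℕ) (f : ℝ × ℝ → E) : ℝ × ℝ → E :=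
  (dirDeriv (0, 1))^[j] ((dirDeriv (1, 0))^[i] f)

theorem iterate_partial_eq_mixedDeriv (i j : ℕ) (f : ℝ × ℝ → ℝ) :
    partialY^[j] (partialX^[i] f) = mixedDeriv i j f := rfl

@[simp]
theorem mixedDeriv_zero_zero (f : ℝ × ℝ → E) : mixedDeriv 0 0 f = f := rfl

theorem mixedDeriv_succ_left (i j : ℕ) (f : ℝ × ℝ → E) :
    mixedDeriv (i + 1) j f = mixedDeriv i j (dirDeriv (1, 0) f) := rfl

theorem mixedDeriv_succ_right (i j : ℕ) (f : ℝ × ℝ → E) :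
    mixedDeriv i (j + 1) f = dirDeriv (0, 1) (mixedDeriv i j f) :=
  Function.iterate_succ_apply' _ _ _

theorem mixedDeriv_succ_zero (i : ℕ) (f : ℝ × ℝ → E) :
    mixedDeriv (i + 1) 0 f = dirDeriv (1, 0) (mixedDeriv i 0 f) :=
  Function.iterate_succ_apply' _ _ _

theorem dirDeriv_congr (hU : IsOpen U) {f g : ℝ × ℝ → E} (h : EqOn f g U) (v : ℝ × ℝ) :
    EqOn (dirDeriv v f) (dirDeriv v g) U := fun p hp => by
  have : f =ᶠ[nhds p] g := Filter.eventuallyEq_of_mem (hU.mem_nhds hp) h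
  simp only [dirDeriv, this.fderiv_eq]

theorem contDiffOn_dirDeriv (hU : IsOpen U) {f : ℝ × ℝ → E} (hf : ContDiffOn ℝ (⊤ : ℕ∞) f U)
    (v : ℝ × ℝ) : ContDiffOn ℝ (⊤ : ℕ∞) (dirDeriv v f) U :=
  (hf.fderiv_of_isOpen hU (by simp)).clm_apply contDiffOn_const

theorem differentiableAt_of_contDiffOn (hU : IsOpen U) {f : ℝ × ℝ → E}
    (hf : ContDiffOn ℝ (⊤ : ℕ∞) f U) {p : ℝ × ℝ} (hp : p ∈ U) : DifferentiableAt ℝ f p :=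
  (hf.contDiffAt (hU.mem_nhds hp)).differentiableAt (by simp)

theorem dirDeriv_comm (hU : IsOpen U) {f : ℝ × ℝ → E} (hf : ContDiffOn ℝ (⊤ : ℕ∞) f U)
    (v v' : ℝ × ℝ) : EqOn (dirDeriv v (dirDeriv v' f)) (dirDeriv v' (dirDeriv v f)) U := by
  intro p hp
  have hd : DifferentiableAt ℝ (fderiv ℝ f) p :=
    ((hf.fderiv_of_isOpen hU (m := (⊤ : ℕ∞)) (by simp)).contDiffAt
      (hU.mem_nhds hp)).differentiableAt (by simp)
  have key : ∀ a b : ℝ × ℝ, dirDeriv a (dirDeriv b f) p = fderiv ℝ (fderiv ℝ f) p a b := by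
    intro a b
    change fderiv ℝ (fun q => fderiv ℝ f q b) p a = _
    rw [fderiv_clm_apply hd (differentiableAt_const _)]
    simp
  have hs : IsSymmSndFDerivAt ℝ f p :=
    (hf.contDiffAt (hU.mem_nhds hp)).isSymmSndFDerivAt (by
      rw [minSmoothness_of_isRCLikeNormedField]
      exact WithTop.coe_le_coe.2 le_top)
  rw [key, key, hs v v']

theorem dirDeriv_add (hU : IsOpen U) {f g : ℝ × ℝ → E} (hf : ContDiffOn ℝ (⊤ : ℕ∞) f U)
    (hg : ContDiffOn ℝ (⊤ : ℕ∞) g U) (v : ℝ × ℝ) :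
    EqOn (dirDeriv v (fun p => f p + g p)) (fun p => dirDeriv v f p + dirDeriv v g p) U := by
  intro p hp
  simp only [dirDeriv]
  rw [fderiv_fun_add (differentiableAt_of_contDiffOn hU hf hp)
    (differentiableAt_of_contDiffOn hU hg hp)]
  rfl

theorem dirDeriv_clm (hU : IsOpen U) (L : E →L[ℝ] F) {f : ℝ × ℝ → E}
    (hf : ContDiffOn ℝ (⊤ : ℕ∞) f U) (v : ℝ × ℝ) :
    EqOn (dirDeriv v (fun p => L (f p))) (fun p => L (dirDeriv v f p)) U := by
  intro p hp
  simp only [dirDeriv]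
  have := L.hasFDerivAt.comp p (differentiableAt_of_contDiffOn hU hf hp).hasFDerivAt
  have h2 : fderiv ℝ (fun p => L (f p)) p = L.comp (fderiv ℝ f p) := this.fderiv
  rw [h2]
  rfl

theorem dirDeriv_sum (hU : IsOpen U) {ι : Type*} (s : Finset ι) {f : ι → ℝ × ℝ → E}
    (hf : ∀ i ∈ s, ContDiffOn ℝ (⊤ : ℕ∞) (f i) U) (v : ℝ × ℝ) :
    EqOn (dirDeriv v (fun p => ∑ i ∈ s, f i p)) (fun p => ∑ i ∈ s, dirDeriv v (f i) p) U := by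
  intro p hp
  simp only [dirDeriv]
  rw [fderiv_fun_sum fun i hi => differentiableAt_of_contDiffOn hU (hf i hi) hp]
  simp

theorem mixedDeriv_congr (hU : IsOpen U) (i j : ℕ) {f g : ℝ × ℝ → E} (h : EqOn f g U) :
    EqOn (mixedDeriv i j f) (mixedDeriv i j g) U := by
  induction j with
  | zero =>
    induction i with
    | zero => simpa using h
    | succ i ih => rw [mixedDeriv_succ_zero, mixedDeriv_succ_zero]; exact dirDeriv_congr hU ih _
  | succ j ih => rw [mixedDeriv_succ_right, mixedDeriv_succ_right]; exact dirDeriv_congr hU ih _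

theorem contDiffOn_mixedDeriv (hU : IsOpen U) (i j : ℕ) {f : ℝ × ℝ → E}
    (hf : ContDiffOn ℝ (⊤ : ℕ∞) f U) : ContDiffOn ℝ (⊤ : ℕ∞) (mixedDeriv i j f) U := by
  induction j with
  | zero =>
    induction i with
    | zero => simpa using hf
    | succ i ih => rw [mixedDeriv_succ_zero]; exact contDiffOn_dirDeriv hU ih _
  | succ j ih => rw [mixedDeriv_succ_right]; exact contDiffOn_dirDeriv hU ih _

theorem contDiff_mixedDeriv (i j : ℕ) {f : ℝ × ℝ → E}
    (hf : ContDiff ℝ (⊤ : ℕ∞) f) : ContDiff ℝ (⊤ : ℕ∞) (mixedDeriv i j f) :=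
  contDiffOn_univ.1 (contDiffOn_mixedDeriv isOpen_univ i j hf.contDiffOn)

/-- Partial derivatives of smooth functions commute. The sets of smoothness are open sets such as
the disk, because the powers of `1 - r²` are smooth only there. -/
theorem mixedDeriv_dirDeriv (hU : IsOpen U) (i j : ℕ) {f : ℝ × ℝ → E}
    (hf : ContDiffOn ℝ (⊤ : ℕ∞) f U) (v : ℝ × ℝ) :
    EqOn (mixedDeriv i j (dirDeriv v f)) (dirDeriv v (mixedDeriv i j f)) U := by
  induction j with
  | zero =>
    induction i with
    | zero => exact fun p _ => rfl
    | succ i ih =>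
      rw [mixedDeriv_succ_zero, mixedDeriv_succ_zero]
      exact (dirDeriv_congr hU ih _).trans
        (dirDeriv_comm hU (contDiffOn_mixedDeriv hU i 0 hf) _ _)
  | succ j ih =>
    rw [mixedDeriv_succ_right, mixedDeriv_succ_right]
    exact (dirDeriv_congr hU ih _).trans (dirDeriv_comm hU (contDiffOn_mixedDeriv hU i j hf) _ _)

theorem mixedDeriv_succ_left' (hU : IsOpen U) (i j : ℕ) {f : ℝ × ℝ → E}
    (hf : ContDiffOn ℝ (⊤ : ℕ∞) f U) :
    EqOn (mixedDeriv (i + 1) j f) (dirDeriv (1, 0) (mixedDeriv i j f)) U :=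
  mixedDeriv_dirDeriv hU i j hf (1, 0)

theorem mixedDeriv_succ_right' (hU : IsOpen U) (i j : ℕ) {f : ℝ × ℝ → E}
    (hf : ContDiffOn ℝ (⊤ : ℕ∞) f U) :
    EqOn (mixedDeriv i (j + 1) f) (mixedDeriv i j (dirDeriv (0, 1) f)) U := by
  rw [mixedDeriv_succ_right]
  exact (mixedDeriv_dirDeriv hU i j hf (0, 1)).symm

theorem mixedDeriv_add (hU : IsOpen U) (i j : ℕ) {f g : ℝ × ℝ → E}
    (hf : ContDiffOn ℝ (⊤ : ℕ∞) f U) (hg : ContDiffOn ℝ (⊤ : ℕ∞) g U) :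
    EqOn (mixedDeriv i j (fun p => f p + g p))
      (fun p => mixedDeriv i j f p + mixedDeriv i j g p) U := by
  induction j with
  | zero =>
    induction i with
    | zero => exact fun p _ => rfl
    | succ i ih =>
      simp only [mixedDeriv_succ_zero]
      exact (dirDeriv_congr hU ih _).trans (dirDeriv_add hU (contDiffOn_mixedDeriv hU i 0 hf)
        (contDiffOn_mixedDeriv hU i 0 hg) _)
  | succ j ih =>
    simp only [mixedDeriv_succ_right]
    exact (dirDeriv_congr hU ih _).trans (dirDeriv_add hU (contDiffOn_mixedDeriv hU i j hf)
      (contDiffOn_mixedDeriv hU i j hg) _)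

theorem mixedDeriv_clm (hU : IsOpen U) (L : E →L[ℝ] F) (i j : ℕ) {f : ℝ × ℝ → E}
    (hf : ContDiffOn ℝ (⊤ : ℕ∞) f U) :
    EqOn (mixedDeriv i j (fun p => L (f p))) (fun p => L (mixedDeriv i j f p)) U := by
  induction j with
  | zero =>
    induction i with
    | zero => exact fun p _ => rfl
    | succ i ih =>
      simp only [mixedDeriv_succ_zero]
      exact (dirDeriv_congr hU ih _).trans
        (dirDeriv_clm hU L (contDiffOn_mixedDeriv hU i 0 hf) _)
  | succ j ih =>
    simp only [mixedDeriv_succ_right]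
    exact (dirDeriv_congr hU ih _).trans
      (dirDeriv_clm hU L (contDiffOn_mixedDeriv hU i j hf) _)

/-- The differential operator `∑_{i+j=s} s!/(i! j!) ∂x^i ∂y^j (W ∂x^i ∂y^j f)`. Up to the sign
`(-1)^s` it represents the quadratic form `∑ s!/(i! j!) ∫ W (∂x^i ∂y^j f)²`. -/
def formOp (s : ℕ) (W : ℝ × ℝ → ℝ) (f : ℝ × ℝ → E) : ℝ × ℝ → E := fun p =>
  ∑ ij ∈ Finset.HasAntidiagonal.antidiagonal s, s.choose ij.1 •
    mixedDeriv ij.1 ij.2 (fun p => W p • mixedDeriv ij.1 ij.2 f p) p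

variable {W : ℝ × ℝ → ℝ}

theorem contDiffOn_smul_mixedDeriv (hU : IsOpen U) (hW : ContDiffOn ℝ (⊤ : ℕ∞) W U)
    {f : ℝ × ℝ → E} (hf : ContDiffOn ℝ (⊤ : ℕ∞) f U) (i j : ℕ) :
    ContDiffOn ℝ (⊤ : ℕ∞) (fun p => W p • mixedDeriv i j f p) U :=
  hW.smul (contDiffOn_mixedDeriv hU i j hf)

theorem formOp_clm (hU : IsOpen U) (s : ℕ) (hW : ContDiffOn ℝ (⊤ : ℕ∞) W U) (L : E →L[ℝ] F)
    {f : ℝ × ℝ → E} (hf : ContDiffOn ℝ (⊤ : ℕ∞) f U) :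
    EqOn (formOp s W (fun p => L (f p))) (fun p => L (formOp s W f p)) U := by
  intro p hp
  simp only [formOp, map_sum, map_nsmul]
  refine Finset.sum_congr rfl fun ij _ => ?_
  congr 1
  refine Eq.trans ?_ (mixedDeriv_clm hU L _ _ (contDiffOn_smul_mixedDeriv hU hW hf _ _) hp)
  refine mixedDeriv_congr hU _ _ (fun q hq => ?_) hp
  simp only [mixedDeriv_clm hU L _ _ hf hq, map_smul]

theorem formOp_add (hU : IsOpen U) (s : ℕ) (hW : ContDiffOn ℝ (⊤ : ℕ∞) W U)
    {f g : ℝ × ℝ → E} (hf : ContDiffOn ℝ (⊤ : ℕ∞) f U) (hg : ContDiffOn ℝ (⊤ : ℕ∞) g U) :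
    EqOn (formOp s W (fun p => f p + g p)) (fun p => formOp s W f p + formOp s W g p) U := by
  intro p hp
  simp only [formOp, ← Finset.sum_add_distrib, ← smul_add]
  refine Finset.sum_congr rfl fun ij _ => ?_
  congr 1
  refine Eq.trans ?_ (mixedDeriv_add hU _ _ (contDiffOn_smul_mixedDeriv hU hW hf _ _)
    (contDiffOn_smul_mixedDeriv hU hW hg _ _) hp)
  refine mixedDeriv_congr hU _ _ (fun q hq => ?_) hp
  simp only [mixedDeriv_add hU _ _ hf hg hq, smul_add]

theorem dirDeriv_nsmul_sum_mixedDeriv (hU : IsOpen U) (S : Finset (ℕ × ℕ)) (c : ℕ × ℕ → ℕ)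
    {G : ℕ × ℕ → ℝ × ℝ → E} (hG : ∀ ij, ContDiffOn ℝ (⊤ : ℕ∞) (G ij) U) (v : ℝ × ℝ) :
    EqOn (dirDeriv v (fun p => ∑ ij ∈ S, c ij • mixedDeriv ij.1 ij.2 (G ij) p))
      (fun p => ∑ ij ∈ S, c ij • dirDeriv v (mixedDeriv ij.1 ij.2 (G ij)) p) U := by
  intro p hp
  rw [dirDeriv_sum hU S (fun ij _ => (contDiffOn_mixedDeriv hU ij.1 ij.2 (hG ij)).const_smul _) v
    hp]
  refine Finset.sum_congr rfl fun ij _ => ?_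
  have := dirDeriv_clm hU (c ij • ContinuousLinearMap.id ℝ E)
    (contDiffOn_mixedDeriv hU ij.1 ij.2 (hG ij)) v hp
  simpa using this

/-- Pascal's rule: the operators of order `s + 1` are obtained from those of order `s` as
`∑_v ∂_v ∘ (operator of order s) ∘ ∂_v`. -/
theorem formOp_succ (hU : IsOpen U) (s : ℕ) (hW : ContDiffOn ℝ (⊤ : ℕ∞) W U)
    {f : ℝ × ℝ → E} (hf : ContDiffOn ℝ (⊤ : ℕ∞) f U) :
    EqOn (formOp (s + 1) W f)
      (fun p => dirDeriv (1, 0) (formOp s W (dirDeriv (1, 0) f)) p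
        + dirDeriv (0, 1) (formOp s W (dirDeriv (0, 1) f)) p) U := by
  intro p hp
  have hx := contDiffOn_dirDeriv hU hf (1, 0)
  have hy := contDiffOn_dirDeriv hU hf (0, 1)
  have e1 := dirDeriv_nsmul_sum_mixedDeriv hU (Finset.HasAntidiagonal.antidiagonal s)
    (fun ij => s.choose ij.1) (G := fun ij p => W p • mixedDeriv ij.1 ij.2 (dirDeriv (1, 0) f) p)
    (fun ij => contDiffOn_smul_mixedDeriv hU hW hx _ _) (1, 0) hp
  have e2 := dirDeriv_nsmul_sum_mixedDeriv hU (Finset.HasAntidiagonal.antidiagonal s)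
    (fun ij => s.choose ij.1) (G := fun ij p => W p • mixedDeriv ij.1 ij.2 (dirDeriv (0, 1) f) p)
    (fun ij => contDiffOn_smul_mixedDeriv hU hW hy _ _) (0, 1) hp
  have e3 := Finset.sum_antidiagonal_choose_succ_nsmul
    (fun i j => mixedDeriv i j (fun p => W p • mixedDeriv i j f p) p) s
  change dirDeriv (1, 0) (formOp s W (dirDeriv (1, 0) f)) p = _ at e1
  change dirDeriv (0, 1) (formOp s W (dirDeriv (0, 1) f)) p = _ at e2
  change formOp (s + 1) W f p = _ at e3
  rw [e3, add_comm]
  refine Eq.trans ?_ (congrArg₂ (· + ·) e1 e2).symm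
  congr 1
  · refine Finset.sum_congr rfl fun ij hij => ?_
    rw [← Nat.choose_symm_of_eq_add (Finset.HasAntidiagonal.mem_antidiagonal.1 hij).symm]
    congr 1
    exact mixedDeriv_succ_left' hU _ _ (contDiffOn_smul_mixedDeriv hU hW hf (ij.1 + 1) ij.2) hp
  · refine Finset.sum_congr rfl fun ij _ => ?_
    congr 1
    rw [mixedDeriv_succ_right]
    refine dirDeriv_congr hU (mixedDeriv_congr hU _ _ fun q hq => ?_) _ hp
    simp only [mixedDeriv_succ_right' hU _ _ hf hq]

end Derivatives

/-! ### Disk polynomials and their ladder relations -/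

/-- The coefficient of `a^{p-k} b^{q-k}` in the disk polynomial. It vanishes for `k > min p q`, and
the scaling is such that derivatives of disk polynomials carry no other factor than the degree. -/
def diskCoeff (γ : ℝ) (p q k : ℕ) : ℝ :=
  (-1) ^ k * p.descFactorial k * q.choose k * Real.Gamma (p + q - k + 1 + γ)

/-- The disk polynomial of bidegree `(p, q)`, as a polynomial in two independent variables; on the
plane it is evaluated at `a = z`, `b = conj z`. -/
def diskPoly (γ : ℝ) (p q : ℕ) (a b : ℂ) : ℂ :=
  ∑ k ∈ Finset.range (q + 1), (diskCoeff γ p q k : ℂ) * (a ^ (p - k) * b ^ (q - k))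

theorem diskCoeff_of_lt_left {p k : ℕ} (γ : ℝ) (q : ℕ) (h : p < k) : diskCoeff γ p q k = 0 := by
  simp [diskCoeff, Nat.descFactorial_of_lt h]

theorem diskCoeff_of_lt_right {q k : ℕ} (γ : ℝ) (p : ℕ) (h : q < k) : diskCoeff γ p q k = 0 := by
  simp [diskCoeff, Nat.choose_eq_zero_of_lt h]

theorem diskCoeff_comm (γ : ℝ) (p q k : ℕ) : diskCoeff γ p q k = diskCoeff γ q p k := by
  have h : p.descFactorial k * q.choose k = q.descFactorial k * p.choose k := by
    rw [Nat.descFactorial_eq_factorial_mul_choose, Nat.descFactorial_eq_factorial_mul_choose]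
    ring
  have h' : (p.descFactorial k : ℝ) * q.choose k = q.descFactorial k * p.choose k := by
    exact_mod_cast h
  simp only [diskCoeff, mul_assoc]
  rw [← mul_assoc (p.descFactorial k : ℝ), h', mul_assoc]
  ring_nf

theorem diskPoly_eq_sum_range (γ : ℝ) (p q : ℕ) (a b : ℂ) {N : ℕ} (hN : q + 1 ≤ N) :
    diskPoly γ p q a b =
      ∑ k ∈ Finset.range N, (diskCoeff γ p q k : ℂ) * (a ^ (p - k) * b ^ (q - k)) := by
  refine Finset.sum_subset (Finset.range_subset_range.2 hN) fun k _ hk => ?_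
  rw [diskCoeff_of_lt_right γ p (by have := mt Finset.mem_range.2 hk; omega)]
  simp

/-- The symmetry which turns each statement on the variable `a` into one on `b`. -/
theorem diskPoly_comm (γ : ℝ) (p q : ℕ) (a b : ℂ) : diskPoly γ p q a b = diskPoly γ q p b a := by
  rw [diskPoly_eq_sum_range γ p q a b (N := p + q + 1) (by omega),
    diskPoly_eq_sum_range γ q p b a (N := p + q + 1) (by omega)]
  refine Finset.sum_congr rfl fun k _ => ?_
  rw [diskCoeff_comm, mul_comm (a ^ _)]

theorem star_diskPoly (γ : ℝ) (p q : ℕ) (a b : ℂ) :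
    (starRingEnd ℂ) (diskPoly γ p q a b) =
      diskPoly γ p q ((starRingEnd ℂ) a) ((starRingEnd ℂ) b) := by
  simp [diskPoly, map_sum]

/-- Homogeneity: with `u = v⁻¹` on the unit circle, this is the behaviour under rotations. -/
theorem diskPoly_mul_mul (γ : ℝ) (p q : ℕ) (a b u v : ℂ) (huv : u * v = 1) (h : q ≤ p) :
    diskPoly γ p q (u * a) (v * b) = u ^ (p - q) * diskPoly γ p q a b := by
  simp only [diskPoly, Finset.mul_sum]
  refine Finset.sum_congr rfl fun k hk => ?_
  have hk : k ≤ q := by simpa [Nat.lt_succ_iff] using hk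
  have : p - k = (p - q) + (q - k) := by omega
  rw [this, mul_pow, mul_pow, pow_add u]
  have h1 : u ^ (q - k) * v ^ (q - k) = 1 := by rw [← mul_pow, huv, one_pow]
  linear_combination
    (diskCoeff γ p q k : ℂ) * a ^ (p - q + (q - k)) * b ^ (q - k) * u ^ (p - q) * h1

theorem diskCoeff_mul_sub (γ : ℝ) (p q k : ℕ) :
    diskCoeff γ p q k * ((p - k : ℕ) : ℝ) = p * diskCoeff (γ + 1) (p - 1) q k := by
  rcases Nat.lt_or_ge p k with h | h
  · rw [diskCoeff_of_lt_left γ q h, diskCoeff_of_lt_left (γ + 1) q (by omega)]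
    ring
  · rcases p with _ | p
    · simp
    · have e : ((p + 1 : ℕ).descFactorial k) * (p + 1 - k) = (p + 1) * p.descFactorial k := by
        have := Nat.succ_descFactorial p k
        rw [← this, mul_comm]
      have e' : ((p + 1 : ℕ).descFactorial k : ℝ) * ((p + 1 - k : ℕ) : ℝ)
          = ((p + 1 : ℕ) : ℝ) * p.descFactorial k := by exact_mod_cast e
      simp only [diskCoeff, Nat.add_sub_cancel]
      have g : ((p + 1 : ℕ) : ℝ) + q - k + 1 + γ = p + q - k + 1 + (γ + 1) := by
        push_cast; ring
      rw [g]
      linear_combination (-1) ^ k * (q.choose k : ℝ) * Real.Gamma (p + q - k + 1 + (γ + 1)) * e'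

/-- Lowering: `∂/∂a` of a disk polynomial, written as a sum over its monomials. -/
theorem sum_deriv_left (γ : ℝ) (p q : ℕ) (a b : ℂ) :
    ∑ k ∈ Finset.range (q + 1), (diskCoeff γ p q k : ℂ) *
        (((p - k : ℕ) : ℂ) * a ^ (p - k - 1) * b ^ (q - k))
      = p * diskPoly (γ + 1) (p - 1) q a b := by
  simp only [diskPoly, Finset.mul_sum]
  refine Finset.sum_congr rfl fun k _ => ?_
  have h : (diskCoeff γ p q k : ℂ) * ((p - k : ℕ) : ℂ) =
      p * (diskCoeff (γ + 1) (p - 1) q k : ℂ) := by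
    exact_mod_cast congrArg (fun x : ℝ => (x : ℂ)) (diskCoeff_mul_sub γ p q k)
  rw [show p - k - 1 = p - 1 - k by omega]
  linear_combination a ^ (p - 1 - k) * b ^ (q - k) * h

/-- Lowering in the second variable. -/
theorem sum_deriv_right (γ : ℝ) (p q : ℕ) (a b : ℂ) :
    ∑ k ∈ Finset.range (q + 1), (diskCoeff γ p q k : ℂ) *
        (((q - k : ℕ) : ℂ) * b ^ (q - k - 1) * a ^ (p - k))
      = q * diskPoly (γ + 1) p (q - 1) a b := by
  rw [diskPoly_eq_sum_range (γ + 1) p (q - 1) a b (N := q + 1) (by omega), Finset.mul_sum]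
  refine Finset.sum_congr rfl fun k _ => ?_
  have h : (diskCoeff γ p q k : ℂ) * ((q - k : ℕ) : ℂ) =
      q * (diskCoeff (γ + 1) p (q - 1) k : ℂ) := by
    have := diskCoeff_mul_sub γ q p k
    rw [diskCoeff_comm γ q p, diskCoeff_comm (γ + 1) (q - 1) p] at this
    exact_mod_cast congrArg (fun x : ℝ => (x : ℂ)) this
  rw [show q - k - 1 = q - 1 - k by omega]
  linear_combination a ^ (p - k) * b ^ (q - 1 - k) * h

/-- Raising: the polynomial form of
`∂_b ((1 - ab)^{γ+1} Q^{γ+1}_{p,q}) = -(q + γ + 1) (1 - ab)^γ Q^γ_{p+1,q}`. -/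
theorem diskPoly_raise (γ : ℝ) (hγ : 0 ≤ γ) (p q : ℕ) (a b : ℂ) :
    (γ + 1) * a * diskPoly (γ + 1) p q a b
        - (1 - a * b) * (q * diskPoly (γ + 2) p (q - 1) a b)
      = (q + γ + 1) * diskPoly γ (p + 1) q a b := by
  have h1 : (q : ℂ) * diskPoly (γ + 2) p (q - 1) a b =
      ∑ k ∈ Finset.range (q + 1), (diskCoeff (γ + 1) p q k : ℂ) *
        (((q - k : ℕ) : ℂ) * b ^ (q - k - 1) * a ^ (p - k)) := by
    rw [sum_deriv_right]
    ring_nf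
  -- the summand of index `k` contributes to `a ^ (p - k)`, which has index `k + 1` on the right
  let f : ℕ → ℂ := fun k => match k with
    | 0 => 0
    | k + 1 => (diskCoeff (γ + 1) p q k : ℂ) *
        (((q - k : ℕ) : ℂ) * b ^ (q - k - 1) * a ^ (p - k))
  have h2 : ∑ k ∈ Finset.range (q + 1), (diskCoeff (γ + 1) p q k : ℂ) *
        (((q - k : ℕ) : ℂ) * b ^ (q - k - 1) * a ^ (p - k)) = ∑ k ∈ Finset.range (q + 1), f k := by
    rw [Finset.sum_range_succ' f, Finset.sum_range_succ]
    simp [f]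
  have h3 : (1 - a * b) * (q * diskPoly (γ + 2) p (q - 1) a b) =
      ∑ k ∈ Finset.range (q + 1), f k - a * b * ∑ k ∈ Finset.range (q + 1),
        (diskCoeff (γ + 1) p q k : ℂ) * (((q - k : ℕ) : ℂ) * b ^ (q - k - 1) * a ^ (p - k)) := by
    rw [← h2, ← h1]; ring
  rw [h3]
  simp only [diskPoly, Finset.mul_sum, ← Finset.sum_sub_distrib]
  refine Finset.sum_congr rfl fun k hk => ?_
  have hkq : k ≤ q := by simpa [Nat.lt_succ_iff] using hk
  rcases Nat.lt_or_ge (p + 1) k with hp | hp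
  · have hk0 : k ≠ 0 := by omega
    obtain ⟨m, rfl⟩ := Nat.exists_eq_succ_of_ne_zero hk0
    simp [f, diskCoeff_of_lt_left γ q hp, diskCoeff_of_lt_left (γ + 1) q (show p < m by omega),
      diskCoeff_of_lt_left (γ + 1) q (show p < m + 1 by omega)]
  -- `G` is the common Gamma factor of the coefficients involved
  set G : ℝ := Real.Gamma (p + q - k + 2 + γ) with hG
  have c1 : diskCoeff (γ + 1) p q k = (-1) ^ k * p.descFactorial k * q.choose k * G := by
    rw [diskCoeff, hG]; ring_nf
  have c2 : diskCoeff γ (p + 1) q k = (-1) ^ k * (p + 1).descFactorial k * q.choose k * G := by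
    rw [diskCoeff, hG]; push_cast; ring_nf
  have hfk : f k = ((-1 : ℝ) ^ k * (-k) * (p + 1).descFactorial k * q.choose k
      * ((p + q - k + 2 + γ) / (p + 1) * G) : ℝ) * (b ^ (q - k) * a ^ (p + 1 - k)) := by
    rcases k with _ | m
    · simp [f]
    · have hm : m + 1 ≤ q := hkq
      have c3 : diskCoeff (γ + 1) p q m = (-1) ^ m * p.descFactorial m * q.choose m *
          ((p + q - (m + 1) + 2 + γ) * G) := by
        rw [hG, diskCoeff, show (p : ℝ) + q - m + 1 + (γ + 1) =
          (p + q - ((m + 1 : ℕ) : ℝ) + 2 + γ) + 1 by push_cast; ring, Real.Gamma_add_one]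
        · push_cast; ring
        · have : ((m + 1 : ℕ) : ℝ) ≤ q := by exact_mod_cast hm
          have : (0 : ℝ) ≤ p := Nat.cast_nonneg p
          have : 0 < (p : ℝ) + q - ((m + 1 : ℕ) : ℝ) + 2 + γ := by linarith
          exact this.ne'
      have e1 : ((p + 1).descFactorial (m + 1) : ℝ) = (p + 1) * p.descFactorial m := by
        exact_mod_cast Nat.succ_descFactorial_succ p m
      have e2 : (q.choose (m + 1) : ℝ) * (m + 1) = q.choose m * ((q - m : ℕ) : ℝ) := by
        exact_mod_cast Nat.choose_succ_right_eq q m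
      have e3 : (p : ℝ) + 1 ≠ 0 := by positivity
      simp only [f, c3]
      rw [show q - m - 1 = q - (m + 1) by omega, show p + 1 - (m + 1) = p - m by omega]
      have : (-1 : ℝ) ^ m * p.descFactorial m * q.choose m * ((p + q - (m + 1) + 2 + γ) * G)
          * ((q - m : ℕ) : ℝ) = ((-1 : ℝ) ^ (m + 1) * (-((m + 1 : ℕ) : ℝ)) *
            (p + 1).descFactorial (m + 1) * q.choose (m + 1)
            * ((p + q - ((m + 1 : ℕ) : ℝ) + 2 + γ) / (p + 1) * G) : ℝ) := by
        rw [e1]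
        field_simp
        push_cast
        linear_combination (-1 : ℝ) ^ m * (-p.descFactorial m) *
          ((p + q - (m + 1) + 2 + γ)) * G * e2
      rw [← this]
      push_cast
      ring
  have e4 : ((p + 1).descFactorial k : ℝ) * (p + 1 - k) = (p + 1) * p.descFactorial k := by
    have := Nat.succ_descFactorial p k
    have h5 : ((p + 1 - k : ℕ) : ℝ) * (p + 1).descFactorial k = (p + 1) * p.descFactorial k := by
      exact_mod_cast this
    rw [← h5, Nat.cast_sub hp]
    push_cast; ring
  have e4' : (p.descFactorial k : ℝ) = (p + 1).descFactorial k * (p + 1 - k) / (p + 1) := by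
    rw [e4]; field_simp
  -- the monomials agree where the coefficients do not vanish
  have m1 : (diskCoeff (γ + 1) p q k : ℂ) * (a * a ^ (p - k)) =
      (diskCoeff (γ + 1) p q k : ℂ) * a ^ (p + 1 - k) := by
    rcases Nat.lt_or_ge p k with h | h
    · simp [diskCoeff_of_lt_left (γ + 1) q h]
    · rw [show p + 1 - k = (p - k) + 1 by omega, pow_succ']
  have m2 : ((q - k : ℕ) : ℂ) * (b * b ^ (q - k - 1)) = (q - k) * b ^ (q - k) := by
    rcases Nat.eq_or_lt_of_le hkq with h | h
    · simp [h]
    · rw [Nat.cast_sub hkq, ← pow_succ', show q - k - 1 + 1 = q - k by omega]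
  have key : (γ + 1) * diskCoeff (γ + 1) p q k + (q - k) * diskCoeff (γ + 1) p q k
      - ((-1 : ℝ) ^ k * (-k) * (p + 1).descFactorial k * q.choose k
      * ((p + q - k + 2 + γ) / (p + 1) * G)) = (q + γ + 1) * diskCoeff γ (p + 1) q k := by
    rw [c1, c2, e4']
    field_simp
    ring
  have keyC : ((γ : ℂ) + 1) * diskCoeff (γ + 1) p q k + (q - k) * diskCoeff (γ + 1) p q k
      - ((-1 : ℝ) ^ k * (-k) * (p + 1).descFactorial k * q.choose k
      * ((p + q - k + 2 + γ) / (p + 1) * G) : ℝ) = (q + γ + 1) * diskCoeff γ (p + 1) q k := by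
    exact_mod_cast congrArg (fun x : ℝ => (x : ℂ)) key
  rw [hfk]
  linear_combination (γ + 1) * b ^ (q - k) * m1 + (q - k) * b ^ (q - k) * m1
    + (diskCoeff (γ + 1) p q k : ℂ) * (a * a ^ (p - k)) * m2 + a ^ (p + 1 - k) * b ^ (q - k) * keyC

/-! ### Disk polynomials as functions on the disk -/

/-- The defining function `1 - r²` of the disk. -/
def diskW (p : ℝ × ℝ) : ℝ := 1 - (p.1 ^ 2 + p.2 ^ 2)

theorem diskW_pos {p : ℝ × ℝ} (hp : p ∈ Disk) : 0 < diskW p := sub_pos.2 hp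

theorem diskW_le_one (p : ℝ × ℝ) : diskW p ≤ 1 := by
  unfold diskW; nlinarith [sq_nonneg p.1, sq_nonneg p.2]

theorem contDiff_diskW : ContDiff ℝ (⊤ : ℕ∞) diskW := by unfold diskW; fun_prop

/-- The complex coordinate `z = x + iy`, as a real linear map. -/
def zMap : ℝ × ℝ →L[ℝ] ℂ := Complex.equivRealProdCLM.symm.toContinuousLinearMap

/-- The conjugate coordinate `x - iy`, as a real linear map. -/
def zbarMap : ℝ × ℝ →L[ℝ] ℂ := (Complex.conjCLE : ℂ →L[ℝ] ℂ).comp zMap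

theorem zMap_apply (p : ℝ × ℝ) : zMap p = ⟨p.1, p.2⟩ := by
  apply Complex.ext <;> simp [zMap]

theorem zbarMap_apply (p : ℝ × ℝ) : zbarMap p = (starRingEnd ℂ) (zMap p) := rfl

@[simp] theorem zMap_one_zero : zMap (1, 0) = 1 := by rw [zMap_apply]; rfl
@[simp] theorem zMap_zero_one : zMap (0, 1) = Complex.I := by rw [zMap_apply]; rfl
@[simp] theorem zbarMap_one_zero : zbarMap (1, 0) = 1 := by simp [zbarMap_apply]
@[simp] theorem zbarMap_zero_one : zbarMap (0, 1) = -Complex.I := by simp [zbarMap_apply]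

theorem zMap_mul_zbarMap (p : ℝ × ℝ) : zMap p * zbarMap p = ((p.1 ^ 2 + p.2 ^ 2 : ℝ) : ℂ) := by
  rw [zbarMap_apply, Complex.mul_conj, zMap_apply, Complex.normSq_mk]
  ring_nf

theorem one_sub_zMap_mul_zbarMap (p : ℝ × ℝ) : 1 - zMap p * zbarMap p = (diskW p : ℂ) := by
  rw [zMap_mul_zbarMap, diskW]; push_cast; ring

/-- The disk polynomial of bidegree `(p, q)` as a function on the plane. -/
def diskFun (γ : ℝ) (m n : ℕ) (p : ℝ × ℝ) : ℂ := diskPoly γ m n (zMap p) (zbarMap p)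

theorem contDiff_diskFun (γ : ℝ) (m n : ℕ) : ContDiff ℝ (⊤ : ℕ∞) (diskFun γ m n) := by
  unfold diskFun diskPoly
  exact ContDiff.sum fun k _ => contDiff_const.mul
    ((zMap.contDiff.pow _).mul (zbarMap.contDiff.pow _))

theorem hasFDerivAt_diskFun (γ : ℝ) (m n : ℕ) (p : ℝ × ℝ) :
    HasFDerivAt (diskFun γ m n)
      ((m * diskFun (γ + 1) (m - 1) n p) • zMap + (n * diskFun (γ + 1) m (n - 1) p) • zbarMap)
      p := by
  have h : HasFDerivAt (diskFun γ m n) (∑ k ∈ Finset.range (n + 1),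
      (diskCoeff γ m n k : ℂ) • (zMap p ^ (m - k) •
          (((n - k : ℕ) * zbarMap p ^ (n - k - 1) : ℂ) • zbarMap)
        + zbarMap p ^ (n - k) • (((m - k : ℕ) * zMap p ^ (m - k - 1) : ℂ) • zMap))) p := by
    unfold diskFun diskPoly
    refine HasFDerivAt.fun_sum fun k _ => ?_
    refine HasFDerivAt.const_mul ?_ _
    have h1 := (zMap.hasFDerivAt (x := p)).pow (m - k)
    have h2 := (zbarMap.hasFDerivAt (x := p)).pow (n - k)
    exact (h1.mul h2).congr_fderiv (by simp)
  refine h.congr_fderiv ?_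
  symm
  unfold diskFun
  rw [← sum_deriv_left, ← sum_deriv_right]
  refine ContinuousLinearMap.ext fun v => ?_
  simp only [add_apply, smul_apply, sum_apply, smul_eq_mul, Finset.sum_mul,
    ← Finset.sum_add_distrib]
  exact Finset.sum_congr rfl fun k _ => by ring

theorem dirDeriv_diskFun_x (γ : ℝ) (m n : ℕ) :
    dirDeriv (1, 0) (diskFun γ m n) = fun p =>
      (m * diskFun (γ + 1) (m - 1) n p + n * diskFun (γ + 1) m (n - 1) p) := by
  ext1 p
  simp [dirDeriv, (hasFDerivAt_diskFun γ m n p).fderiv]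

theorem dirDeriv_diskFun_y (γ : ℝ) (m n : ℕ) :
    dirDeriv (0, 1) (diskFun γ m n) = fun p =>
      (m * Complex.I * diskFun (γ + 1) (m - 1) n p
        + -(n * Complex.I) * diskFun (γ + 1) m (n - 1) p) := by
  ext1 p
  simp [dirDeriv, (hasFDerivAt_diskFun γ m n p).fderiv]
  ring

theorem hasFDerivAt_diskW (p : ℝ × ℝ) :
    HasFDerivAt diskW (-((2 * p.1) • ContinuousLinearMap.fst ℝ ℝ ℝ
      + (2 * p.2) • ContinuousLinearMap.snd ℝ ℝ ℝ)) p := by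
  have h1 := (hasFDerivAt_fst (𝕜 := ℝ) (p := p)).pow 2
  have h2 := (hasFDerivAt_snd (𝕜 := ℝ) (p := p)).pow 2
  have := (h1.add h2).const_sub 1
  exact this.congr_fderiv (by simp)

theorem contDiffOn_rpow_diskW (β : ℝ) :
    ContDiffOn ℝ (⊤ : ℕ∞) (fun p => diskW p ^ β) Disk :=
  contDiff_diskW.contDiffOn.rpow_const_of_ne fun _ hp => (diskW_pos hp).ne'

/-- The derivative of `(1 - r²)^{γ+1} f` in a direction `v`. -/
theorem dirDeriv_rpow_mul (γ : ℝ) {p : ℝ × ℝ} (hp : p ∈ Disk) {f : ℝ × ℝ → ℂ}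
    (hf : DifferentiableAt ℝ f p) (v : ℝ × ℝ) :
    dirDeriv v (fun p => ((diskW p ^ (γ + 1) : ℝ) : ℂ) * f p) p =
      ((diskW p ^ γ : ℝ) : ℂ) * (diskW p * dirDeriv v f p
        - (γ + 1) * ((2 * p.1 * v.1 + 2 * p.2 * v.2 : ℝ) : ℂ) * f p) := by
  have h0 := diskW_pos hp
  have h1 := (hasFDerivAt_diskW p).rpow_const (p := γ + 1) (Or.inl h0.ne')
  have h2 := h1.smul hf.hasFDerivAt
  have h3 : (fun p => ((diskW p ^ (γ + 1) : ℝ) : ℂ) * f p) =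
      fun p => (diskW p ^ (γ + 1)) • f p := by ext1 q; simp
  have h4 : dirDeriv v (fun p => (diskW p ^ (γ + 1)) • f p) p = _ :=
    congrArg (fun A => A v) h2.fderiv
  rw [h3, h4, Real.rpow_add_one h0.ne']
  simp [dirDeriv]
  ring

/-- Raising of disk functions: the operator `∂x + i ∂y` removes a factor `1 - r²`. -/
theorem dirDeriv_rpow_mul_diskFun_left (γ : ℝ) (hγ : 0 ≤ γ) (m n : ℕ) {p : ℝ × ℝ}
    (hp : p ∈ Disk) :
    dirDeriv (1, 0) (fun p => ((diskW p ^ (γ + 1) : ℝ) : ℂ) * diskFun (γ + 1) m n p) p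
      + Complex.I * dirDeriv (0, 1)
        (fun p => ((diskW p ^ (γ + 1) : ℝ) : ℂ) * diskFun (γ + 1) m n p) p
      = -(2 * (n + γ + 1)) * ((diskW p ^ γ : ℝ) * diskFun γ (m + 1) n p) := by
  have hd := (hasFDerivAt_diskFun (γ + 1) m n p).differentiableAt
  rw [dirDeriv_rpow_mul γ hp hd, dirDeriv_rpow_mul γ hp hd, dirDeriv_diskFun_x, dirDeriv_diskFun_y]
  have hr := diskPoly_raise γ hγ m n (zMap p) (zbarMap p)
  rw [one_sub_zMap_mul_zbarMap] at hr
  have hz : zMap p = p.1 + p.2 * Complex.I := by rw [zMap_apply, Complex.mk_eq_add_mul_I]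
  simp only [diskFun]
  rw [show γ + 1 + 1 = γ + 2 by ring]
  push_cast
  linear_combination (-2 : ℂ) * ((diskW p ^ γ : ℝ) : ℂ) * hr
    + 2 * ((diskW p ^ γ : ℝ) : ℂ) * (γ + 1) * diskPoly (γ + 1) m n (zMap p) (zbarMap p) * hz
    + ((diskW p ^ γ : ℝ) : ℂ) * diskW p * (m * diskPoly (γ + 2) (m - 1) n (zMap p) (zbarMap p)
      - n * diskPoly (γ + 2) m (n - 1) (zMap p) (zbarMap p)) * Complex.I_sq

/-- Raising in the other variable, by the operator `∂x - i ∂y`. -/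
theorem dirDeriv_rpow_mul_diskFun_right (γ : ℝ) (hγ : 0 ≤ γ) (m n : ℕ) {p : ℝ × ℝ}
    (hp : p ∈ Disk) :
    dirDeriv (1, 0) (fun p => ((diskW p ^ (γ + 1) : ℝ) : ℂ) * diskFun (γ + 1) m n p) p
      - Complex.I * dirDeriv (0, 1)
        (fun p => ((diskW p ^ (γ + 1) : ℝ) : ℂ) * diskFun (γ + 1) m n p) p
      = -(2 * (m + γ + 1)) * ((diskW p ^ γ : ℝ) * diskFun γ m (n + 1) p) := by
  have hd := (hasFDerivAt_diskFun (γ + 1) m n p).differentiableAt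
  rw [dirDeriv_rpow_mul γ hp hd, dirDeriv_rpow_mul γ hp hd, dirDeriv_diskFun_x, dirDeriv_diskFun_y]
  have hr := diskPoly_raise γ hγ n m (zbarMap p) (zMap p)
  rw [mul_comm (zbarMap p) (zMap p), one_sub_zMap_mul_zbarMap, diskPoly_comm _ n m,
    diskPoly_comm _ n (m - 1), diskPoly_comm _ (n + 1) m] at hr
  have hz : zbarMap p = p.1 - p.2 * Complex.I := by
    rw [zbarMap_apply, zMap_apply, Complex.mk_eq_add_mul_I]; simp [sub_eq_add_neg]
  simp only [diskFun]
  rw [show γ + 1 + 1 = γ + 2 by ring]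
  push_cast
  linear_combination (-2 : ℂ) * ((diskW p ^ γ : ℝ) : ℂ) * hr
    + 2 * ((diskW p ^ γ : ℝ) : ℂ) * (γ + 1) * diskPoly (γ + 1) m n (zMap p) (zbarMap p) * hz
    - ((diskW p ^ γ : ℝ) : ℂ) * diskW p * (m * diskPoly (γ + 2) (m - 1) n (zMap p) (zbarMap p)
      - n * diskPoly (γ + 2) m (n - 1) (zMap p) (zbarMap p)) * Complex.I_sq

/-! ### Eigenvalues of the Sobolev forms -/

/-- The eigenvalue of the Sobolev form of order `s` on disk polynomials of bidegree `(m, n)`. For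
`m = 0` or `n = 0` the truncated subtraction is harmless, as the term has the factor `0`. -/
def eigenvalue : ℕ → ℝ → ℕ → ℕ → ℝ
  | 0, _, _, _ => 1
  | s + 1, γ, m, n => 2 * (m * (n + γ + 1) * eigenvalue s (γ + 1) (m - 1) n
      + n * (m + γ + 1) * eigenvalue s (γ + 1) m (n - 1))

theorem eigenvalue_nonneg (s : ℕ) {γ : ℝ} (hγ : 0 ≤ γ) (m n : ℕ) : 0 ≤ eigenvalue s γ m n := by
  induction s generalizing γ m n with
  | zero => simp [eigenvalue]
  | succ s ih =>
    have h1 := ih (γ := γ + 1) (by positivity) (m - 1) n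
    have h2 := ih (γ := γ + 1) (by positivity) m (n - 1)
    rw [eigenvalue]
    positivity

/-- Each step of the recursion contributes at most a multiple of `(m + 1) (n + 1)`. -/
theorem eigenvalue_le (s : ℕ) {γ : ℝ} (hγ : 0 ≤ γ) :
    ∃ C : ℝ, 0 < C ∧ ∀ m n : ℕ, eigenvalue s γ m n ≤ C * (((m : ℝ) + 1) * (n + 1)) ^ s := by
  induction s generalizing γ with
  | zero => exact ⟨1, one_pos, fun m n => by simp [eigenvalue]⟩
  | succ s ih =>
    obtain ⟨C, hC, h⟩ := ih (γ := γ + 1) (by positivity)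
    refine ⟨4 * (γ + 1) * C, by positivity, fun m n => ?_⟩
    set A : ℝ := ((m : ℝ) + 1) * (n + 1) with hA
    have hA0 : 0 < A := by positivity
    have b1 : eigenvalue s (γ + 1) (m - 1) n ≤ C * A ^ s := by
      refine (h _ _).trans ?_
      have : ((m - 1 : ℕ) : ℝ) ≤ m := by exact_mod_cast Nat.sub_le m 1
      rw [hA]
      gcongr
    have b2 : eigenvalue s (γ + 1) m (n - 1) ≤ C * A ^ s := by
      refine (h _ _).trans ?_
      have : ((n - 1 : ℕ) : ℝ) ≤ n := by exact_mod_cast Nat.sub_le n 1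
      rw [hA]
      gcongr
    have c1 : (m : ℝ) * (n + γ + 1) ≤ (γ + 1) * A := by
      have hm : (0 : ℝ) ≤ m := Nat.cast_nonneg m
      have hn : (0 : ℝ) ≤ n := Nat.cast_nonneg n
      have := mul_nonneg hm hn
      have := mul_nonneg hγ hn
      have := mul_nonneg hγ this
      have := mul_nonneg (mul_nonneg hγ hm) hn
      rw [hA]; nlinarith
    have c2 : (n : ℝ) * (m + γ + 1) ≤ (γ + 1) * A := by
      have hm : (0 : ℝ) ≤ m := Nat.cast_nonneg m
      have hn : (0 : ℝ) ≤ n := Nat.cast_nonneg n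
      have := mul_nonneg hm hn
      have := mul_nonneg hγ hm
      have := mul_nonneg (mul_nonneg hγ hm) hn
      rw [hA]; nlinarith
    have d1 := mul_le_mul c1 b1 (eigenvalue_nonneg s (by positivity) _ _) (by positivity)
    have d2 := mul_le_mul c2 b2 (eigenvalue_nonneg s (by positivity) _ _) (by positivity)
    rw [eigenvalue]
    calc _ ≤ 2 * ((γ + 1) * A * (C * A ^ s) + (γ + 1) * A * (C * A ^ s)) := by linarith
      _ = 4 * (γ + 1) * C * A ^ (s + 1) := by ring

/-- Only the branch of the recursion which lowers `m` is kept. -/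
theorem descFactorial_mul_pow_le_eigenvalue (s : ℕ) {γ : ℝ} (hγ : 0 ≤ γ) (m n : ℕ) :
    (m.descFactorial s : ℝ) * (n + 1) ^ s ≤ eigenvalue s γ m n := by
  induction s generalizing γ m n with
  | zero => simp [eigenvalue]
  | succ s ih =>
    have h1 := ih (γ := γ + 1) (by positivity) (m - 1) n
    have h2 := eigenvalue_nonneg s (γ := γ + 1) (by positivity) m (n - 1)
    have h3 := eigenvalue_nonneg s (γ := γ + 1) (by positivity) (m - 1) n
    have e : (m.descFactorial (s + 1) : ℝ) = m * (m - 1).descFactorial s := by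
      rcases m with _ | m
      · simp
      · exact_mod_cast Nat.succ_descFactorial_succ m s
    rw [e, eigenvalue]
    have hn : (n : ℝ) + 1 ≤ n + γ + 1 := by linarith
    calc (m : ℝ) * (m - 1).descFactorial s * (n + 1) ^ (s + 1)
        = m * (n + 1) * ((m - 1).descFactorial s * (n + 1) ^ s) := by ring
      _ ≤ m * (n + γ + 1) * eigenvalue s (γ + 1) (m - 1) n := by gcongr
      _ ≤ _ := by
        have : 0 ≤ (m : ℝ) * (n + γ + 1) * eigenvalue s (γ + 1) (m - 1) n := by positivity
        have : 0 ≤ (n : ℝ) * (m + γ + 1) * eigenvalue s (γ + 1) m (n - 1) := by positivity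
        linarith

/-- For `n ≤ m` the eigenvalue, increased by one, is bounded below by a multiple of
`((m + 1) (n + 1))^s`. -/
theorem le_one_add_eigenvalue (s : ℕ) :
    ∃ c : ℝ, 0 < c ∧ ∀ (γ : ℝ), 0 ≤ γ → ∀ m n : ℕ, n ≤ m →
      c * (((m : ℝ) + 1) * (n + 1)) ^ s ≤ 1 + eigenvalue s γ m n := by
  refine ⟨(((s : ℝ) + 1) ^ (2 * s))⁻¹, by positivity, fun γ hγ m n hnm => ?_⟩
  rw [inv_mul_le_iff₀ (by positivity)]
  have h0 := eigenvalue_nonneg s hγ m n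
  rcases Nat.lt_or_ge m s with h | h
  · -- both indices are bounded in terms of `s`
    have a1 : ((m : ℝ) + 1) ≤ s + 1 := by
      have : (m : ℝ) ≤ s := by exact_mod_cast h.le
      linarith
    have a2 : ((n : ℝ) + 1) ≤ s + 1 := by
      have : (n : ℝ) ≤ s := by exact_mod_cast (hnm.trans h.le)
      linarith
    calc (((m : ℝ) + 1) * (n + 1)) ^ s ≤ (((s : ℝ) + 1) * (s + 1)) ^ s := by gcongr
      _ = ((s : ℝ) + 1) ^ (2 * s) * 1 := by rw [mul_one, pow_mul]; ring
      _ ≤ _ := by gcongr; linarith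
  · have h1 := descFactorial_mul_pow_le_eigenvalue s hγ m n
    have h2 : ((m : ℝ) + 1) ^ s ≤ (s + 1) ^ s * m.descFactorial s := by
      have e1 : ((m + 1 - s : ℕ) : ℝ) ^ s ≤ m.descFactorial s := by
        exact_mod_cast Nat.pow_sub_le_descFactorial m s
      have e2 : ((m : ℝ) + 1) ≤ (s + 1) * ((m + 1 - s : ℕ) : ℝ) := by
        rw [Nat.cast_sub (by omega)]
        have : (s : ℝ) ≤ m := by exact_mod_cast h
        push_cast
        nlinarith [Nat.cast_nonneg (α := ℝ) s]
      calc ((m : ℝ) + 1) ^ s ≤ ((s + 1) * ((m + 1 - s : ℕ) : ℝ)) ^ s := by gcongr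
        _ = (s + 1) ^ s * ((m + 1 - s : ℕ) : ℝ) ^ s := mul_pow _ _ _
        _ ≤ _ := by gcongr
    calc (((m : ℝ) + 1) * (n + 1)) ^ s = ((m : ℝ) + 1) ^ s * (n + 1) ^ s := mul_pow _ _ _
      _ ≤ (s + 1) ^ s * m.descFactorial s * (n + 1) ^ s := by gcongr
      _ = (s + 1) ^ s * (m.descFactorial s * (n + 1) ^ s) := by ring
      _ ≤ (s + 1) ^ s * (1 + eigenvalue s γ m n) := by gcongr; linarith
      _ ≤ _ := by
        gcongr
        · linarith [Nat.cast_nonneg (α := ℝ) s]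
        · omega

theorem formOp_const_mul (s : ℕ) {W : ℝ × ℝ → ℝ} (hW : ContDiffOn ℝ (⊤ : ℕ∞) W Disk) (c : ℂ)
    {f : ℝ × ℝ → ℂ} (hf : ContDiffOn ℝ (⊤ : ℕ∞) f Disk) :
    EqOn (formOp s W (fun p => c * f p)) (fun p => c * formOp s W f p) Disk := by
  have := formOp_clm isOpen_disk s hW (c • ContinuousLinearMap.id ℝ ℂ) hf
  simpa using this

/-- Disk functions are eigenfunctions of the differential operators of all Sobolev forms. -/
theorem formOp_diskFun (s : ℕ) {γ : ℝ} (hγ : 0 ≤ γ) (m n : ℕ) :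
    EqOn (formOp s (fun p => diskW p ^ (γ + s)) (diskFun γ m n))
      (fun p => ((-1) ^ s * eigenvalue s γ m n : ℝ) * (((diskW p ^ γ : ℝ) : ℂ) * diskFun γ m n p))
      Disk := by
  induction s generalizing γ m n with
  | zero =>
    intro p _
    simp [formOp, eigenvalue]
  | succ s ih =>
    intro p hp
    have hγ1 : 0 ≤ γ + 1 := by positivity
    have hW : ContDiffOn ℝ (⊤ : ℕ∞) (fun p => diskW p ^ (γ + 1 + s)) Disk :=
      contDiffOn_rpow_diskW _
    rw [show γ + ((s + 1 : ℕ) : ℝ) = γ + 1 + s by push_cast; ring]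
    rw [formOp_succ isOpen_disk s hW (contDiff_diskFun γ m n).contDiffOn hp]
    have hc : ∀ m n, ContDiffOn ℝ (⊤ : ℕ∞) (diskFun (γ + 1) m n) Disk := fun m n =>
      (contDiff_diskFun (γ + 1) m n).contDiffOn
    -- the order `s` operator on a combination of two disk functions, and its derivatives
    have hw1 : ∀ m n, ContDiffOn ℝ (⊤ : ℕ∞)
        (fun p => ((diskW p ^ (γ + 1) : ℝ) : ℂ) * diskFun (γ + 1) m n p) Disk := fun m n => by
      refine ((contDiffOn_rpow_diskW (γ + 1)).smul (hc m n)).congr fun q _ => ?_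
      simp
    have key : ∀ (a b : ℂ) (v : ℝ × ℝ),
        dirDeriv v (formOp s (fun p => diskW p ^ (γ + 1 + s))
          (fun p => a * diskFun (γ + 1) (m - 1) n p + b * diskFun (γ + 1) m (n - 1) p)) p =
        a * ((-1) ^ s * eigenvalue s (γ + 1) (m - 1) n : ℝ) *
          dirDeriv v (fun p => ((diskW p ^ (γ + 1) : ℝ) : ℂ) * diskFun (γ + 1) (m - 1) n p) p
        + b * ((-1) ^ s * eigenvalue s (γ + 1) m (n - 1) : ℝ) *
          dirDeriv v (fun p => ((diskW p ^ (γ + 1) : ℝ) : ℂ) * diskFun (γ + 1) m (n - 1) p) p := by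
      intro a b v
      have e1 : EqOn (formOp s (fun p => diskW p ^ (γ + 1 + s))
          (fun p => a * diskFun (γ + 1) (m - 1) n p + b * diskFun (γ + 1) m (n - 1) p))
          (fun p => a * ((-1) ^ s * eigenvalue s (γ + 1) (m - 1) n : ℝ) *
              (((diskW p ^ (γ + 1) : ℝ) : ℂ) * diskFun (γ + 1) (m - 1) n p)
            + b * ((-1) ^ s * eigenvalue s (γ + 1) m (n - 1) : ℝ) *
              (((diskW p ^ (γ + 1) : ℝ) : ℂ) * diskFun (γ + 1) m (n - 1) p)) Disk := by
        intro q hq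
        refine (formOp_add isOpen_disk s hW (contDiffOn_const.mul (hc _ _))
          (contDiffOn_const.mul (hc _ _)) hq).trans ?_
        beta_reduce
        rw [formOp_const_mul s hW a (hc _ _) hq, formOp_const_mul s hW b (hc _ _) hq]
        beta_reduce
        rw [ih hγ1 (m - 1) n hq, ih hγ1 m (n - 1) hq]
        ring
      rw [dirDeriv_congr isOpen_disk e1 v hp]
      refine (dirDeriv_add isOpen_disk (contDiffOn_const.mul (hw1 _ _))
        (contDiffOn_const.mul (hw1 _ _)) v hp).trans ?_
      have h1 := fun (c : ℂ) (m n : ℕ) =>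
        dirDeriv_clm isOpen_disk (c • ContinuousLinearMap.id ℝ ℂ) (hw1 m n) v hp
      simp only [smul_apply, ContinuousLinearMap.id_apply, smul_eq_mul] at h1
      simp only [h1]
    simp only [dirDeriv_diskFun_x, dirDeriv_diskFun_y, key]
    rw [eigenvalue]
    set X1 := dirDeriv (1, 0)
      (fun p => ((diskW p ^ (γ + 1) : ℝ) : ℂ) * diskFun (γ + 1) (m - 1) n p) p with hX1
    set Y1 := dirDeriv (0, 1)
      (fun p => ((diskW p ^ (γ + 1) : ℝ) : ℂ) * diskFun (γ + 1) (m - 1) n p) p with hY1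
    set X2 := dirDeriv (1, 0)
      (fun p => ((diskW p ^ (γ + 1) : ℝ) : ℂ) * diskFun (γ + 1) m (n - 1) p) p with hX2
    set Y2 := dirDeriv (0, 1)
      (fun p => ((diskW p ^ (γ + 1) : ℝ) : ℂ) * diskFun (γ + 1) m (n - 1) p) p with hY2
    -- raising brings the lowered functions back to bidegree `(m, n)`
    have r1 : (m : ℂ) * (X1 + Complex.I * Y1) =
        m * (-(2 * (n + γ + 1)) * ((diskW p ^ γ : ℝ) * diskFun γ m n p)) := by
      rcases m with _ | m
      · simp
      · rw [hX1, hY1, Nat.add_sub_cancel, dirDeriv_rpow_mul_diskFun_left γ hγ m n hp]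
    have r2 : (n : ℂ) * (X2 - Complex.I * Y2) =
        n * (-(2 * (m + γ + 1)) * ((diskW p ^ γ : ℝ) * diskFun γ m n p)) := by
      rcases n with _ | n
      · simp
      · rw [hX2, hY2, Nat.add_sub_cancel, dirDeriv_rpow_mul_diskFun_right γ hγ m n hp]
    push_cast
    linear_combination (-1) ^ s * (eigenvalue s (γ + 1) (m - 1) n : ℂ) * r1
      + (-1) ^ s * (eigenvalue s (γ + 1) m (n - 1) : ℂ) * r2

/-- Real parts of multiples of disk functions are eigenfunctions as well. -/
theorem formOp_re_diskFun (s : ℕ) {γ : ℝ} (hγ : 0 ≤ γ) (c : ℂ) (m n : ℕ) :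
    EqOn (formOp s (fun p => diskW p ^ (γ + s)) (fun p => (c * diskFun γ m n p).re))
      (fun p => (-1) ^ s * eigenvalue s γ m n * (diskW p ^ γ * (c * diskFun γ m n p).re))
      Disk := by
  intro p hp
  have h := formOp_clm isOpen_disk s (contDiffOn_rpow_diskW (γ + s))
    (Complex.reCLM.comp (c • ContinuousLinearMap.id ℝ ℂ)) (contDiff_diskFun γ m n).contDiffOn hp
  simp only [ContinuousLinearMap.comp_apply, smul_apply,
    ContinuousLinearMap.id_apply, smul_eq_mul, Complex.reCLM_apply] at h
  rw [h, formOp_diskFun s hγ m n hp]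
  beta_reduce
  rw [show c * ((((-1) ^ s * eigenvalue s γ m n : ℝ) : ℂ) *
      (((diskW p ^ γ : ℝ) : ℂ) * diskFun γ m n p)) =
      (((-1) ^ s * eigenvalue s γ m n * diskW p ^ γ : ℝ) : ℂ) * (c * diskFun γ m n p) by
    push_cast; ring, Complex.re_ofReal_mul]
  ring

open Filter Topology

/-! ### Truncated powers -/

/-- Smooth functions vanishing near `0` which approximate `x^{β+s}` together with the derivatives
up to order `s`, and satisfy the same bounds. They are `s`-fold primitives of smooth truncations of
a multiple of `x^β`, so that no derivative of the truncation enters. -/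
theorem exists_truncated_rpow {β : ℝ} (hβ : 0 ≤ β) (s : ℕ) :
    ∃ ψ : ℕ → ℝ → ℝ, (∀ n, ContDiff ℝ (⊤ : ℕ∞) (ψ n)) ∧
      (∀ n, ∃ ε > 0, ∀ x ≤ ε, ψ n x = 0) ∧
      (∃ C, ∀ n, ∀ k ≤ s, ∀ x > 0, |iteratedDeriv k (ψ n) x| ≤ C * x ^ (β + s - k)) ∧
      ∀ k ≤ s, ∀ x > 0, Tendsto (fun n => iteratedDeriv k (ψ n) x) atTop
        (𝓝 (iteratedDeriv k (fun t : ℝ => t ^ (β + s)) x)) := by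
  induction s with
  | zero =>
    refine ⟨fun n x => Real.smoothTransition ((n + 1) * x - 1) * x ^ β, fun n => ?_, fun n => ?_,
      ⟨1, fun n k hk x hx => ?_⟩, fun k hk x hx => ?_⟩
    · refine contDiff_iff_contDiffAt.2 fun x => ?_
      rcases le_or_gt x 0 with hx | hx
      · have hev : (fun x : ℝ => Real.smoothTransition ((n + 1) * x - 1) * x ^ β)
            =ᶠ[𝓝 x] fun _ => 0 := by
          have hlt : ((n : ℝ) + 1) * x - 1 < 0 := by nlinarith [Nat.cast_nonneg (α := ℝ) n]
          have : ∀ᶠ y in 𝓝 x, ((n : ℝ) + 1) * y - 1 < 0 :=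
            (by fun_prop : ContinuousAt (fun y : ℝ => ((n : ℝ) + 1) * y - 1) x).eventually_lt_const
              hlt
          filter_upwards [this] with y hy
          rw [Real.smoothTransition.zero_of_nonpos hy.le, zero_mul]
        exact contDiffAt_const.congr_of_eventuallyEq hev
      · refine ContDiffAt.mul ?_ (contDiffAt_id.rpow_const_of_ne hx.ne')
        exact (Real.smoothTransition.contDiff.comp
          ((contDiff_const.mul contDiff_id).sub contDiff_const)).contDiffAt
    · refine ⟨1 / (n + 1), by positivity, fun x hx => ?_⟩
      have : ((n : ℝ) + 1) * x - 1 ≤ 0 := by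
        have h := mul_le_mul_of_nonneg_left hx (show (0 : ℝ) ≤ (n : ℝ) + 1 by positivity)
        rw [mul_one_div_cancel (by positivity)] at h
        linarith
      simp [Real.smoothTransition.zero_of_nonpos this]
    · obtain rfl : k = 0 := by omega
      simp only [iteratedDeriv_zero, Nat.cast_zero, add_zero, sub_zero, one_mul]
      have hp : 0 ≤ x ^ β := Real.rpow_nonneg hx.le _
      rw [abs_of_nonneg (mul_nonneg (Real.smoothTransition.nonneg _) hp)]
      exact mul_le_of_le_one_left hp (Real.smoothTransition.le_one _)
    · obtain rfl : k = 0 := by omega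
      simp only [iteratedDeriv_zero, Nat.cast_zero, add_zero]
      refine tendsto_const_nhds.congr' ?_
      obtain ⟨N, hN⟩ := exists_nat_gt (2 / x)
      filter_upwards [eventually_ge_atTop N] with n hn
      have h1 : 2 / x ≤ n := hN.le.trans (by exact_mod_cast hn)
      rw [div_le_iff₀ hx] at h1
      rw [Real.smoothTransition.one_of_one_le (by nlinarith), one_mul]
  | succ s ih =>
    obtain ⟨ψ, hs, h0, ⟨C, hC⟩, hl⟩ := ih
    -- the primitives are scaled by `c`, since the derivative of `x^c` is `c x^{c-1}`
    set c : ℝ := β + s + 1 with hc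
    have hc0 : 0 < c := by positivity
    have hcast : β + ((s + 1 : ℕ) : ℝ) = c := by rw [hc]; push_cast; ring
    have hd : ∀ n, deriv (fun x => c * ∫ t in (0 : ℝ)..x, ψ n t) = fun x => c * ψ n x := by
      intro n
      ext x
      rw [deriv_const_mul_field]
      rw [(hs n).continuous.deriv_integral]
    have hpow : ∀ x > 0, IntervalIntegrable (fun t : ℝ => t ^ (β + s)) volume 0 x := fun x _ =>
      intervalIntegral.intervalIntegrable_rpow' (by linarith [Nat.cast_nonneg (α := ℝ) s])
    have hint : ∀ x : ℝ, ∫ t in (0 : ℝ)..x, t ^ (β + s) = x ^ c / c := fun x => by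
      rw [integral_rpow (Or.inl (by linarith [Nat.cast_nonneg (α := ℝ) s])), ← hc,
        Real.zero_rpow hc0.ne', sub_zero]
    have hC' : ∀ n, ∀ t > 0, |ψ n t| ≤ C * t ^ (β + s) := fun n t ht => by
      simpa using hC n 0 (Nat.zero_le _) t ht
    have hl' : ∀ t > 0, Tendsto (fun n => ψ n t) atTop (𝓝 (t ^ (β + s))) := fun t ht => by
      simpa using hl 0 (Nat.zero_le _) t ht
    refine ⟨fun n x => c * ∫ t in (0 : ℝ)..x, ψ n t, fun n => ?_, fun n => ?_,
      ⟨max C (c * C), fun n k hk x hx => ?_⟩, fun k hk x hx => ?_⟩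
    · rw [contDiff_infty_iff_deriv, hd]
      refine ⟨fun x => ?_, contDiff_const.mul (hs n)⟩
      exact ((hs n).continuous.integral_hasStrictDerivAt 0
        x).hasDerivAt.differentiableAt.const_mul c
    · obtain ⟨ε, hε, h⟩ := h0 n
      refine ⟨ε, hε, fun x hx => ?_⟩
      beta_reduce
      rw [intervalIntegral.integral_congr (g := fun _ => (0 : ℝ)) fun t ht => ?_]
      · simp
      · exact h t ((mem_uIcc.1 ht).elim (fun h => h.2.trans hx) fun h => h.2.trans hε.le)
    · have hxc : 0 ≤ x ^ (β + ((s + 1 : ℕ) : ℝ) - k) := Real.rpow_nonneg hx.le _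
      rcases k with _ | k
      · refine le_trans ?_ (mul_le_mul_of_nonneg_right (le_max_left _ _) hxc)
        simp only [iteratedDeriv_zero, Nat.cast_zero, sub_zero]
        rw [hcast, abs_mul, abs_of_pos hc0]
        have := intervalIntegral.norm_integral_le_of_norm_le hx.le
          (f := ψ n) (g := fun t => C * t ^ (β + s)) (μ := volume)
          (Eventually.of_forall fun t ht => hC' n t ht.1) ((hpow x hx).const_mul C)
        rw [intervalIntegral.integral_const_mul, hint, Real.norm_eq_abs] at this
        calc c * |∫ t in (0 : ℝ)..x, ψ n t| ≤ c * (C * (x ^ c / c)) := by gcongr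
          _ = C * x ^ c := by field_simp
      · refine le_trans ?_ (mul_le_mul_of_nonneg_right (le_max_right _ _) hxc)
        rw [iteratedDeriv_succ', hd, iteratedDeriv_const_mul_field, abs_mul, abs_of_pos hc0,
          mul_assoc]
        refine mul_le_mul_of_nonneg_left ?_ hc0.le
        refine (hC n k (by omega) x hx).trans_eq ?_
        congr 2
        push_cast; ring
    · rcases k with _ | k
      · simp only [iteratedDeriv_zero]
        have := intervalIntegral.tendsto_integral_filter_of_dominated_convergence
          (μ := volume) (a := 0) (b := x) (F := ψ) (f := fun t => t ^ (β + s)) (l := atTop)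
          (fun t => C * t ^ (β + s))
          (Eventually.of_forall fun n => (hs n).continuous.aestronglyMeasurable)
          (Eventually.of_forall fun n => Eventually.of_forall fun t ht =>
            hC' n t (by rw [uIoc_of_le hx.le] at ht; exact ht.1))
          ((hpow x hx).const_mul C)
          (Eventually.of_forall fun t ht =>
            hl' t (by rw [uIoc_of_le hx.le] at ht; exact ht.1))
        rw [hint] at this
        rw [hcast]
        convert this.const_mul c using 2
        field_simp
      · have e1 : deriv (fun t : ℝ => t ^ (β + ((s + 1 : ℕ) : ℝ))) =
            fun t => c * t ^ (β + s) := by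
          ext t
          rw [hcast, Real.deriv_rpow_const, hc]
          congr 2
          ring
        simp only [iteratedDeriv_succ']
        rw [e1]
        simp only [hd, iteratedDeriv_const_mul_field]
        exact (hl k (by omega) x hx).const_mul c

theorem contDiffOn_iteratedDeriv {ψ : ℝ → ℝ} (h : ContDiffOn ℝ (⊤ : ℕ∞) ψ (Ioi 0)) (k : ℕ) :
    ContDiffOn ℝ (⊤ : ℕ∞) (iteratedDeriv k ψ) (Ioi 0) := by
  induction k with
  | zero => simpa using h
  | succ k ih =>
    rw [iteratedDeriv_succ]
    exact ih.deriv_of_isOpen isOpen_Ioi (by simp)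

theorem differentiableAt_iteratedDeriv {ψ : ℝ → ℝ} (h : ContDiffOn ℝ (⊤ : ℕ∞) ψ (Ioi 0)) (k : ℕ)
    {x : ℝ} (hx : 0 < x) : DifferentiableAt ℝ (iteratedDeriv k ψ) x :=
  ((contDiffOn_iteratedDeriv h k).contDiffAt (isOpen_Ioi.mem_nhds hx)).differentiableAt (by simp)

/-- An operator `Φ` on functions of one variable which is of the form
`Φ ψ = ∑_{k ≤ N} ψ^{(k)}(1 - r²) P_k` with smooth functions `P_k` not depending on `ψ`. -/
def HasExpansion (N : ℕ) (Φ : (ℝ → ℝ) → ℝ × ℝ → ℝ) : Prop :=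
  ∃ P : ℕ → ℝ × ℝ → ℝ, (∀ k, ContDiff ℝ (⊤ : ℕ∞) (P k)) ∧
    ∀ ψ : ℝ → ℝ, ContDiffOn ℝ (⊤ : ℕ∞) ψ (Ioi 0) → EqOn (Φ ψ)
      (fun p => ∑ k ∈ Finset.range (N + 1), iteratedDeriv k ψ (diskW p) * P k p) Disk

theorem HasExpansion.dirDeriv {N : ℕ} {Φ : (ℝ → ℝ) → ℝ × ℝ → ℝ} (h : HasExpansion N Φ)
    (v : ℝ × ℝ) : HasExpansion (N + 1) fun ψ => dirDeriv v (Φ ψ) := by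
  obtain ⟨P, hP, hΦ⟩ := h
  have hDP : ∀ k, ContDiff ℝ (⊤ : ℕ∞) (DiskSobolev.dirDeriv v (P k)) := fun k =>
    contDiffOn_univ.1 (contDiffOn_dirDeriv isOpen_univ (hP k).contDiffOn v)
  have hDw : ContDiff ℝ (⊤ : ℕ∞) (DiskSobolev.dirDeriv v diskW) :=
    contDiffOn_univ.1 (contDiffOn_dirDeriv isOpen_univ contDiff_diskW.contDiffOn v)
  refine ⟨fun k p => (if k ≤ N then DiskSobolev.dirDeriv v (P k) p else 0) +
      (if k = 0 then 0 else DiskSobolev.dirDeriv v diskW p * P (k - 1) p), fun k => ?_,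
      fun ψ hψ p hp => ?_⟩
  · refine ContDiff.add ?_ ?_
    · split_ifs
      exacts [hDP k, contDiff_const]
    · split_ifs
      exacts [contDiff_const, hDw.mul (hP _)]
  · have e1 := dirDeriv_congr isOpen_disk (hΦ ψ hψ) v hp
    have hk : ∀ k, HasFDerivAt (fun p => iteratedDeriv k ψ (diskW p) * P k p)
        (iteratedDeriv k ψ (diskW p) • fderiv ℝ (P k) p
          + P k p • (iteratedDeriv (k + 1) ψ (diskW p) • fderiv ℝ diskW p)) p := fun k => by
      have h1 := (differentiableAt_iteratedDeriv hψ k (diskW_pos hp)).hasDerivAt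
      rw [← iteratedDeriv_succ] at h1
      have h2 := (contDiff_diskW.differentiable (by simp) p).hasFDerivAt
      exact (h1.comp_hasFDerivAt p h2).mul ((hP k).differentiable (by simp) p).hasFDerivAt
    have e2 : DiskSobolev.dirDeriv v (fun p => ∑ k ∈ Finset.range (N + 1),
        iteratedDeriv k ψ (diskW p) * P k p) p = ∑ k ∈ Finset.range (N + 1),
        (iteratedDeriv k ψ (diskW p) * DiskSobolev.dirDeriv v (P k) p
          + iteratedDeriv (k + 1) ψ (diskW p) * (DiskSobolev.dirDeriv v diskW p * P k p)) := by
      have := (HasFDerivAt.fun_sum fun k (_ : k ∈ Finset.range (N + 1)) => hk k).fderiv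
      rw [DiskSobolev.dirDeriv, this, sum_apply]
      refine Finset.sum_congr rfl fun k _ => ?_
      simp only [add_apply, smul_apply, smul_eq_mul, DiskSobolev.dirDeriv]
      ring
    beta_reduce
    rw [e1, e2]
    simp only [mul_add, Finset.sum_add_distrib]
    congr 1
    · rw [Finset.sum_range_succ _ (N + 1)]
      simp only [show ¬ (N + 1 ≤ N) by omega, if_false, mul_zero, add_zero]
      refine Finset.sum_congr rfl fun k hk => ?_
      rw [if_pos (by simpa [Nat.lt_succ_iff] using hk)]
    · rw [Finset.sum_range_succ' _ (N + 1)]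
      simp

/-- The derivatives of `ψ(1 - r²) F` depend on `ψ` only through finitely many derivatives of `ψ`, so
that bounds and limits of those carry over. -/
theorem hasExpansion_mixedDeriv {F : ℝ × ℝ → ℝ} (hF : ContDiff ℝ (⊤ : ℕ∞) F) (i j : ℕ) :
    HasExpansion (i + j) fun ψ => mixedDeriv i j fun p => ψ (diskW p) * F p := by
  induction j with
  | zero =>
    induction i with
    | zero => exact ⟨fun _ => F, fun _ => hF, fun ψ _ p _ => by simp⟩
    | succ i ih =>
      simp only [mixedDeriv_succ_zero]
      rw [show i + 1 + 0 = i + 0 + 1 by ring]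
      exact ih.dirDeriv _
  | succ j ih =>
    simp only [mixedDeriv_succ_right]
    exact ih.dirDeriv _

/-! ### The weighted measures -/

theorem measurable_diskDensity (β : ℝ) :
    Measurable fun p : ℝ × ℝ => ENNReal.ofReal ((1 - (p.1 ^ 2 + p.2 ^ 2)) ^ β) := by
  fun_prop

theorem integral_wMeasure (β : ℝ) (f : ℝ × ℝ → ℝ) :
    ∫ p, f p ∂wMeasure β = ∫ p in Disk, diskW p ^ β * f p := by
  rw [wMeasure, integral_withDensity_eq_integral_toReal_smul (measurable_diskDensity β)
    (Eventually.of_forall fun _ => ENNReal.ofReal_lt_top)]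
  refine setIntegral_congr_fun isOpen_disk.measurableSet fun p hp => ?_
  rw [smul_eq_mul]
  exact congrArg (· * f p) (ENNReal.toReal_ofReal (Real.rpow_nonneg (diskW_pos hp).le _))

theorem integrable_wMeasure_iff (β : ℝ) (f : ℝ × ℝ → ℝ) :
    Integrable f (wMeasure β) ↔ IntegrableOn (fun p => diskW p ^ β * f p) Disk := by
  rw [wMeasure, integrable_withDensity_iff_integrable_smul' (measurable_diskDensity β)
    (Eventually.of_forall fun _ => ENNReal.ofReal_lt_top)]
  refine integrableOn_congr_fun (fun p hp => ?_) isOpen_disk.measurableSet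
  rw [smul_eq_mul]
  exact congrArg (· * f p) (ENNReal.toReal_ofReal (Real.rpow_nonneg (diskW_pos hp).le _))

theorem disk_subset_closedBall : Disk ⊆ Metric.closedBall (0 : ℝ × ℝ) 1 := by
  intro p hp
  have hp : p.1 ^ 2 + p.2 ^ 2 < 1 := hp
  rw [mem_closedBall_zero_iff, Prod.norm_def, Real.norm_eq_abs, Real.norm_eq_abs]
  refine max_le ?_ ?_ <;> rw [abs_le] <;> constructor <;> nlinarith [sq_nonneg p.1, sq_nonneg p.2]

theorem exists_bound_on_disk {E : Type*} [NormedAddCommGroup E] {f : ℝ × ℝ → E}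
    (hf : Continuous f) : ∃ C, 0 ≤ C ∧ ∀ p ∈ Disk, ‖f p‖ ≤ C := by
  obtain ⟨C, hC⟩ := (isCompact_closedBall (0 : ℝ × ℝ) 1).exists_bound_of_continuousOn
    hf.continuousOn
  exact ⟨max C 0, le_max_right _ _, fun p hp =>
    (hC p (disk_subset_closedBall hp)).trans (le_max_left _ _)⟩

theorem isFiniteMeasure_wMeasure {β : ℝ} (hβ : 0 ≤ β) : IsFiniteMeasure (wMeasure β) := by
  refine isFiniteMeasure_withDensity (ne_of_lt ?_)
  calc ∫⁻ p in Disk, ENNReal.ofReal ((1 - (p.1 ^ 2 + p.2 ^ 2)) ^ β)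
      ≤ ∫⁻ p in Disk, 1 := by
        refine setLIntegral_mono measurable_const fun p hp => ?_
        rw [← ENNReal.ofReal_one]
        exact ENNReal.ofReal_le_ofReal
          (Real.rpow_le_one (diskW_pos hp).le (diskW_le_one p) hβ)
    _ = volume Disk := by simp
    _ < ⊤ := (measure_mono disk_subset_closedBall).trans_lt
      (isCompact_closedBall _ _).measure_lt_top

theorem wMeasure_absolutelyContinuous (β : ℝ) : wMeasure β ≪ volume.restrict Disk :=
  withDensity_absolutelyContinuous _ _

theorem ae_mem_disk (β : ℝ) : ∀ᵐ p ∂wMeasure β, p ∈ Disk :=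
  (wMeasure_absolutelyContinuous β).ae_le (ae_restrict_mem isOpen_disk.measurableSet)

/-- The weight is positive on the disk, so that the weighted measures have the same null sets as the
Lebesgue measure of the disk. -/
theorem absolutelyContinuous_wMeasure (β : ℝ) : volume.restrict Disk ≪ wMeasure β := by
  refine withDensity_absolutelyContinuous' (measurable_diskDensity β).aemeasurable ?_
  filter_upwards [ae_restrict_mem isOpen_disk.measurableSet] with p hp
  exact (ENNReal.ofReal_pos.2 (Real.rpow_pos_of_pos (diskW_pos hp) β)).ne'

theorem memLp_wMeasure_of_continuous {E : Type*} [NormedAddCommGroup E] {β : ℝ} (hβ : 0 ≤ β)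
    {f : ℝ × ℝ → E} (hf : Continuous f) (q : ℝ≥0∞) : MemLp f q (wMeasure β) := by
  have := isFiniteMeasure_wMeasure hβ
  obtain ⟨C, _, hC⟩ := exists_bound_on_disk hf
  exact MemLp.of_bound hf.aestronglyMeasurable C
    ((ae_mem_disk β).mono fun p hp => hC p hp)

theorem MemLp.integrable_wMeasure {β : ℝ} (hβ : 0 ≤ β) {f : ℝ × ℝ → ℝ}
    (hf : MemLp f 2 (wMeasure β)) : Integrable f (wMeasure β) := by
  have := isFiniteMeasure_wMeasure hβ
  exact hf.integrable (by norm_num)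

/-! ### Weighted integration by parts -/

/-- A function of `1 - r²` which vanishes near `0` cuts off to the disk. -/
theorem isTestFunction_of_eq_zero {ψ : ℝ → ℝ} {ε : ℝ} (hε : 0 < ε) (h : ∀ x ≤ ε, ψ x = 0)
    (F : ℝ × ℝ → ℝ) : HasCompactSupport (fun p => ψ (diskW p) * F p) ∧
      tsupport (fun p => ψ (diskW p) * F p) ⊆ Disk := by
  have hc : IsClosed {p : ℝ × ℝ | ε ≤ diskW p} :=
    isClosed_le continuous_const contDiff_diskW.continuous
  have hs : tsupport (fun p => ψ (diskW p) * F p) ⊆ {p : ℝ × ℝ | ε ≤ diskW p} := by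
    refine closure_minimal (fun p hp => ?_) hc
    by_contra hlt
    exact hp (by simp [h _ (not_le.1 hlt).le])
  have hD : {p : ℝ × ℝ | ε ≤ diskW p} ⊆ Disk := fun p hp => sub_pos.1 (hε.trans_le hp)
  refine ⟨?_, hs.trans hD⟩
  exact (isCompact_closedBall (0 : ℝ × ℝ) 1).of_isClosed_subset (isClosed_tsupport _)
    (hs.trans (hD.trans disk_subset_closedBall))

/-- Integration by parts against `(1 - r²)^{γ+i+j} F`, which need not have compact support in the
disk: the boundary terms vanish because of the weight. -/
theorem IsWeakDeriv.integral_rpow_mul {γ : ℝ} (hγ : 0 ≤ γ) {i j s : ℕ} (hs : i + j = s)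
    {u g : ℝ × ℝ → ℝ} (hu : MemLp u 2 (wMeasure γ)) (hg : MemLp g 2 (wMeasure (γ + s)))
    (h : IsWeakDeriv i j u g) {F : ℝ × ℝ → ℝ} (hF : ContDiff ℝ (⊤ : ℕ∞) F) :
    IntegrableOn (fun p => u p * mixedDeriv i j (fun p => diskW p ^ (γ + s) * F p) p) Disk ∧
    ∫ p in Disk, g p * (diskW p ^ (γ + s) * F p) =
      (-1) ^ s * ∫ p in Disk, u p * mixedDeriv i j (fun p => diskW p ^ (γ + s) * F p) p := by
  obtain ⟨ψ, hψ, hψ0, ⟨C, hC⟩, hl⟩ := exists_truncated_rpow hγ s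
  obtain ⟨P, hP, hexp⟩ := hasExpansion_mixedDeriv hF i j
  rw [hs] at hexp
  have hγs : 0 ≤ γ + s := by positivity
  have hum := h.1.aestronglyMeasurable
  have hgm := h.2.1.aestronglyMeasurable
  have hui := (integrable_wMeasure_iff γ u).1 (MemLp.integrable_wMeasure hγ hu)
  have hgi := (integrable_wMeasure_iff _ g).1 (MemLp.integrable_wMeasure hγs hg)
  have hCnn : 0 ≤ C := by
    have := hC 0 0 (Nat.zero_le _) 1 one_pos
    rw [Real.one_rpow, mul_one] at this
    exact (abs_nonneg _).trans this
  -- the test functions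
  have htest : ∀ n, ContDiff ℝ (⊤ : ℕ∞) (fun p => ψ n (diskW p) * F p) := fun n =>
    ((hψ n).comp contDiff_diskW).mul hF
  have hibp : ∀ n, ∫ p in Disk, g p * (ψ n (diskW p) * F p) =
      (-1) ^ s * ∫ p in Disk, u p * mixedDeriv i j (fun p => ψ n (diskW p) * F p) p := by
    intro n
    obtain ⟨ε, hε, h0⟩ := hψ0 n
    have ht := isTestFunction_of_eq_zero hε h0 F
    have := h.2.2 _ (htest n) ht.1 ht.2
    rw [iterate_partial_eq_mixedDeriv, hs] at this
    rw [this, ← mul_assoc, ← mul_pow]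
    simp
  have hrpow : ContDiffOn ℝ (⊤ : ℕ∞) (fun t : ℝ => t ^ (γ + s)) (Ioi 0) :=
    contDiffOn_id.rpow_const_of_ne fun x hx => (ne_of_gt hx)
  -- convergence of the left-hand side
  obtain ⟨B, hB0, hB⟩ := exists_bound_on_disk hF.continuous
  have hlim1 : Tendsto (fun n => ∫ p in Disk, g p * (ψ n (diskW p) * F p)) atTop
      (𝓝 (∫ p in Disk, g p * (diskW p ^ (γ + s) * F p))) := by
    refine tendsto_integral_of_dominated_convergence
      (fun p => C * B * ‖diskW p ^ (γ + s) * g p‖) (fun n => ?_) (hgi.norm.const_mul _)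
      (fun n => ?_) ?_
    · exact hgm.mul (htest n).continuous.aestronglyMeasurable
    · filter_upwards [ae_restrict_mem isOpen_disk.measurableSet] with p hp
      have h1 := hC n 0 (Nat.zero_le _) _ (diskW_pos hp)
      rw [iteratedDeriv_zero, Nat.cast_zero, sub_zero] at h1
      rw [norm_mul, norm_mul, norm_mul, Real.norm_eq_abs (ψ n _), Real.norm_eq_abs (F p),
        Real.norm_of_nonneg (Real.rpow_nonneg (diskW_pos hp).le _)]
      calc ‖g p‖ * (|ψ n (diskW p)| * |F p|) ≤ ‖g p‖ * ((C * diskW p ^ (γ + s)) * B) := by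
            have := Real.rpow_nonneg (diskW_pos hp).le (γ + s)
            gcongr
            exact hB p hp
        _ = _ := by ring
    · filter_upwards [ae_restrict_mem isOpen_disk.measurableSet] with p hp
      have := hl 0 (Nat.zero_le _) _ (diskW_pos hp)
      simp only [iteratedDeriv_zero] at this
      exact (this.mul_const _).const_mul _
  -- convergence of the right-hand side
  choose M hM0 hM using fun k => exists_bound_on_disk (hP k).continuous
  have hbound : ∀ n, ∀ p ∈ Disk, |mixedDeriv i j (fun p => ψ n (diskW p) * F p) p| ≤
      (∑ k ∈ Finset.range (s + 1), C * M k) * diskW p ^ γ := by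
    intro n p hp
    have e := hexp (ψ n) (hψ n).contDiffOn hp
    beta_reduce at e
    rw [e, Finset.sum_mul]
    refine (Finset.abs_sum_le_sum_abs _ _).trans (Finset.sum_le_sum fun k hk => ?_)
    have hks : k ≤ s := by simpa [Nat.lt_succ_iff] using hk
    rw [abs_mul]
    have h1 := hC n k hks _ (diskW_pos hp)
    have h2 : diskW p ^ (γ + s - k) ≤ diskW p ^ γ := by
      refine Real.rpow_le_rpow_of_exponent_ge (diskW_pos hp) (diskW_le_one p) ?_
      have : (k : ℝ) ≤ s := by exact_mod_cast hks
      linarith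
    calc |iteratedDeriv k (ψ n) (diskW p)| * |P k p| ≤ (C * diskW p ^ γ) * M k := by
          refine mul_le_mul (h1.trans (by gcongr)) (hM k p hp) (abs_nonneg _) ?_
          exact mul_nonneg hCnn (Real.rpow_nonneg (diskW_pos hp).le _)
      _ = _ := by ring
  have hptw : ∀ p ∈ Disk, Tendsto (fun n => mixedDeriv i j (fun p => ψ n (diskW p) * F p) p) atTop
      (𝓝 (mixedDeriv i j (fun p => diskW p ^ (γ + s) * F p) p)) := by
    intro p hp
    have e := fun n => hexp (ψ n) (hψ n).contDiffOn hp
    have e' := hexp _ hrpow hp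
    beta_reduce at e e'
    simp only [e, e']
    refine tendsto_finsetSum _ fun k hk => ?_
    exact (hl k (by simpa [Nat.lt_succ_iff] using hk) _ (diskW_pos hp)).mul_const _
  have hmeas : ∀ n, AEStronglyMeasurable
      (fun p => u p * mixedDeriv i j (fun p => ψ n (diskW p) * F p) p) (volume.restrict Disk) :=
    fun n => hum.mul (contDiff_mixedDeriv i j (htest n)).continuous.aestronglyMeasurable
  have hae : ∀ᵐ p ∂volume.restrict Disk,
      Tendsto (fun n => u p * mixedDeriv i j (fun p => ψ n (diskW p) * F p) p) atTop
      (𝓝 (u p * mixedDeriv i j (fun p => diskW p ^ (γ + s) * F p) p)) := by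
    filter_upwards [ae_restrict_mem isOpen_disk.measurableSet] with p hp
    exact (hptw p hp).const_mul _
  have hdom : Integrable (fun p => (∑ k ∈ Finset.range (s + 1), C * M k) * ‖diskW p ^ γ * u p‖)
      (volume.restrict Disk) := hui.norm.const_mul _
  have hlim2 : Tendsto
      (fun n => ∫ p in Disk, u p * mixedDeriv i j (fun p => ψ n (diskW p) * F p) p) atTop
      (𝓝 (∫ p in Disk, u p * mixedDeriv i j (fun p => diskW p ^ (γ + s) * F p) p)) := by
    refine tendsto_integral_of_dominated_convergence _ hmeas hdom (fun n => ?_) hae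
    filter_upwards [ae_restrict_mem isOpen_disk.measurableSet] with p hp
    rw [norm_mul, norm_mul, Real.norm_of_nonneg (Real.rpow_nonneg (diskW_pos hp).le _)]
    calc ‖u p‖ * ‖mixedDeriv i j (fun p => ψ n (diskW p) * F p) p‖
        ≤ ‖u p‖ * ((∑ k ∈ Finset.range (s + 1), C * M k) * diskW p ^ γ) := by
          gcongr
          exact hbound n p hp
      _ = _ := by ring
  constructor
  · refine Integrable.mono' hdom (aestronglyMeasurable_of_tendsto_ae atTop hmeas hae) ?_
    filter_upwards [ae_restrict_mem isOpen_disk.measurableSet] with p hp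
    have hle : |mixedDeriv i j (fun p => diskW p ^ (γ + s) * F p) p| ≤
        (∑ k ∈ Finset.range (s + 1), C * M k) * diskW p ^ γ :=
      le_of_tendsto (hptw p hp).abs (Eventually.of_forall fun n => hbound n p hp)
    rw [norm_mul, norm_mul, Real.norm_of_nonneg (Real.rpow_nonneg (diskW_pos hp).le _)]
    calc ‖u p‖ * ‖mixedDeriv i j (fun p => diskW p ^ (γ + s) * F p) p‖
        ≤ ‖u p‖ * ((∑ k ∈ Finset.range (s + 1), C * M k) * diskW p ^ γ) := by
          gcongr
          exact hle
      _ = _ := by ring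
  · refine tendsto_nhds_unique hlim1 ?_
    simp only [hibp]
    exact hlim2.const_mul _

/-! ### The basis functions as real parts of disk polynomials -/

/-- Disk polynomials of bidegree `(n + l, n)` are multiples of `z^l P_n^{(γ,l)}(2|z|² - 1)`. -/
theorem diskPoly_eq_jacobiP {γ : ℝ} (hγ : 0 ≤ γ) (l n : ℕ) (a b : ℂ) (t : ℝ)
    (hab : a * b = t) :
    diskPoly γ (n + l) n a b =
      ((n.factorial * Real.Gamma (n + 1 + γ + l) * jacobiP n γ l (2 * t - 1) : ℝ) : ℂ) * a ^ l := by
  have hn : (n.factorial : ℝ) ≠ 0 := by positivity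
  have hG : Real.Gamma (n + 1 + γ + l) ≠ 0 := (Real.Gamma_pos_of_pos (by positivity)).ne'
  have e : n.factorial * Real.Gamma (n + 1 + γ + l) * jacobiP n γ l (2 * t - 1) =
      ∑ j ∈ Finset.range (n + 1), diskCoeff γ (n + l) n (n - j) * t ^ j := by
    rw [jacobiP, ← mul_assoc, Finset.mul_sum]
    refine Finset.sum_congr rfl fun j hj => ?_
    have hj : j ≤ n := by simpa [Nat.lt_succ_iff] using hj
    obtain ⟨k, rfl⟩ := Nat.exists_eq_add_of_le hj
    have h1 : Real.Gamma ((j + k : ℕ) + 1 + l) = ((j + k + l).factorial : ℝ) := by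
      rw [show (((j + k : ℕ) : ℝ) + 1 + l) = ((j + k + l : ℕ) : ℝ) + 1 by push_cast; ring,
        Real.Gamma_nat_eq_factorial]
    have h2 : Real.Gamma (j + 1 + l) = ((j + l).factorial : ℝ) := by
      rw [show ((j : ℝ) + 1 + l) = ((j + l : ℕ) : ℝ) + 1 by push_cast; ring,
        Real.Gamma_nat_eq_factorial]
    have h3 : ((j + l).factorial : ℝ) * (j + k + l).descFactorial k = (j + k + l).factorial := by
      have := Nat.factorial_mul_descFactorial (show k ≤ j + k + l by omega)
      rw [show j + k + l - k = j + l by omega] at this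
      exact_mod_cast this
    have h4 : ((j + k).choose k : ℝ) = (j + k).choose j := by
      rw [Nat.choose_symm_add]
    have h5 : ((-1 : ℝ)) ^ (j + k) * (-1) ^ j = (-1) ^ k := by
      rw [pow_add, mul_comm ((-1 : ℝ) ^ j), mul_assoc, ← pow_add, ← two_mul]
      simp
    have h6 : ((j + l).factorial : ℝ) ≠ 0 := by positivity
    rw [diskCoeff, h1, h2, Nat.add_sub_cancel_left, h4, ← h3,
      show (1 : ℝ) + (2 * t - 1) = 2 * t by ring, mul_pow,
      show ((j + k + l : ℕ) : ℝ) + ((j + k : ℕ) : ℝ) - k + 1 + γ =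
        ((j + k : ℕ) : ℝ) + j + 1 + γ + l by push_cast; ring]
    field_simp
    rw [← h5]
    ring
  rw [e, diskPoly, ← Finset.sum_range_reflect, Complex.ofReal_sum, Finset.sum_mul]
  refine Finset.sum_congr rfl fun j hj => ?_
  have hj : j ≤ n := by simpa [Nat.lt_succ_iff] using hj
  rw [show n + 1 - 1 - j = n - j by omega, show n + l - (n - j) = l + j by omega,
    show n - (n - j) = j by omega, pow_add, mul_assoc, ← mul_pow, hab]
  push_cast
  ring

/-- The constant which turns a disk polynomial into a basis function. -/
def basisConst (γ : ℝ) (l n : ℕ) (μ : ℤˣ) : ℂ :=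
  ((if l = 0 then 1 / 2 else 1) / (n.factorial * Real.Gamma (n + 1 + γ + l)) : ℝ) *
    (if μ = 1 then 1 else -Complex.I)

theorem basisConst_scale_pos {γ : ℝ} (hγ : 0 ≤ γ) (l n : ℕ) :
    0 < (if l = 0 then 1 / 2 else 1 : ℝ) / (n.factorial * Real.Gamma (n + 1 + γ + l)) := by
  have : 0 < Real.Gamma (n + 1 + γ + l) := Real.Gamma_pos_of_pos (by positivity)
  split_ifs <;> positivity

theorem basisConst_ne_zero {γ : ℝ} (hγ : 0 ≤ γ) (l n : ℕ) (μ : ℤˣ) : basisConst γ l n μ ≠ 0 := by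
  refine mul_ne_zero (by exact_mod_cast (basisConst_scale_pos hγ l n).ne') ?_
  split_ifs <;> simp

theorem zMap_pow_re_im (l : ℕ) (p : ℝ × ℝ) :
    ((zMap p) ^ l).re = √(p.1 ^ 2 + p.2 ^ 2) ^ l * Real.cos (l * Complex.arg ⟨p.1, p.2⟩) ∧
    ((zMap p) ^ l).im = √(p.1 ^ 2 + p.2 ^ 2) ^ l * Real.sin (l * Complex.arg ⟨p.1, p.2⟩) := by
  have hn : ‖(⟨p.1, p.2⟩ : ℂ)‖ = √(p.1 ^ 2 + p.2 ^ 2) := by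
    rw [Complex.norm_def, Complex.normSq_mk]; ring_nf
  have h : (zMap p) ^ l = ((√(p.1 ^ 2 + p.2 ^ 2) ^ l : ℝ) : ℂ) *
      Complex.exp ((l * Complex.arg ⟨p.1, p.2⟩ : ℝ) * Complex.I) := by
    rw [zMap_apply]
    conv_lhs => rw [← Complex.norm_mul_exp_arg_mul_I ⟨p.1, p.2⟩]
    rw [mul_pow, ← Complex.exp_nat_mul, hn]
    push_cast
    ring_nf
  rw [h]
  constructor
  · rw [Complex.re_ofReal_mul, Complex.exp_ofReal_mul_I_re]
  · rw [Complex.im_ofReal_mul, Complex.exp_ofReal_mul_I_im]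

/-- The basis functions are real parts of multiples of disk polynomials. The constant is real for
`μ = 1` and imaginary for `μ = -1`. -/
theorem basisFun_eq {γ : ℝ} (hγ : 0 ≤ γ) (l n : ℕ) (μ : ℤˣ) :
    basisFun γ l n μ = fun p => (basisConst γ l n μ * diskFun γ (n + l) n p).re := by
  ext p
  have hn : (n.factorial : ℝ) ≠ 0 := by positivity
  have hG : Real.Gamma (n + 1 + γ + l) ≠ 0 := (Real.Gamma_pos_of_pos (by positivity)).ne'
  have hz := zMap_pow_re_im l p
  rw [diskFun, diskPoly_eq_jacobiP hγ l n _ _ _ (zMap_mul_zbarMap p), basisConst, basisFun,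
    solidHarmonic]
  set J := jacobiP n γ l (2 * (p.1 ^ 2 + p.2 ^ 2) - 1)
  have e : ∀ (A x : ℝ) (c d : ℂ), (((A : ℝ) : ℂ) * c * ((x : ℝ) * d)).re = A * x * (c * d).re := by
    intro A x c d
    rw [← Complex.re_ofReal_mul]
    push_cast
    ring_nf
  rw [e]
  by_cases hμ : μ = 1
  · simp only [hμ, if_true, one_mul]
    by_cases hl : l = 0
    · subst hl
      simp
      field_simp
    · simp only [hl, if_false]
      rw [hz.1]
      field_simp
  · have : (-Complex.I * zMap p ^ l).re = (zMap p ^ l).im := by simp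
    simp only [hμ, if_false]
    rw [this, hz.2]
    by_cases hl : l = 0
    · subst hl; simp
    · simp only [hl, if_false]
      field_simp

theorem contDiff_re_mul_diskFun (γ : ℝ) (c : ℂ) (m n : ℕ) :
    ContDiff ℝ (⊤ : ℕ∞) fun p => (c * diskFun γ m n p).re :=
  Complex.reCLM.contDiff.comp (contDiff_const.mul (contDiff_diskFun γ m n))

theorem contDiff_basisFun {γ : ℝ} (hγ : 0 ≤ γ) (l n : ℕ) (μ : ℤˣ) :
    ContDiff ℝ (⊤ : ℕ∞) (basisFun γ l n μ) := by
  rw [basisFun_eq hγ]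
  exact contDiff_re_mul_diskFun _ _ _ _

/-! ### The weak eigenvalue equation -/

/-- The weak form of the eigenvalue equation: the Sobolev form of order `s` of a function `u` with
weak derivatives `g` and of a basis function is a multiple of their inner product. -/
theorem sum_integral_mixedDeriv_eq {γ : ℝ} (hγ : 0 ≤ γ) (s : ℕ) {u : ℝ × ℝ → ℝ}
    {g : ℕ × ℕ → ℝ × ℝ → ℝ} (hu : MemLp u 2 (wMeasure γ))
    (hg : ∀ ij ∈ Finset.HasAntidiagonal.antidiagonal s,
      IsWeakDeriv ij.1 ij.2 u (g ij) ∧ MemLp (g ij) 2 (wMeasure (γ + s)))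
    (c : ℂ) (m n : ℕ) :
    ∑ ij ∈ Finset.HasAntidiagonal.antidiagonal s, (s.choose ij.1 : ℝ) *
        ∫ p, g ij p * mixedDeriv ij.1 ij.2 (fun p => (c * diskFun γ m n p).re) p
          ∂wMeasure (γ + s)
      = eigenvalue s γ m n * ∫ p, u p * (c * diskFun γ m n p).re ∂wMeasure γ := by
  set e : ℝ × ℝ → ℝ := fun p => (c * diskFun γ m n p).re with he
  have hF : ContDiff ℝ (⊤ : ℕ∞) e := contDiff_re_mul_diskFun _ _ _ _
  have key := fun ij (hij : ij ∈ Finset.HasAntidiagonal.antidiagonal s) =>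
    (hg ij hij).1.integral_rpow_mul hγ (Finset.HasAntidiagonal.mem_antidiagonal.1 hij) hu
      (hg ij hij).2 (contDiff_mixedDeriv ij.1 ij.2 hF)
  have e1 : ∀ ij ∈ Finset.HasAntidiagonal.antidiagonal s, (s.choose ij.1 : ℝ) *
      ∫ p, g ij p * mixedDeriv ij.1 ij.2 e p ∂wMeasure (γ + s) =
      (-1) ^ s * ∫ p in Disk, (s.choose ij.1 : ℝ) * (u p * mixedDeriv ij.1 ij.2
        (fun p => diskW p ^ (γ + s) * mixedDeriv ij.1 ij.2 e p) p) := by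
    intro ij hij
    rw [integral_wMeasure, integral_const_mul, mul_left_comm, ← (key ij hij).2]
    congr 2
    ext p
    ring
  rw [Finset.sum_congr rfl e1, ← Finset.mul_sum, ← integral_finsetSum _ fun ij hij =>
    ((key ij hij).1.const_mul _), integral_wMeasure, ← integral_const_mul, ← integral_const_mul]
  refine setIntegral_congr_fun isOpen_disk.measurableSet fun p hp => ?_
  have h := formOp_re_diskFun s hγ c m n hp
  simp only [formOp, nsmul_eq_mul, smul_eq_mul] at h
  simp only [mul_left_comm _ (u p), ← Finset.mul_sum]
  rw [he, h]
  have : ((-1 : ℝ) ^ s) * (-1) ^ s = 1 := by rw [← mul_pow]; simp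
  linear_combination u p * eigenvalue s γ m n * (diskW p ^ γ * (c * diskFun γ m n p).re) * this

theorem integral_mul_dirDeriv {f φ : ℝ × ℝ → ℝ} (hf : ContDiff ℝ (⊤ : ℕ∞) f)
    (hφ : ContDiff ℝ (⊤ : ℕ∞) φ) (hc : HasCompactSupport φ) (v : ℝ × ℝ) :
    ∫ p, f p * dirDeriv v φ p = -∫ p, dirDeriv v f p * φ p := by
  have hDf : Continuous (dirDeriv v f) :=
    (contDiffOn_univ.1 (contDiffOn_dirDeriv isOpen_univ hf.contDiffOn v)).continuous
  have hDφ : Continuous (dirDeriv v φ) :=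
    (contDiffOn_univ.1 (contDiffOn_dirDeriv isOpen_univ hφ.contDiffOn v)).continuous
  have hcD : HasCompactSupport (dirDeriv v φ) := hc.fderiv_apply ℝ v
  refine integral_mul_fderiv_eq_neg_fderiv_mul_of_integrable ?_ ?_ ?_
    (fun p _ => hf.differentiable (by simp) p) (fun p _ => hφ.differentiable (by simp) p)
  · exact (hDf.mul hφ.continuous).integrable_of_hasCompactSupport hc.mul_left
  · exact (hf.continuous.mul hDφ).integrable_of_hasCompactSupport hcD.mul_left
  · exact (hf.continuous.mul hφ.continuous).integrable_of_hasCompactSupport hc.mul_left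

theorem hasCompactSupport_mixedDeriv (i j : ℕ) {φ : ℝ × ℝ → ℝ} (hc : HasCompactSupport φ) :
    HasCompactSupport (mixedDeriv i j φ) := by
  induction j with
  | zero =>
    induction i with
    | zero => simpa using hc
    | succ i ih => rw [mixedDeriv_succ_zero]; exact ih.fderiv_apply ℝ _
  | succ j ih => rw [mixedDeriv_succ_right]; exact ih.fderiv_apply ℝ _

theorem tsupport_mixedDeriv_subset (i j : ℕ) (φ : ℝ × ℝ → ℝ) :
    tsupport (mixedDeriv i j φ) ⊆ tsupport φ := by
  induction j with
  | zero =>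
    induction i with
    | zero => simp
    | succ i ih => rw [mixedDeriv_succ_zero]; exact (tsupport_fderiv_apply_subset ℝ _).trans ih
  | succ j ih => rw [mixedDeriv_succ_right]; exact (tsupport_fderiv_apply_subset ℝ _).trans ih

theorem integral_mul_mixedDeriv {f φ : ℝ × ℝ → ℝ} (hf : ContDiff ℝ (⊤ : ℕ∞) f)
    (hφ : ContDiff ℝ (⊤ : ℕ∞) φ) (hc : HasCompactSupport φ) (i j : ℕ) :
    ∫ p, f p * mixedDeriv i j φ p = (-1) ^ (i + j) * ∫ p, mixedDeriv i j f p * φ p := by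
  induction j generalizing f with
  | zero =>
    induction i generalizing f with
    | zero => simp
    | succ i ih =>
      have hDf : ContDiff ℝ (⊤ : ℕ∞) (dirDeriv (1, 0) f) :=
        contDiffOn_univ.1 (contDiffOn_dirDeriv isOpen_univ hf.contDiffOn _)
      rw [mixedDeriv_succ_zero, integral_mul_dirDeriv hf (contDiff_mixedDeriv i 0 hφ)
        (hasCompactSupport_mixedDeriv i 0 hc), ih hDf, mixedDeriv_succ_left]
      ring
  | succ j ih =>
    have hDf : ContDiff ℝ (⊤ : ℕ∞) (dirDeriv (0, 1) f) :=
      contDiffOn_univ.1 (contDiffOn_dirDeriv isOpen_univ hf.contDiffOn _)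
    rw [mixedDeriv_succ_right, integral_mul_dirDeriv hf (contDiff_mixedDeriv i j hφ)
      (hasCompactSupport_mixedDeriv i j hc), ih hDf]
    have : mixedDeriv i (j + 1) f = mixedDeriv i j (dirDeriv (0, 1) f) := funext fun p =>
      mixedDeriv_succ_right' isOpen_univ i j hf.contDiffOn (mem_univ p)
    rw [this]
    ring

theorem isWeakDeriv_mixedDeriv {f : ℝ × ℝ → ℝ} (hf : ContDiff ℝ (⊤ : ℕ∞) f) (i j : ℕ) :
    IsWeakDeriv i j f (mixedDeriv i j f) := by
  refine ⟨hf.continuous.locallyIntegrable.locallyIntegrableOn _,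
    (contDiff_mixedDeriv i j hf).continuous.locallyIntegrable.locallyIntegrableOn _,
    fun φ hφ hc hs => ?_⟩
  rw [iterate_partial_eq_mixedDeriv, setIntegral_eq_integral_of_forall_compl_eq_zero,
    setIntegral_eq_integral_of_forall_compl_eq_zero, integral_mul_mixedDeriv hf hφ hc]
  · intro p hp
    rw [image_eq_zero_of_notMem_tsupport fun hx => hp (hs hx), mul_zero]
  · intro p hp
    rw [image_eq_zero_of_notMem_tsupport fun hx =>
      hp (hs (tsupport_mixedDeriv_subset i j φ hx)), mul_zero]

/-! ### Rotations -/

/-- The rotation of the plane by an element of the unit circle. -/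
def rotEquiv (a : Circle) : ℝ × ℝ ≃ᵐ ℝ × ℝ :=
  (Complex.measurableEquivRealProd.symm.trans (rotation a).toMeasurableEquiv).trans
    Complex.measurableEquivRealProd

theorem zMap_rotEquiv (a : Circle) (p : ℝ × ℝ) : zMap (rotEquiv a p) = a * zMap p := by
  have : ∀ z : ℂ, zMap (Complex.measurableEquivRealProd z) = z := fun z => by
    rw [zMap_apply]; rfl
  change zMap (Complex.measurableEquivRealProd (rotation a _)) = _
  rw [this, rotation_apply, zMap_apply]
  rfl

theorem zbarMap_rotEquiv (a : Circle) (p : ℝ × ℝ) :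
    zbarMap (rotEquiv a p) = (a⁻¹ : Circle) * zbarMap p := by
  rw [zbarMap_apply, zMap_rotEquiv, map_mul, zbarMap_apply, Circle.coe_inv_eq_conj]

theorem diskW_rotEquiv (a : Circle) (p : ℝ × ℝ) : diskW (rotEquiv a p) = diskW p := by
  have h : (diskW (rotEquiv a p) : ℂ) = diskW p := by
    rw [← one_sub_zMap_mul_zbarMap, zMap_rotEquiv, zbarMap_rotEquiv, ← one_sub_zMap_mul_zbarMap]
    have : (a : ℂ) * (a⁻¹ : Circle) = 1 := by rw [← Circle.coe_mul]; simp
    linear_combination (-zMap p * zbarMap p) * this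
  exact_mod_cast h

theorem rotEquiv_mem_disk (a : Circle) (p : ℝ × ℝ) : rotEquiv a p ∈ Disk ↔ p ∈ Disk := by
  have h : ∀ q : ℝ × ℝ, q ∈ Disk ↔ 0 < diskW q := fun q =>
    (sub_pos (a := (1 : ℝ)) (b := q.1 ^ 2 + q.2 ^ 2)).symm
  rw [h, h, diskW_rotEquiv]

theorem diskFun_rotEquiv (γ : ℝ) (l n : ℕ) (a : Circle) (p : ℝ × ℝ) :
    diskFun γ (n + l) n (rotEquiv a p) = (a : ℂ) ^ l * diskFun γ (n + l) n p := by
  rw [diskFun, zMap_rotEquiv, zbarMap_rotEquiv, diskPoly_mul_mul _ _ _ _ _ _ _ _ (by omega)]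
  · simp [diskFun]
  · rw [← Circle.coe_mul]; simp

theorem measurePreserving_rotEquiv (a : Circle) (β : ℝ) :
    MeasurePreserving (rotEquiv a) (wMeasure β) (wMeasure β) := by
  have h : MeasurePreserving (rotEquiv a) (volume : Measure (ℝ × ℝ)) volume :=
    (Complex.volume_preserving_equiv_real_prod.symm.trans (rotation a).measurePreserving).trans
      Complex.volume_preserving_equiv_real_prod
  have h1 : MeasurePreserving (rotEquiv a) (volume.restrict Disk) (volume.restrict Disk) := by
    have := h.restrict_preimage_emb (rotEquiv a).measurableEmbedding Disk
    rwa [show rotEquiv a ⁻¹' Disk = Disk from ext fun p => rotEquiv_mem_disk a p] at this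
  refine ⟨(rotEquiv a).measurable, ?_⟩
  ext s hs
  rw [Measure.map_apply (rotEquiv a).measurable hs, wMeasure,
    withDensity_apply _ ((rotEquiv a).measurable hs), withDensity_apply _ hs]
  refine Eq.trans ?_ (h1.setLIntegral_comp_preimage_emb (rotEquiv a).measurableEmbedding _ s)
  refine lintegral_congr fun p => ?_
  change ENNReal.ofReal (diskW p ^ β) = ENNReal.ofReal (diskW (rotEquiv a p) ^ β)
  rw [diskW_rotEquiv]

theorem integral_rotEquiv (a : Circle) (β : ℝ) (f : ℝ × ℝ → ℂ) :
    ∫ p, f (rotEquiv a p) ∂wMeasure β = ∫ p, f p ∂wMeasure β :=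
  (measurePreserving_rotEquiv a β).integral_comp' f

/-! ### Orthogonality -/

/-- A rotation by the angle `π / k` changes the sign of the integral. -/
theorem integral_eq_zero_of_rotEquiv (β : ℝ) {f : ℝ × ℝ → ℂ} {k : ℤ} (hk : k ≠ 0)
    (h : ∀ (a : Circle) p, f (rotEquiv a p) = (a : ℂ) ^ k * f p) :
    ∫ p, f p ∂wMeasure β = 0 := by
  have ha : ((Circle.exp (Real.pi / k) : Circle) : ℂ) ^ k = -1 := by
    have hk' : (k : ℂ) ≠ 0 := by exact_mod_cast hk
    rw [Circle.coe_exp, ← Complex.exp_int_mul, ← Complex.exp_pi_mul_I]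
    congr 1
    push_cast
    field_simp
  have h1 := integral_rotEquiv (Circle.exp (Real.pi / k)) β f
  simp only [h, ha] at h1
  rw [integral_const_mul] at h1
  linear_combination (-1 / 2 : ℂ) * h1

/-- The product of two real parts, `Re A Re B = (Re (A B) + Re (A conj B)) / 2`, reduces the
orthogonality relations to functions which are homogeneous under rotations. -/
theorem integral_re_mul_re_diskFun {β : ℝ} (hβ : 0 ≤ β) (γ γ' : ℝ) (c c' : ℂ) {m n m' n' : ℕ} :
    ∫ p, (c * diskFun γ m n p).re * (c' * diskFun γ' m' n' p).re ∂wMeasure β =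
      ((∫ p, c * c' * (diskFun γ m n p * diskFun γ' m' n' p) ∂wMeasure β).re
      + (∫ p, c * (starRingEnd ℂ) c' * (diskFun γ m n p * (starRingEnd ℂ) (diskFun γ' m' n' p))
          ∂wMeasure β).re) / 2 := by
  have hQ := (contDiff_diskFun γ m n).continuous
  have hQ' := (contDiff_diskFun γ' m' n').continuous
  have i1 : Integrable (fun p => c * c' * (diskFun γ m n p * diskFun γ' m' n' p)) (wMeasure β) :=
    memLp_one_iff_integrable.1 (memLp_wMeasure_of_continuous hβ (by fun_prop) 1)
  have i2 : Integrable (fun p => c * (starRingEnd ℂ) c' *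
      (diskFun γ m n p * (starRingEnd ℂ) (diskFun γ' m' n' p))) (wMeasure β) :=
    memLp_one_iff_integrable.1 (memLp_wMeasure_of_continuous hβ
      (continuous_const.mul (hQ.mul (Complex.continuous_conj.comp hQ'))) 1)
  have h1 := Complex.reCLM.integral_comp_comm i1
  have h2 := Complex.reCLM.integral_comp_comm i2
  have h3 := integral_add (Complex.reCLM.integrable_comp i1) (Complex.reCLM.integrable_comp i2)
  simp only [Complex.reCLM_apply] at h1 h2 h3
  rw [← h1, ← h2, ← h3, ← integral_div]
  congr 1
  ext p
  rw [← Complex.add_re, show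
    c * c' * (diskFun γ m n p * diskFun γ' m' n' p) + c * (starRingEnd ℂ) c' *
      (diskFun γ m n p * (starRingEnd ℂ) (diskFun γ' m' n' p)) =
    (c * diskFun γ m n p) * ((c' * diskFun γ' m' n' p)
      + (starRingEnd ℂ) (c' * diskFun γ' m' n' p)) by rw [map_mul]; ring, Complex.add_conj,
    mul_comm (c * diskFun γ m n p), Complex.re_ofReal_mul]
  ring

/-- Orthogonality of functions with different angular frequencies. -/
theorem integral_re_mul_re_eq_zero {β : ℝ} (hβ : 0 ≤ β) (γ γ' : ℝ) (c c' : ℂ) {l l' : ℕ}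
    (n n' : ℕ) (hl : l ≠ l') :
    ∫ p, (c * diskFun γ (n + l) n p).re * (c' * diskFun γ' (n' + l') n' p).re ∂wMeasure β = 0 := by
  rw [integral_re_mul_re_diskFun hβ,
    integral_eq_zero_of_rotEquiv β (k := (l : ℤ) + l') (by omega) fun a p => ?_,
    integral_eq_zero_of_rotEquiv β (k := (l : ℤ) - l') (by omega) fun a p => ?_]
  · simp
  · simp only [diskFun_rotEquiv]
    have hz : (a : ℂ) ≠ 0 := a.coe_ne_zero
    rw [map_mul, map_pow, ← Circle.coe_inv_eq_conj, Circle.coe_inv, zpow_sub₀ hz, zpow_natCast,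
      zpow_natCast, inv_pow]
    field_simp
  · simp only [diskFun_rotEquiv]
    have hz : (a : ℂ) ≠ 0 := a.coe_ne_zero
    rw [zpow_add₀ hz, zpow_natCast, zpow_natCast]
    ring

/-- Orthogonality of the real and the imaginary part of the same disk polynomial. -/
theorem integral_re_mul_re_eq_zero_of_re_eq_zero {β : ℝ} (hβ : 0 ≤ β) (γ : ℝ) {c c' : ℂ} {l : ℕ}
    (n : ℕ) (hl : l ≠ 0) (hc : (c * (starRingEnd ℂ) c').re = 0) :
    ∫ p, (c * diskFun γ (n + l) n p).re * (c' * diskFun γ (n + l) n p).re ∂wMeasure β = 0 := by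
  rw [integral_re_mul_re_diskFun hβ,
    integral_eq_zero_of_rotEquiv β (k := (l : ℤ) + l) (by omega) fun a p => ?_]
  · have e : ∀ p, c * (starRingEnd ℂ) c' * (diskFun γ (n + l) n p *
        (starRingEnd ℂ) (diskFun γ (n + l) n p)) =
        c * (starRingEnd ℂ) c' * ((Complex.normSq (diskFun γ (n + l) n p) : ℝ) : ℂ) := fun p => by
      rw [Complex.mul_conj]
    simp only [e]
    rw [integral_const_mul, integral_complex_ofReal, mul_comm, Complex.re_ofReal_mul, hc]
    simp
  · simp only [diskFun_rotEquiv]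
    have hz : (a : ℂ) ≠ 0 := a.coe_ne_zero
    rw [zpow_add₀ hz, zpow_natCast]
    ring

/-- The Sobolev form of order `s` of a smooth function and the real part of a disk polynomial. -/
theorem sum_integral_mixedDeriv_mul_mixedDeriv {γ : ℝ} (hγ : 0 ≤ γ) (s : ℕ) {f : ℝ × ℝ → ℝ}
    (hf : ContDiff ℝ (⊤ : ℕ∞) f) (c : ℂ) (m n : ℕ) :
    ∑ ij ∈ Finset.HasAntidiagonal.antidiagonal s, (s.choose ij.1 : ℝ) *
        ∫ p, mixedDeriv ij.1 ij.2 f p * mixedDeriv ij.1 ij.2 (fun p => (c * diskFun γ m n p).re) p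
          ∂wMeasure (γ + s)
      = eigenvalue s γ m n * ∫ p, f p * (c * diskFun γ m n p).re ∂wMeasure γ :=
  sum_integral_mixedDeriv_eq hγ s (memLp_wMeasure_of_continuous hγ hf.continuous 2)
    (fun _ _ => ⟨isWeakDeriv_mixedDeriv hf _ _, memLp_wMeasure_of_continuous (by positivity)
      (contDiff_mixedDeriv _ _ hf).continuous 2⟩) c m n

theorem eigenvalue_one (γ : ℝ) (m n : ℕ) :
    eigenvalue 1 γ m n = 2 * (m * (n + γ + 1) + n * (m + γ + 1)) := by
  simp [eigenvalue]

/-- Orthogonality of functions with the same angular frequency: they belong to different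
eigenvalues of the Sobolev form of order one. -/
theorem integral_re_mul_re_eq_zero_of_ne {γ : ℝ} (hγ : 0 ≤ γ) (c c' : ℂ) (l : ℕ) {n n' : ℕ}
    (hn : n ≠ n') :
    ∫ p, (c * diskFun γ (n + l) n p).re * (c' * diskFun γ (n' + l) n' p).re ∂wMeasure γ = 0 := by
  have h1 := sum_integral_mixedDeriv_mul_mixedDeriv hγ 1
    (contDiff_re_mul_diskFun γ c (n + l) n) c' (n' + l) n'
  have h2 := sum_integral_mixedDeriv_mul_mixedDeriv hγ 1
    (contDiff_re_mul_diskFun γ c' (n' + l) n') c (n + l) n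
  simp only [mul_comm (mixedDeriv _ _ (fun p => (c' * diskFun γ (n' + l) n' p).re) _),
    mul_comm (c' * diskFun γ (n' + l) n' _).re] at h2
  rw [h1, eigenvalue_one, eigenvalue_one] at h2
  set I := ∫ p, (c * diskFun γ (n + l) n p).re * (c' * diskFun γ (n' + l) n' p).re ∂wMeasure γ
  have h3 : (((n' : ℝ) - n) * (n' + n + l + γ + 1)) * I = 0 := by
    push_cast at h2
    linear_combination h2 / 4
  rcases mul_eq_zero.1 h3 with h | h
  · exfalso
    rcases mul_eq_zero.1 h with h | h
    · exact hn (by exact_mod_cast (sub_eq_zero.1 h).symm)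
    · have : 0 < (n' : ℝ) + n + l + γ + 1 := by positivity
      exact this.ne' h
  · exact h

theorem basisConst_mul_conj_re (γ : ℝ) (l n : ℕ) {μ μ' : ℤˣ} (h : μ ≠ μ') :
    (basisConst γ l n μ * (starRingEnd ℂ) (basisConst γ l n μ')).re = 0 := by
  simp only [basisConst]
  generalize (if l = 0 then 1 / 2 else 1 : ℝ) / (n.factorial * Real.Gamma (n + 1 + γ + l)) = A
  rcases Int.units_eq_one_or μ with rfl | rfl <;> rcases Int.units_eq_one_or μ' with rfl | rfl
  · exact absurd rfl h
  · simp
  · simp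
  · exact absurd rfl h

theorem integral_basisFun_mul_basisFun {γ : ℝ} (hγ : 0 ≤ γ) {i i' : BasisIndex} (h : i ≠ i') :
    ∫ p, basisFun γ i.1.1 i.1.2.1 i.1.2.2 p * basisFun γ i'.1.1 i'.1.2.1 i'.1.2.2 p
      ∂wMeasure γ = 0 := by
  obtain ⟨⟨l, n, μ⟩, hi⟩ := i
  obtain ⟨⟨l', n', μ'⟩, hi'⟩ := i'
  simp only [basisFun_eq hγ]
  by_cases hl : l = l'
  · subst hl
    by_cases hn : n = n'
    · subst hn
      have hμ : μ ≠ μ' := fun hμ => h (by subst hμ; rfl)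
      have hl : l ≠ 0 := by
        rintro rfl
        simp only [not_and, true_implies] at hi hi'
        rcases Int.units_eq_one_or μ with rfl | rfl
        · rcases Int.units_eq_one_or μ' with rfl | rfl
          · exact hμ rfl
          · exact hi' rfl
        · exact hi rfl
      exact integral_re_mul_re_eq_zero_of_re_eq_zero hγ γ n hl (basisConst_mul_conj_re γ l n hμ)
    · exact integral_re_mul_re_eq_zero_of_ne hγ _ _ l hn
  · exact integral_re_mul_re_eq_zero hγ γ γ _ _ n n' hl

/-! ### The basis functions do not vanish -/

/-- If a disk polynomial vanished on the disk, then so would its derivatives, among them a non-zero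
constant. -/
theorem not_eqOn_diskFun_zero {γ : ℝ} (hγ : 0 ≤ γ) (m n : ℕ) :
    ¬ EqOn (diskFun γ m n) (fun _ => 0) Disk := by
  intro h
  have step : ∀ {γ : ℝ} {m n : ℕ}, EqOn (diskFun γ m n) (fun _ => 0) Disk → ∀ p ∈ Disk,
      (m : ℂ) * diskFun (γ + 1) (m - 1) n p = 0 ∧ (n : ℂ) * diskFun (γ + 1) m (n - 1) p = 0 := by
    intro γ m n h p hp
    have hx := dirDeriv_congr isOpen_disk h (1, 0) hp
    have hy := dirDeriv_congr isOpen_disk h (0, 1) hp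
    rw [dirDeriv_diskFun_x] at hx
    rw [dirDeriv_diskFun_y] at hy
    simp only [dirDeriv, fderiv_fun_const, Pi.zero_apply, zero_apply] at hx hy
    constructor
    · linear_combination hx / 2 - Complex.I / 2 * hy
        + (m * diskFun (γ + 1) (m - 1) n p - n * diskFun (γ + 1) m (n - 1) p) / 2 * Complex.I_sq
    · linear_combination hx / 2 + Complex.I / 2 * hy
        - (m * diskFun (γ + 1) (m - 1) n p - n * diskFun (γ + 1) m (n - 1) p) / 2 * Complex.I_sq
  induction m generalizing γ with
  | zero =>
    induction n generalizing γ with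
    | zero =>
      have h0 : (0 : ℝ × ℝ) ∈ Disk := by simp [Disk]
      have := h h0
      simp only [diskFun, diskPoly, diskCoeff, zero_add, Finset.range_one,
        Finset.sum_singleton] at this
      simp at this
      exact (Real.Gamma_pos_of_pos (show 0 < 1 + γ by positivity)).ne' (by exact_mod_cast this)
    | succ n ih =>
      refine ih (γ := γ + 1) (by positivity) fun p hp => ?_
      have := (step h p hp).2
      rw [mul_eq_zero] at this
      exact this.resolve_left (Nat.cast_ne_zero.2 (Nat.succ_ne_zero n))
  | succ m ih =>
    refine ih (γ := γ + 1) (by positivity) fun p hp => ?_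
    have := (step h p hp).1
    rw [mul_eq_zero] at this
    exact this.resolve_left (Nat.cast_ne_zero.2 (Nat.succ_ne_zero m))

theorem conj_diskFun (γ : ℝ) (m n : ℕ) (p : ℝ × ℝ) :
    (starRingEnd ℂ) (diskFun γ m n p) = diskFun γ n m p := by
  rw [diskFun, star_diskPoly, diskPoly_comm, diskFun, zbarMap_apply, Complex.conj_conj]

theorem im_diskFun_self (γ : ℝ) (n : ℕ) (p : ℝ × ℝ) : (diskFun γ n n p).im = 0 :=
  Complex.conj_eq_iff_im.1 (conj_diskFun γ n n p)

theorem not_eqOn_basisFun_zero {γ : ℝ} (hγ : 0 ≤ γ) (i : BasisIndex) :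
    ¬ EqOn (basisFun γ i.1.1 i.1.2.1 i.1.2.2) (fun _ => 0) Disk := by
  obtain ⟨⟨l, n, μ⟩, hi⟩ := i
  intro h
  refine not_eqOn_diskFun_zero hγ (n + l) n fun p hp => ?_
  have hc := basisConst_ne_zero hγ l n μ
  have h1 : ∀ q ∈ Disk, (basisConst γ l n μ * diskFun γ (n + l) n q).re = 0 := fun q hq => by
    have := h hq
    rwa [basisFun_eq hγ] at this
  rcases Nat.eq_zero_or_pos l with rfl | hl
  · simp only [not_and, true_implies] at hi
    obtain rfl : μ = 1 := (Int.units_eq_one_or μ).resolve_right hi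
    have h2 := h1 p hp
    apply Complex.ext
    · rw [basisConst, if_pos rfl, if_pos rfl, mul_one, Complex.re_ofReal_mul] at h2
      exact (mul_eq_zero.1 h2).resolve_left (basisConst_scale_pos hγ 0 n).ne'
    · exact im_diskFun_self γ n p
  · -- rotating by the angle `π / (2l)` exchanges real and imaginary part
    have h2 := h1 _ ((rotEquiv_mem_disk (Circle.exp (Real.pi / 2 / l)) p).2 hp)
    have ha : ((Circle.exp (Real.pi / 2 / l) : Circle) : ℂ) ^ l = Complex.I := by
      have hl' : (l : ℂ) ≠ 0 := by exact_mod_cast hl.ne'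
      refine Eq.trans ?_ Complex.exp_pi_div_two_mul_I
      rw [Circle.coe_exp, ← Complex.exp_nat_mul]
      push_cast
      field_simp
    rw [diskFun_rotEquiv, ha, mul_left_comm, Complex.I_mul_re, neg_eq_zero] at h2
    exact (mul_eq_zero.1 (Complex.ext (h1 p hp) h2)).resolve_left hc

theorem memLp_basisFun {γ : ℝ} (hγ : 0 ≤ γ) (l n : ℕ) (μ : ℤˣ) :
    MemLp (basisFun γ l n μ) 2 (wMeasure γ) :=
  memLp_wMeasure_of_continuous hγ (contDiff_basisFun hγ l n μ).continuous 2

theorem basisNorm_pos {γ : ℝ} (hγ : 0 ≤ γ) (i : BasisIndex) :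
    0 < basisNorm γ i.1.1 i.1.2.1 i.1.2.2 := by
  refine ENNReal.toReal_pos (fun h => not_eqOn_basisFun_zero hγ i ?_)
    (memLp_basisFun hγ _ _ _).eLpNorm_lt_top.ne
  have hc := (contDiff_basisFun hγ i.1.1 i.1.2.1 i.1.2.2).continuous
  rw [wNorm, eLpNorm_eq_zero_iff hc.aestronglyMeasurable (by norm_num)] at h
  exact Measure.eqOn_open_of_ae_eq ((absolutelyContinuous_wMeasure γ).ae_eq h) isOpen_disk
    hc.continuousOn continuousOn_const

/-! ### Completeness -/

section Completeness

variable {γ : ℝ} {u : ℝ × ℝ → ℝ}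

/-- The basis functions only come from bidegrees `(m, n)` with `n ≤ m`; conjugation gives the
others. -/
theorem integral_mul_re_diskFun_eq_zero (hγ : 0 ≤ γ) (hu : MemLp u 2 (wMeasure γ))
    (h : ∀ i : BasisIndex, ∫ p, u p * basisFun γ i.1.1 i.1.2.1 i.1.2.2 p ∂wMeasure γ = 0)
    (c : ℂ) (m n : ℕ) : ∫ p, u p * (c * diskFun γ m n p).re ∂wMeasure γ = 0 := by
  have hint : ∀ (c : ℂ) (m n : ℕ),
      Integrable (fun p => u p * (c * diskFun γ m n p).re) (wMeasure γ) := fun c m n =>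
    hu.integrable_mul
      (memLp_wMeasure_of_continuous hγ (contDiff_re_mul_diskFun γ c m n).continuous 2)
  have hb : ∀ (l n : ℕ) (μ : ℤˣ), ¬(l = 0 ∧ μ = -1) →
      ∫ p, u p * ((if μ = 1 then 1 else -Complex.I) * diskFun γ (n + l) n p).re
        ∂wMeasure γ = 0 := by
    intro l n μ hi
    have h1 := h ⟨(l, n, μ), hi⟩
    simp only [basisFun_eq hγ, basisConst, mul_assoc, Complex.re_ofReal_mul] at h1
    simp only [mul_left_comm (u _)] at h1
    rw [integral_const_mul] at h1
    exact (mul_eq_zero.1 h1).resolve_left (basisConst_scale_pos hγ l n).ne'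
  have hre : ∀ l n : ℕ, ∫ p, u p * (diskFun γ (n + l) n p).re ∂wMeasure γ = 0 := fun l n => by
    simpa using hb l n 1 (by simp)
  have him : ∀ l n : ℕ, ∫ p, u p * (diskFun γ (n + l) n p).im ∂wMeasure γ = 0 := fun l n => by
    rcases Nat.eq_zero_or_pos l with rfl | hl
    · simp [im_diskFun_self]
    · simpa using hb l n (-1) (fun h => hl.ne' h.1)
  have hle : ∀ (c : ℂ) (m n : ℕ), n ≤ m →
      ∫ p, u p * (c * diskFun γ m n p).re ∂wMeasure γ = 0 := by
    intro c m n hmn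
    obtain ⟨l, rfl⟩ := Nat.exists_eq_add_of_le hmn
    have i1 : Integrable (fun p => c.re * (u p * (diskFun γ (n + l) n p).re)) (wMeasure γ) := by
      simpa using (hint 1 (n + l) n).const_mul c.re
    have i2 : Integrable (fun p => c.im * (u p * (diskFun γ (n + l) n p).im)) (wMeasure γ) := by
      simpa using (hint (-Complex.I) (n + l) n).const_mul c.im
    have : ∀ p, u p * (c * diskFun γ (n + l) n p).re =
        c.re * (u p * (diskFun γ (n + l) n p).re) - c.im * (u p * (diskFun γ (n + l) n p).im) :=
      fun p => by rw [Complex.mul_re]; ring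
    simp only [this]
    rw [integral_sub i1 i2, integral_const_mul, integral_const_mul, hre, him]
    simp
  rcases le_total n m with hmn | hmn
  · exact hle c m n hmn
  · have : ∀ p, (c * diskFun γ m n p).re = ((starRingEnd ℂ) c * diskFun γ n m p).re := fun p => by
      rw [← conj_diskFun γ m n, ← map_mul, Complex.conj_re]
    simp only [this]
    exact hle _ n m hmn

theorem continuous_re_monomial (c : ℂ) (a b : ℕ) :
    Continuous fun p => (c * (zMap p ^ a * zbarMap p ^ b)).re := by fun_prop

/-- A function orthogonal to the basis is orthogonal to all monomials in `z` and its conjugate: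
the disk polynomials are obtained from the monomials by a triangular transformation. -/
theorem integral_mul_re_monomial_eq_zero (hγ : 0 ≤ γ) (hu : MemLp u 2 (wMeasure γ))
    (h : ∀ i : BasisIndex, ∫ p, u p * basisFun γ i.1.1 i.1.2.1 i.1.2.2 p ∂wMeasure γ = 0)
    (c : ℂ) (a b : ℕ) : ∫ p, u p * (c * (zMap p ^ a * zbarMap p ^ b)).re ∂wMeasure γ = 0 := by
  have hint : ∀ (c : ℂ) (a b : ℕ),
      Integrable (fun p => u p * (c * (zMap p ^ a * zbarMap p ^ b)).re) (wMeasure γ) :=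
    fun c a b => hu.integrable_mul
      (memLp_wMeasure_of_continuous hγ (continuous_re_monomial c a b) 2)
  induction b using Nat.strong_induction_on generalizing a c with
  | _ b ih =>
    -- the leading coefficient of the disk polynomial
    have hG : (diskCoeff γ a b 0 : ℂ) ≠ 0 := by
      have : diskCoeff γ a b 0 ≠ 0 := by
        simp only [diskCoeff, Nat.descFactorial_zero, Nat.choose_zero_right]
        have : Real.Gamma (a + b - (0 : ℕ) + 1 + γ) ≠ 0 :=
          (Real.Gamma_pos_of_pos (by push_cast; rw [sub_zero]; positivity)).ne'
        simpa using this
      exact_mod_cast this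
    have h1 := integral_mul_re_diskFun_eq_zero hγ hu h (c / diskCoeff γ a b 0) a b
    have e : ∀ p, u p * (c / diskCoeff γ a b 0 * diskFun γ a b p).re =
        ∑ k ∈ Finset.range (b + 1), u p * (c / diskCoeff γ a b 0 * diskCoeff γ a b k *
          (zMap p ^ (a - k) * zbarMap p ^ (b - k))).re := fun p => by
      rw [diskFun, diskPoly, Finset.mul_sum, Complex.re_sum, Finset.mul_sum]
      refine Finset.sum_congr rfl fun k _ => ?_
      rw [mul_assoc (c / _)]
    simp only [e] at h1
    rw [integral_finsetSum _ fun k _ => hint _ _ _, Finset.sum_range_succ'] at h1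
    rw [Finset.sum_eq_zero fun k hk => ih (b - (k + 1))
      (by have := Finset.mem_range.1 hk; omega) _ _, zero_add] at h1
    rw [div_mul_cancel₀ _ hG] at h1
    exact h1

theorem integral_mul_re_eval_eq_zero (hγ : 0 ≤ γ) (hu : MemLp u 2 (wMeasure γ))
    (h : ∀ i : BasisIndex, ∫ p, u p * basisFun γ i.1.1 i.1.2.1 i.1.2.2 p ∂wMeasure γ = 0)
    (P : MvPolynomial (Fin 2) ℂ) :
    ∫ p, u p * (MvPolynomial.eval ![zMap p, zbarMap p] P).re ∂wMeasure γ = 0 := by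
  have e : ∀ p, u p * (MvPolynomial.eval ![zMap p, zbarMap p] P).re = ∑ d ∈ P.support,
      u p * (P.coeff d * (zMap p ^ d 0 * zbarMap p ^ d 1)).re := fun p => by
    rw [MvPolynomial.eval_eq', Complex.re_sum, Finset.mul_sum]
    simp [Fin.prod_univ_two]
  have hint : ∀ (c : ℂ) (a b : ℕ),
      Integrable (fun p => u p * (c * (zMap p ^ a * zbarMap p ^ b)).re) (wMeasure γ) :=
    fun c a b => hu.integrable_mul
      (memLp_wMeasure_of_continuous hγ (continuous_re_monomial c a b) 2)
  simp only [e]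
  rw [integral_finsetSum _ fun d _ => hint _ _ _]
  exact Finset.sum_eq_zero fun d _ => integral_mul_re_monomial_eq_zero hγ hu h _ _ _

/-- By the Stone-Weierstrass theorem, a continuous function is approximated on the disk by
polynomials in `z` and its conjugate. -/
theorem exists_mvPolynomial_near {g : ℝ × ℝ → ℝ} (hg : Continuous g) {ε : ℝ} (hε : 0 < ε) :
    ∃ P : MvPolynomial (Fin 2) ℂ, ∀ p ∈ Disk,
      |g p - (MvPolynomial.eval ![zMap p, zbarMap p] P).re| ≤ ε := by
  let K := Metric.closedBall (0 : ℝ × ℝ) 1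
  have hK : CompactSpace K := isCompact_iff_compactSpace.1 (isCompact_closedBall _ _)
  let X : C(K, ℝ) := ⟨fun p => p.1.1, by fun_prop⟩
  let Y : C(K, ℝ) := ⟨fun p => p.1.2, by fun_prop⟩
  let A : Subalgebra ℝ C(K, ℝ) := Algebra.adjoin ℝ {X, Y}
  have hA : A.SeparatesPoints := by
    intro p q hpq
    by_cases h1 : p.1.1 = q.1.1
    · have h2 : p.1.2 ≠ q.1.2 := fun h2 => hpq (Subtype.ext (Prod.ext h1 h2))
      exact ⟨Y, ⟨Y, Algebra.subset_adjoin (by simp), rfl⟩, h2⟩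
    · exact ⟨X, ⟨X, Algebra.subset_adjoin (by simp), rfl⟩, h1⟩
  have hpoly : ∀ f ∈ A, ∃ P : MvPolynomial (Fin 2) ℂ, ∀ p : K,
      MvPolynomial.eval ![zMap p.1, zbarMap p.1] P = ((f p : ℝ) : ℂ) := by
    intro f hf
    have hz : ∀ p : ℝ × ℝ, zMap p = p.1 + p.2 * Complex.I := fun p => by
      rw [zMap_apply, Complex.mk_eq_add_mul_I]
    have hzb : ∀ p : ℝ × ℝ, zbarMap p = p.1 - p.2 * Complex.I := fun p => by
      rw [zbarMap_apply, hz]; simp [sub_eq_add_neg]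
    induction hf using Algebra.adjoin_induction with
    | mem f hf =>
      rcases hf with rfl | rfl
      · refine ⟨MvPolynomial.C (1 / 2) * (MvPolynomial.X 0 + MvPolynomial.X 1), fun p => ?_⟩
        simp [hz, hzb, X]
        ring
      · refine ⟨MvPolynomial.C (-Complex.I / 2) * (MvPolynomial.X 0 - MvPolynomial.X 1),
          fun p => ?_⟩
        simp [hz, hzb, Y]
        linear_combination -(p.1.2 : ℂ) * Complex.I_sq
    | algebraMap r => exact ⟨MvPolynomial.C r, fun p => by simp⟩
    | add f f' _ _ hf hf' =>
      obtain ⟨P, hP⟩ := hf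
      obtain ⟨P', hP'⟩ := hf'
      exact ⟨P + P', fun p => by simp [hP, hP']⟩
    | mul f f' _ _ hf hf' =>
      obtain ⟨P, hP⟩ := hf
      obtain ⟨P', hP'⟩ := hf'
      exact ⟨P * P', fun p => by simp [hP, hP']⟩
  obtain ⟨f, hf⟩ := ContinuousMap.exists_mem_subalgebra_near_continuousMap_of_separatesPoints A hA
    ⟨fun p : K => g p.1, by fun_prop⟩ ε hε
  obtain ⟨P, hP⟩ := hpoly f.1 f.2
  refine ⟨P, fun p hp => ?_⟩
  have h1 := hP ⟨p, disk_subset_closedBall hp⟩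
  beta_reduce at h1
  rw [h1, Complex.ofReal_re, abs_sub_comm]
  have h2 := (ContinuousMap.norm_coe_le_norm _ ⟨p, disk_subset_closedBall hp⟩).trans hf.le
  simpa using h2

/-- Completeness of the system of basis functions. -/
theorem ae_eq_zero_of_integral_mul_basisFun_eq_zero (hγ : 0 ≤ γ) (hu : MemLp u 2 (wMeasure γ))
    (h : ∀ i : BasisIndex, ∫ p, u p * basisFun γ i.1.1 i.1.2.1 i.1.2.2 p ∂wMeasure γ = 0) :
    u =ᵐ[wMeasure γ] 0 := by
  have hui := MemLp.integrable_wMeasure hγ hu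
  have hcont : ∀ g : ℝ × ℝ → ℝ, Continuous g → ∫ p, u p * g p ∂wMeasure γ = 0 := by
    intro g hg
    have hM : 0 ≤ ∫ p, ‖u p‖ ∂wMeasure γ := integral_nonneg fun _ => norm_nonneg _
    have hle : ∀ ε > 0, |∫ p, u p * g p ∂wMeasure γ| ≤ ε * ∫ p, ‖u p‖ ∂wMeasure γ := by
      intro ε hε
      obtain ⟨P, hP⟩ := exists_mvPolynomial_near hg hε
      have hPc : Continuous fun p => (MvPolynomial.eval ![zMap p, zbarMap p] P).re := by
        simp only [MvPolynomial.eval_eq', Fin.prod_univ_two, Matrix.cons_val_zero,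
          Matrix.cons_val_one]
        fun_prop
      have i1 : Integrable (fun p => u p * g p) (wMeasure γ) :=
        hu.integrable_mul (memLp_wMeasure_of_continuous hγ hg 2)
      have i2 : Integrable (fun p => u p * (MvPolynomial.eval ![zMap p, zbarMap p] P).re)
          (wMeasure γ) := hu.integrable_mul (memLp_wMeasure_of_continuous hγ hPc 2)
      have e := integral_sub i1 i2
      rw [integral_mul_re_eval_eq_zero hγ hu h P, sub_zero] at e
      rw [← e, ← integral_const_mul, ← Real.norm_eq_abs]
      refine norm_integral_le_of_norm_le (hui.norm.const_mul ε) ?_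
      filter_upwards [ae_mem_disk γ] with p hp
      rw [← mul_sub, norm_mul, mul_comm]
      exact mul_le_mul_of_nonneg_right (hP p hp) (norm_nonneg _)
    have h0 : |∫ p, u p * g p ∂wMeasure γ| ≤ 0 := by
      refine le_of_forall_pos_le_add fun δ hδ => ?_
      have := hle (δ / (∫ p, ‖u p‖ ∂wMeasure γ + 1)) (by positivity)
      refine this.trans ?_
      rw [zero_add, div_mul_eq_mul_div, div_le_iff₀ (by positivity)]
      nlinarith
    exact abs_nonpos_iff.1 h0
  have hloc := (integrable_wMeasure_iff γ u).1 hui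
  have hae : ∀ᵐ p ∂(volume : Measure (ℝ × ℝ)), p ∈ Disk → diskW p ^ γ * u p = 0 := by
    apply isOpen_disk.ae_eq_zero_of_integral_contDiff_smul_eq_zero hloc.locallyIntegrableOn
    intro φ hφ hc hs
    have e := hcont φ hφ.continuous
    rw [integral_wMeasure, setIntegral_eq_integral_of_forall_compl_eq_zero] at e
    · rw [← e]
      congr 1
      ext p
      simp only [smul_eq_mul]
      ring
    · intro p hp
      rw [image_eq_zero_of_notMem_tsupport fun hx => hp (hs hx)]
      simp
  refine (wMeasure_absolutelyContinuous γ).ae_le ?_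
  change ∀ᵐ p ∂volume.restrict Disk, u p = 0
  rw [ae_restrict_iff' isOpen_disk.measurableSet]
  filter_upwards [hae] with p hp hd
  exact (mul_eq_zero.1 (hp hd)).resolve_left (Real.rpow_pos_of_pos (diskW_pos hd) γ).ne'

end Completeness

/-! ### Expansions in orthogonal families -/

section Orthogonal

variable {H ι : Type*} [NormedAddCommGroup H] [InnerProductSpace ℝ H]
  [DecidableEq ι] {d : ι → H} {Λ : ι → ℝ}

/-- Pythagoras for an orthogonal family with squared norms `Λ i`, which may vanish. -/
theorem norm_sum_smul_sq_of_orthogonal (hd : ∀ i j, inner ℝ (d i) (d j) = if i = j then Λ i else 0)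
    (b : ι → ℝ) (S : Finset ι) :
    ‖∑ i ∈ S, b i • d i‖ ^ 2 = ∑ i ∈ S, Λ i * b i ^ 2 := by
  rw [← real_inner_self_eq_norm_sq, sum_inner]
  refine Finset.sum_congr rfl fun i hi => ?_
  rw [inner_sum]
  simp only [real_inner_smul_left, real_inner_smul_right, hd]
  rw [Finset.sum_eq_single i]
  · simp; ring
  · intro j _ hj
    rw [if_neg (Ne.symm hj)]; simp
  · exact fun h => absurd hi h

/-- Bessel's inequality for an orthogonal family, some of whose members may vanish. -/
theorem sum_le_norm_sq_of_orthogonal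
    (hd : ∀ i j, inner ℝ (d i) (d j) = if i = j then Λ i else 0) {V : H} {b : ι → ℝ}
    (hV : ∀ i, inner ℝ V (d i) = Λ i * b i) (S : Finset ι) :
    ∑ i ∈ S, Λ i * b i ^ 2 ≤ ‖V‖ ^ 2 := by
  have h := sq_nonneg ‖V - ∑ i ∈ S, b i • d i‖
  rw [norm_sub_sq_real, norm_sum_smul_sq_of_orthogonal hd, inner_sum] at h
  simp only [real_inner_smul_right, hV] at h
  have e : ∑ i ∈ S, b i * (Λ i * b i) = ∑ i ∈ S, Λ i * b i ^ 2 :=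
    Finset.sum_congr rfl fun i _ => by ring
  rw [e] at h
  linarith

theorem summable_smul_of_orthogonal [CompleteSpace H]
    (hd : ∀ i j, inner ℝ (d i) (d j) = if i = j then Λ i else 0) {b : ι → ℝ}
    (hb : Summable fun i => Λ i * b i ^ 2) : Summable fun i => b i • d i := by
  rw [summable_iff_vanishing_norm] at hb ⊢
  intro ε hε
  obtain ⟨s, hs⟩ := hb (ε ^ 2) (by positivity)
  refine ⟨s, fun t ht => ?_⟩
  have h1 := (le_abs_self _).trans_lt (hs t ht)
  rw [← norm_sum_smul_sq_of_orthogonal hd] at h1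
  exact lt_of_pow_lt_pow_left₀ 2 hε.le h1

theorem norm_tsum_sq_of_orthogonal [CompleteSpace H]
    (hd : ∀ i j, inner ℝ (d i) (d j) = if i = j then Λ i else 0) {b : ι → ℝ}
    (hb : Summable fun i => Λ i * b i ^ 2) :
    ‖∑' i, b i • d i‖ ^ 2 = ∑' i, Λ i * b i ^ 2 := by
  have h1 := ((summable_smul_of_orthogonal hd hb).hasSum.norm.pow 2)
  refine tendsto_nhds_unique h1 ?_
  simp only [norm_sum_smul_sq_of_orthogonal hd]
  exact hb.hasSum

end Orthogonal

/-! ### The Fourier-Jacobi expansion -/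

theorem inner_L2w {γ : ℝ} (u v : L2w γ) : inner ℝ u v = ∫ p, u p * v p ∂wMeasure γ := by
  rw [L2.inner_def]
  refine integral_congr_ae (Eventually.of_forall fun p => ?_)
  simp [mul_comm]

theorem inner_toLp_right {γ : ℝ} (u : L2w γ) {f : ℝ × ℝ → ℝ} (hf : MemLp f 2 (wMeasure γ)) :
    inner ℝ u (hf.toLp f) = ∫ p, u p * f p ∂wMeasure γ := by
  rw [inner_L2w]
  refine integral_congr_ae ?_
  filter_upwards [hf.coeFn_toLp] with p hp
  rw [hp]

theorem inner_toLp_toLp {γ : ℝ} {f g : ℝ × ℝ → ℝ} (hf : MemLp f 2 (wMeasure γ))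
    (hg : MemLp g 2 (wMeasure γ)) :
    inner ℝ (hf.toLp f) (hg.toLp g) = ∫ p, f p * g p ∂wMeasure γ := by
  rw [inner_toLp_right]
  refine integral_congr_ae ?_
  filter_upwards [hf.coeFn_toLp] with p hp
  rw [hp]

/-- The basis function with index `i`. -/
def basisFn (γ : ℝ) (i : BasisIndex) : ℝ × ℝ → ℝ := basisFun γ i.1.1 i.1.2.1 i.1.2.2

/-- The norm of the basis function with index `i`. -/
def basisNm (γ : ℝ) (i : BasisIndex) : ℝ := basisNorm γ i.1.1 i.1.2.1 i.1.2.2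

variable {γ : ℝ}

theorem contDiff_basisFn (hγ : 0 ≤ γ) (i : BasisIndex) : ContDiff ℝ (⊤ : ℕ∞) (basisFn γ i) :=
  contDiff_basisFun hγ _ _ _

theorem memLp_basisFn (hγ : 0 ≤ γ) (i : BasisIndex) : MemLp (basisFn γ i) 2 (wMeasure γ) :=
  memLp_basisFun hγ _ _ _

theorem basisNm_pos (hγ : 0 ≤ γ) (i : BasisIndex) : 0 < basisNm γ i := basisNorm_pos hγ i

theorem integral_basisFn_sq (hγ : 0 ≤ γ) (i : BasisIndex) :
    ∫ p, basisFn γ i p * basisFn γ i p ∂wMeasure γ = basisNm γ i ^ 2 := by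
  rw [← inner_toLp_toLp (memLp_basisFn hγ i) (memLp_basisFn hγ i), real_inner_self_eq_norm_sq,
    Lp.norm_toLp]
  rfl

theorem orthonormal_basisFn (hγ : 0 ≤ γ) : Orthonormal ℝ fun i : BasisIndex =>
    (basisNm γ i)⁻¹ • (memLp_basisFn hγ i).toLp (basisFn γ i) := by
  classical
  rw [orthonormal_iff_ite]
  intro i j
  have hi := (basisNm_pos hγ i).ne'
  rw [real_inner_smul_left, real_inner_smul_right, inner_toLp_toLp]
  split_ifs with h
  · subst h
    rw [integral_basisFn_sq hγ]
    field_simp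
  · rw [show ∫ p, basisFn γ i p * basisFn γ j p ∂wMeasure γ = 0 from
      integral_basisFun_mul_basisFun hγ h]
    simp

/-- The normalized basis functions form a Hilbert basis of the weighted `L²` space. -/
def diskBasis (hγ : 0 ≤ γ) : HilbertBasis BasisIndex ℝ (L2w γ) :=
  HilbertBasis.mkOfOrthogonalEqBot (orthonormal_basisFn hγ) <| by
    rw [Submodule.eq_bot_iff]
    intro u hu
    have h1 : ∀ i : BasisIndex, ∫ p, u p * basisFn γ i p ∂wMeasure γ = 0 := by
      intro i
      have h2 := (Submodule.mem_orthogonal' _ _).1 hu _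
        (Submodule.subset_span (mem_range_self i))
      rw [real_inner_smul_right, inner_toLp_right] at h2
      exact (mul_eq_zero.1 h2).resolve_left (inv_ne_zero (basisNm_pos hγ i).ne')
    exact (Lp.eq_zero_iff_ae_eq_zero).2
      (ae_eq_zero_of_integral_mul_basisFun_eq_zero hγ (Lp.memLp u) h1)

theorem diskBasis_apply (hγ : 0 ≤ γ) (i : BasisIndex) :
    diskBasis hγ i = (basisNm γ i)⁻¹ • (memLp_basisFn hγ i).toLp (basisFn γ i) := by
  rw [diskBasis, HilbertBasis.coe_mkOfOrthogonalEqBot]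

/-- The coefficient of `u` with respect to the normalized basis. -/
def fourierCoeff (hγ : 0 ≤ γ) (u : L2w γ) (i : BasisIndex) : ℝ := (diskBasis hγ).repr u i

/-- The Fourier-Jacobi integrals in terms of the coefficients of the normalized basis. -/
theorem integral_mul_basisFn (hγ : 0 ≤ γ) (u : L2w γ) (i : BasisIndex) :
    ∫ p, u p * basisFn γ i p ∂wMeasure γ = basisNm γ i * fourierCoeff hγ u i := by
  have hi := (basisNm_pos hγ i).ne'
  rw [fourierCoeff, HilbertBasis.repr_apply_apply, diskBasis_apply, real_inner_comm,
    real_inner_smul_right, inner_toLp_right]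
  field_simp

theorem hasSum_fourierCoeff_sq (hγ : 0 ≤ γ) (u : L2w γ) :
    HasSum (fun i => fourierCoeff hγ u i ^ 2) (‖u‖ ^ 2) := by
  have h := (diskBasis hγ).hasSum_inner_mul_inner u u
  rw [real_inner_self_eq_norm_sq] at h
  have e : (fun i => fourierCoeff hγ u i ^ 2) =
      fun i => inner ℝ u (diskBasis hγ i) * inner ℝ (diskBasis hγ i) u := by
    ext i
    rw [fourierCoeff, HilbertBasis.repr_apply_apply, real_inner_comm u]
    ring
  rw [e]
  exact h

theorem wNorm_sq (hγ : 0 ≤ γ) (u : L2w γ) :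
    wNorm γ u ^ 2 = ∑' i, ENNReal.ofReal (fourierCoeff hγ u i ^ 2) := by
  have h := hasSum_fourierCoeff_sq hγ u
  rw [← ENNReal.ofReal_tsum_of_nonneg (fun i => sq_nonneg _) h.summable, h.tsum_eq,
    ENNReal.ofReal_pow (norm_nonneg _), ofReal_norm, Lp.enorm_def]
  rfl

theorem hasSum_basisFn (hγ : 0 ≤ γ) (u : L2w γ) :
    HasSum (fun i => (fourierCoeff hγ u i * (basisNm γ i)⁻¹) •
      (memLp_basisFn hγ i).toLp (basisFn γ i)) u := by
  have h := (diskBasis hγ).hasSum_repr u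
  simp only [diskBasis_apply, smul_smul] at h
  exact h

/-! ### Test functions as functionals -/

/-- The weight is bounded away from zero on compact subsets of the disk. -/
theorem locallyIntegrableOn_of_memLp {β : ℝ} (hβ : 0 ≤ β) {f : ℝ × ℝ → ℝ}
    (hf : MemLp f 2 (wMeasure β)) : LocallyIntegrableOn f Disk volume := by
  have h1 := (integrable_wMeasure_iff β f).1 (MemLp.integrable_wMeasure hβ hf)
  rw [locallyIntegrableOn_iff isOpen_disk.isLocallyClosed]
  intro k hk hkc
  have h2 : IntegrableOn (fun p => diskW p ^ (-β) * (diskW p ^ β * f p)) k :=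
    (h1.mono_set hk).continuousOn_mul ((contDiffOn_rpow_diskW (-β)).continuousOn.mono hk) hkc
  refine (integrableOn_congr_fun (fun p hp => ?_) hkc.measurableSet).1 h2
  rw [← mul_assoc, ← Real.rpow_add (diskW_pos (hk hp)), neg_add_cancel, Real.rpow_zero, one_mul]

/-- Integration against a continuous function with support in the disk is a continuous functional
on the weighted `L²` space. -/
theorem exists_clm_integral_mul {β : ℝ} (hβ : 0 ≤ β) {φ : ℝ × ℝ → ℝ} (hφ : Continuous φ)
    (hs : tsupport φ ⊆ Disk) :
    ∃ T : L2w β →L[ℝ] ℝ, ∀ f : ℝ × ℝ → ℝ, ∀ hf : MemLp f 2 (wMeasure β),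
      T (hf.toLp f) = ∫ p in Disk, f p * φ p := by
  have hc : Continuous fun p => diskW p ^ (-β) * φ p := by
    refine continuous_of_tsupport fun p hp => ?_
    have hp' : p ∈ Disk := hs (closure_mono (Function.support_mul_subset_right _ _) hp)
    exact (((contDiffOn_rpow_diskW (-β)).continuousOn).continuousAt
      (isOpen_disk.mem_nhds hp')).mul hφ.continuousAt
  have hm := memLp_wMeasure_of_continuous hβ hc 2
  refine ⟨innerSL ℝ (hm.toLp _), fun f hf => ?_⟩
  rw [innerSL_apply_apply, inner_toLp_toLp, integral_wMeasure]
  refine setIntegral_congr_fun isOpen_disk.measurableSet fun p hp => ?_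
  have : diskW p ^ β * diskW p ^ (-β) = 1 := by
    rw [← Real.rpow_add (diskW_pos hp), add_neg_cancel, Real.rpow_zero]
  linear_combination φ p * f p * this

/-- Weak derivatives pass to the limit of a series of smooth functions. -/
theorem isWeakDeriv_of_hasSum {ι : Type*} {β : ℝ} (hγ : 0 ≤ γ) (hβ : 0 ≤ β) {i j : ℕ}
    {e : ι → ℝ × ℝ → ℝ} (he : ∀ k, ContDiff ℝ (⊤ : ℕ∞) (e k)) (a : ι → ℝ)
    (h1 : ∀ k, MemLp (e k) 2 (wMeasure γ)) (h2 : ∀ k, MemLp (mixedDeriv i j (e k)) 2 (wMeasure β))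
    {u : L2w γ} {g : L2w β} (hu : HasSum (fun k => a k • (h1 k).toLp (e k)) u)
    (hg : HasSum (fun k => a k • (h2 k).toLp (mixedDeriv i j (e k))) g) :
    IsWeakDeriv i j u g := by
  refine ⟨locallyIntegrableOn_of_memLp hγ (Lp.memLp u),
    locallyIntegrableOn_of_memLp hβ (Lp.memLp g), fun φ hφ hc hs => ?_⟩
  rw [iterate_partial_eq_mixedDeriv]
  obtain ⟨T, hT⟩ := exists_clm_integral_mul hγ (contDiff_mixedDeriv i j hφ).continuous
    ((tsupport_mixedDeriv_subset i j φ).trans hs)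
  obtain ⟨T', hT'⟩ := exists_clm_integral_mul hβ hφ.continuous hs
  have e1 := hT u (Lp.memLp u)
  have e2 := hT' g (Lp.memLp g)
  rw [Lp.toLp_coeFn] at e1 e2
  rw [← e1, ← e2]
  have s1 := T.hasSum hu
  have s2 := (((-1 : ℝ) ^ (i + j)) • T').hasSum hg
  have e : (fun k => T (a k • (h1 k).toLp (e k))) =
      fun k => (((-1 : ℝ) ^ (i + j)) • T') (a k • (h2 k).toLp (mixedDeriv i j (e k))) := by
    refine funext fun k => ?_
    have := (isWeakDeriv_mixedDeriv (he k) i j).2.2 φ hφ hc hs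
    rw [iterate_partial_eq_mixedDeriv] at this
    rw [map_smul, map_smul, smul_apply, hT, hT', this]
    rfl
  rw [← e] at s2
  exact s1.unique s2

/-! ### Sobolev seminorms of integer order in terms of Fourier-Jacobi coefficients -/

/-- A tuple of functions, indexed like the partial derivatives of order `s`, as a vector of a
Hilbert space, with weights which account for the binomial coefficients of the Sobolev seminorm. -/
def tupleVec {β : ℝ} (s : ℕ) (G : Fin (s + 1) → L2w β) : PiLp 2 fun _ : Fin (s + 1) => L2w β :=
  WithLp.toLp 2 fun j => √(s.choose j) • G j

theorem inner_tupleVec {β : ℝ} (s : ℕ) (G G' : Fin (s + 1) → L2w β) :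
    inner ℝ (tupleVec s G) (tupleVec s G') =
      ∑ j : Fin (s + 1), (s.choose j : ℝ) * inner ℝ (G j) (G' j) := by
  rw [PiLp.inner_apply]
  refine Finset.sum_congr rfl fun j _ => ?_
  simp only [tupleVec, real_inner_smul_left, real_inner_smul_right]
  rw [← mul_assoc, Real.mul_self_sqrt (Nat.cast_nonneg _)]

theorem sum_antidiagonal_choose_mul_eq_sum_fin (s : ℕ) (f : ℕ × ℕ → ℝ) :
    ∑ ij ∈ Finset.HasAntidiagonal.antidiagonal s, (s.choose ij.1 : ℝ) * f ij =
      ∑ j : Fin (s + 1), (s.choose j : ℝ) * f (s - j, j) := by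
  rw [← Finset.Nat.sum_antidiagonal_swap, Finset.Nat.sum_antidiagonal_eq_sum_range_succ_mk,
    Finset.sum_range]
  refine Finset.sum_congr rfl fun j _ => ?_
  rw [Prod.swap_prod_mk, Nat.choose_symm (Nat.lt_succ_iff.1 j.2)]

/-- The eigenvalue of the Sobolev form of order `s` on the basis function with index `i`. -/
def basisEigenvalue (s : ℕ) (γ : ℝ) (i : BasisIndex) : ℝ :=
  eigenvalue s γ (i.1.2.1 + i.1.1) i.1.2.1

theorem basisFn_eq (hγ : 0 ≤ γ) (i : BasisIndex) : basisFn γ i = fun p =>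
    (basisConst γ i.1.1 i.1.2.1 i.1.2.2 * diskFun γ (i.1.2.1 + i.1.1) i.1.2.1 p).re :=
  basisFun_eq hγ _ _ _

theorem memLp_mixedDeriv_basisFn (hγ : 0 ≤ γ) (s i j : ℕ) (k : BasisIndex) :
    MemLp (mixedDeriv i j (basisFn γ k)) 2 (wMeasure (γ + s)) :=
  memLp_wMeasure_of_continuous (by positivity)
    (contDiff_mixedDeriv i j (contDiff_basisFn hγ k)).continuous 2

/-- The tuple of the derivatives of order `s` of the normalized basis function. -/
def derivVec (hγ : 0 ≤ γ) (s : ℕ) (k : BasisIndex) :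
    PiLp 2 fun _ : Fin (s + 1) => L2w (γ + s) :=
  tupleVec s fun j => (basisNm γ k)⁻¹ •
    (memLp_mixedDeriv_basisFn hγ s (s - j) j k).toLp (mixedDeriv (s - j) j (basisFn γ k))

/-- The inner product of the derivatives of `u` with those of a basis function. -/
theorem inner_tupleVec_derivVec (hγ : 0 ≤ γ) (s : ℕ) {u : ℝ × ℝ → ℝ} (hu : MemLp u 2 (wMeasure γ))
    {G : Fin (s + 1) → L2w (γ + s)}
    (hG : ∀ j : Fin (s + 1), IsWeakDeriv (s - j) j u (G j)) (k : BasisIndex) :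
    inner ℝ (tupleVec s G) (derivVec hγ s k) =
      basisEigenvalue s γ k * ((basisNm γ k)⁻¹ * ∫ p, u p * basisFn γ k p ∂wMeasure γ) := by
  have h := sum_integral_mixedDeriv_eq hγ s hu
    (g := fun ij => if h : ij.2 < s + 1 then (G ⟨ij.2, h⟩ : ℝ × ℝ → ℝ) else 0)
    (fun ij hij => by
      have hij := Finset.HasAntidiagonal.mem_antidiagonal.1 hij
      have h1 : ij.2 < s + 1 := by omega
      rw [dif_pos h1]
      have h2 := hG ⟨ij.2, h1⟩
      rw [show s - (⟨ij.2, h1⟩ : Fin (s + 1)) = ij.1 by dsimp only; omega] at h2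
      exact ⟨h2, Lp.memLp _⟩)
    (basisConst γ k.1.1 k.1.2.1 k.1.2.2) (k.1.2.1 + k.1.1) k.1.2.1
  rw [← basisFn_eq hγ k] at h
  rw [sum_antidiagonal_choose_mul_eq_sum_fin s fun ij => ∫ p,
    (if h : ij.2 < s + 1 then (G ⟨ij.2, h⟩ : ℝ × ℝ → ℝ) else 0) p *
      mixedDeriv ij.1 ij.2 (basisFn γ k) p ∂wMeasure (γ + s)] at h
  have h3 : ∀ p, (basisConst γ k.1.1 k.1.2.1 k.1.2.2 *
      diskFun γ (k.1.2.1 + k.1.1) k.1.2.1 p).re = basisFn γ k p := fun p => by rw [basisFn_eq hγ k]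
  simp only [h3] at h
  rw [derivVec, inner_tupleVec, basisEigenvalue, mul_left_comm, ← h, Finset.mul_sum]
  refine Finset.sum_congr rfl fun j _ => ?_
  rw [real_inner_smul_right, inner_toLp_right, mul_left_comm]
  simp only [dif_pos j.2, Fin.eta]

/-- The tuples of the derivatives of the basis functions are orthogonal; their squared norms are the
eigenvalues, which may vanish. -/
theorem inner_derivVec_derivVec (hγ : 0 ≤ γ) (s : ℕ) (i k : BasisIndex) :
    inner ℝ (derivVec hγ s i) (derivVec hγ s k) = if i = k then basisEigenvalue s γ i else 0 := by
  have h := sum_integral_mixedDeriv_mul_mixedDeriv hγ s (contDiff_basisFn hγ i)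
    (basisConst γ k.1.1 k.1.2.1 k.1.2.2) (k.1.2.1 + k.1.1) k.1.2.1
  rw [← basisFn_eq hγ k] at h
  have h3 : ∀ p, (basisConst γ k.1.1 k.1.2.1 k.1.2.2 *
      diskFun γ (k.1.2.1 + k.1.1) k.1.2.1 p).re = basisFn γ k p := fun p => by rw [basisFn_eq hγ k]
  simp only [h3] at h
  rw [sum_antidiagonal_choose_mul_eq_sum_fin s fun ij => ∫ p,
    mixedDeriv ij.1 ij.2 (basisFn γ i) p * mixedDeriv ij.1 ij.2 (basisFn γ k) p
      ∂wMeasure (γ + s)] at h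
  have e : inner ℝ (derivVec hγ s i) (derivVec hγ s k) = (basisNm γ i)⁻¹ * (basisNm γ k)⁻¹ *
      (eigenvalue s γ (k.1.2.1 + k.1.1) k.1.2.1 *
        ∫ p, basisFn γ i p * basisFn γ k p ∂wMeasure γ) := by
    rw [derivVec, derivVec, inner_tupleVec, ← h, Finset.mul_sum]
    refine Finset.sum_congr rfl fun j _ => ?_
    rw [real_inner_smul_right, real_inner_smul_left, inner_toLp_toLp]
    ring
  rw [e]
  split_ifs with hik
  · subst hik
    have := (basisNm_pos hγ i).ne'
    rw [integral_basisFn_sq hγ, basisEigenvalue]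
    field_simp
  · rw [show ∫ p, basisFn γ i p * basisFn γ k p ∂wMeasure γ = 0 from
      integral_basisFun_mul_basisFun hγ hik]
    simp

theorem basisEigenvalue_nonneg (hγ : 0 ≤ γ) (s : ℕ) (i : BasisIndex) :
    0 ≤ basisEigenvalue s γ i := eigenvalue_nonneg s hγ _ _

theorem sq_rpow_half (x : ℝ≥0∞) : (x ^ (1 / 2 : ℝ)) ^ 2 = x := by
  rw [← ENNReal.rpow_natCast, ← ENNReal.rpow_mul]
  norm_num

theorem sobolevSeminorm_sq_eq_sum (s : ℕ) (u : L2w γ) : sobolevSeminorm γ s u ^ 2 =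
    ∑ j : Fin (s + 1), (s.choose j : ℝ≥0∞) * derivNorm (γ + s) (s - j) j u ^ 2 := by
  rw [sobolevSeminorm, sq_rpow_half, Finset.sum_range]

/-- The Sobolev seminorm is the norm of the tuple of the derivatives. -/
theorem sobolevSeminorm_sq_eq_ofReal (s : ℕ) {u : L2w γ} {G : Fin (s + 1) → L2w (γ + s)}
    (hG : ∀ j : Fin (s + 1), IsWeakDeriv (s - j) j u (G j)) :
    sobolevSeminorm γ s u ^ 2 = ENNReal.ofReal (‖tupleVec s G‖ ^ 2) := by
  rw [sobolevSeminorm_sq_eq_sum, ← real_inner_self_eq_norm_sq, inner_tupleVec,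
    ENNReal.ofReal_sum_of_nonneg fun j _ => mul_nonneg (Nat.cast_nonneg _) real_inner_self_nonneg]
  refine Finset.sum_congr rfl fun j _ => ?_
  rw [derivNorm_eq _ (hG j), ENNReal.ofReal_mul (Nat.cast_nonneg _), ENNReal.ofReal_natCast,
    real_inner_self_eq_norm_sq, ENNReal.ofReal_pow (norm_nonneg _), ofReal_norm, Lp.enorm_def]
  rfl

/-- If the Sobolev seminorm is finite, the weak derivatives have representatives in the weighted
`L²` spaces. -/
theorem exists_weakDeriv_of_sobolevSeminorm_ne_top (s : ℕ) {u : L2w γ}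
    (h : sobolevSeminorm γ s u ^ 2 ≠ ⊤) : ∃ G : Fin (s + 1) → L2w (γ + s),
      ∀ j : Fin (s + 1), IsWeakDeriv (s - j) j u (G j) := by
  have hex : ∀ j : Fin (s + 1), ∃ G : L2w (γ + s), IsWeakDeriv (s - j) j u G := by
    intro j
    have h1 : derivNorm (γ + s) (s - j) j u < ⊤ := by
      rw [lt_top_iff_ne_top]
      intro htop
      refine h ?_
      rw [sobolevSeminorm_sq_eq_sum, ENNReal.sum_eq_top]
      refine ⟨j, Finset.mem_univ _, ?_⟩
      rw [htop, ENNReal.top_pow two_ne_zero]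
      refine ENNReal.mul_top ?_
      exact_mod_cast (Nat.choose_pos (Nat.lt_succ_iff.1 j.2)).ne'
    rw [derivNorm, iInf_lt_iff] at h1
    obtain ⟨g, hg⟩ := h1
    rw [iInf_lt_iff] at hg
    obtain ⟨hw, hg⟩ := hg
    have hm : MemLp g 2 (wMeasure (γ + s)) :=
      ⟨(hw.2.1.aestronglyMeasurable).mono_ac (wMeasure_absolutelyContinuous _), hg⟩
    have hae : g =ᵐ[volume.restrict Disk] hm.toLp g :=
      (absolutelyContinuous_wMeasure (γ + s)).ae_eq hm.coeFn_toLp.symm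
    refine ⟨hm.toLp g, hw.1, (locallyIntegrableOn_congr hae).1 hw.2.1, fun φ hφ hc hs => ?_⟩
    rw [hw.2.2 φ hφ hc hs]
    congr 1
    refine integral_congr_ae ?_
    filter_upwards [hae] with p hp
    rw [hp]
  exact ⟨fun j => (hex j).choose, fun j => (hex j).choose_spec⟩

/-- The Sobolev seminorm of order `s` is diagonal in the Fourier-Jacobi coefficients. -/
theorem sobolevSeminorm_sq (hγ : 0 ≤ γ) (s : ℕ) (u : L2w γ) : sobolevSeminorm γ s u ^ 2 =
    ∑' i, ENNReal.ofReal (basisEigenvalue s γ i * fourierCoeff hγ u i ^ 2) := by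
  have hnn : ∀ i, 0 ≤ basisEigenvalue s γ i * fourierCoeff hγ u i ^ 2 := fun i =>
    mul_nonneg (basisEigenvalue_nonneg hγ s i) (sq_nonneg _)
  apply le_antisymm
  · -- the series of the derivatives converges, and its sum consists of weak derivatives of `u`
    rcases eq_or_ne (∑' i, ENNReal.ofReal (basisEigenvalue s γ i * fourierCoeff hγ u i ^ 2)) ⊤
      with htop | hfin
    · rw [htop]; exact le_top
    have hsum : Summable fun i => basisEigenvalue s γ i * fourierCoeff hγ u i ^ 2 := by
      refine (ENNReal.summable_toReal hfin).congr fun i => ENNReal.toReal_ofReal (hnn i)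
    have hd := inner_derivVec_derivVec hγ s
    set V := ∑' i, fourierCoeff hγ u i • derivVec hγ s i with hVdef
    have hV : HasSum (fun i => fourierCoeff hγ u i • derivVec hγ s i) V :=
      (summable_smul_of_orthogonal hd hsum).hasSum
    -- the components of `V`, freed from the binomial weights, are the weak derivatives
    have hch : ∀ j : Fin (s + 1), √(s.choose j : ℝ) ≠ 0 := fun j =>
      (Real.sqrt_pos.2 (by exact_mod_cast Nat.choose_pos (Nat.lt_succ_iff.1 j.2))).ne'
    let G : Fin (s + 1) → L2w (γ + s) := fun j => (√(s.choose j : ℝ))⁻¹ • V j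
    have hVG : tupleVec s G = V := by
      refine PiLp.ext fun j => ?_
      simp [tupleVec, G, smul_smul, mul_inv_cancel₀ (hch j)]
    have hG : ∀ j : Fin (s + 1), IsWeakDeriv (s - j) j u (G j) := by
      intro j
      refine isWeakDeriv_of_hasSum hγ (by positivity) (fun i => contDiff_basisFn hγ i)
        (fun i => fourierCoeff hγ u i * (basisNm γ i)⁻¹) (memLp_basisFn hγ)
        (memLp_mixedDeriv_basisFn hγ s (s - j) j) (hasSum_basisFn hγ u) ?_
      have h1 := ((PiLp.proj 2 (fun _ : Fin (s + 1) => L2w (γ + s)) j : _ →L[ℝ] _).hasSum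
        hV).const_smul (√(s.choose j : ℝ))⁻¹
      convert h1 using 1
      · refine funext fun i => ?_
        simp [derivVec, tupleVec, smul_smul]
        congr 1
        have := hch j
        field_simp
      · rfl
    rw [sobolevSeminorm_sq_eq_ofReal s hG, hVG, hVdef, norm_tsum_sq_of_orthogonal hd hsum,
      ENNReal.ofReal_tsum_of_nonneg hnn hsum]
  · -- the eigenvalue equation relates the coefficients of the derivatives to those of `u`
    rcases eq_or_ne (sobolevSeminorm γ s u ^ 2) ⊤ with htop | hfin
    · rw [htop]; exact le_top
    obtain ⟨G, hG⟩ := exists_weakDeriv_of_sobolevSeminorm_ne_top s hfin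
    rw [sobolevSeminorm_sq_eq_ofReal s hG]
    have hV : ∀ i, inner ℝ (tupleVec s G) (derivVec hγ s i) =
        basisEigenvalue s γ i * fourierCoeff hγ u i := fun i => by
      rw [inner_tupleVec_derivVec hγ s (Lp.memLp u) hG, integral_mul_basisFn,
        inv_mul_cancel_left₀ (basisNm_pos hγ i).ne']
    rw [ENNReal.tsum_eq_iSup_sum]
    refine iSup_le fun S => ?_
    rw [← ENNReal.ofReal_sum_of_nonneg fun i _ => hnn i]
    exact ENNReal.ofReal_le_ofReal
      (sum_le_norm_sq_of_orthogonal (inner_derivVec_derivVec hγ s) hV S)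

theorem sobolevNorm_sq (hγ : 0 ≤ γ) (s : ℕ) (u : L2w γ) : sobolevNorm γ s u ^ 2 =
    ∑' i, ENNReal.ofReal ((1 + basisEigenvalue s γ i) * fourierCoeff hγ u i ^ 2) := by
  rw [sobolevNorm, sq_rpow_half, wNorm_sq hγ, sobolevSeminorm_sq hγ, ← ENNReal.tsum_add]
  refine tsum_congr fun i => ?_
  rw [← ENNReal.ofReal_add (sq_nonneg _)
    (mul_nonneg (basisEigenvalue_nonneg hγ s i) (sq_nonneg _))]
  congr 1
  ring

/-- The factor `(n + 1) (n + l + 1)` whose powers are the weights of the Fourier-Jacobi norms. -/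
def basisWeight (i : BasisIndex) : ℝ := ((i.1.2.1 : ℝ) + 1) * ((i.1.2.1 : ℝ) + i.1.1 + 1)

theorem one_le_basisWeight (i : BasisIndex) : 1 ≤ basisWeight i := by
  have h1 : (0 : ℝ) ≤ i.1.2.1 := Nat.cast_nonneg _
  have h2 : (0 : ℝ) ≤ i.1.1 := Nat.cast_nonneg _
  unfold basisWeight
  nlinarith [mul_nonneg h1 h2]

theorem jacobiNorm_sq (hγ : 0 ≤ γ) (s : ℝ) (u : L2w γ) : jacobiNorm γ s u ^ 2 =
    ∑' i, ENNReal.ofReal (basisWeight i ^ s * fourierCoeff hγ u i ^ 2) := by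
  rw [jacobiNorm, sq_rpow_half]
  refine tsum_congr fun i => ?_
  have h := integral_mul_basisFn hγ u i
  have hi := (basisNm_pos hγ i).ne'
  have h1 : coeff γ u i.1.1 i.1.2.1 i.1.2.2 ^ 2 * basisNorm γ i.1.1 i.1.2.1 i.1.2.2 ^ 2 =
      fourierCoeff hγ u i ^ 2 := by
    change ((∫ p, u p * basisFn γ i p ∂wMeasure γ) / basisNm γ i ^ 2) ^ 2 * basisNm γ i ^ 2 = _
    rw [h]
    field_simp
  dsimp only
  rw [mul_assoc, h1, basisWeight, Real.mul_rpow (by positivity) (by positivity)]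

/-- Two norms which are both given by weighted sums of squares of the coefficients are compared
through the weights. -/
theorem tsum_ofReal_le_mul {ι : Type*} {A B b : ι → ℝ} {C : ℝ} (hC : 0 ≤ C)
    (h : ∀ i, A i ≤ C * B i) :
    ∑' i, ENNReal.ofReal (A i * b i ^ 2) ≤
      ENNReal.ofReal C * ∑' i, ENNReal.ofReal (B i * b i ^ 2) := by
  rw [← ENNReal.tsum_mul_left]
  refine ENNReal.tsum_le_tsum fun i => ?_
  rw [← ENNReal.ofReal_mul hC]
  refine ENNReal.ofReal_le_ofReal ?_
  rw [← mul_assoc]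
  exact mul_le_mul_of_nonneg_right (h i) (sq_nonneg _)

theorem le_ofReal_sqrt_mul {x y : ℝ≥0∞} {C : ℝ} (hC : 0 ≤ C)
    (h : x ^ 2 ≤ ENNReal.ofReal C * y ^ 2) : x ≤ ENNReal.ofReal (√C) * y := by
  have e : (ENNReal.ofReal (√C) * y) ^ 2 = ENNReal.ofReal C * y ^ 2 := by
    rw [mul_pow, ← ENNReal.ofReal_pow (Real.sqrt_nonneg _), Real.sq_sqrt hC]
  rw [← e] at h
  exact (ENNReal.pow_le_pow_left_iff two_ne_zero).1 h

/-- Global inequalities between two norms with values in `[0, ∞]` imply that the spaces on which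
they are finite coincide. -/
theorem spacesEquivalent_of_le {E : Type*} {N N' : E → ℝ≥0∞} {C C' : ℝ} (hC : 0 < C) (hC' : 0 < C')
    (h : ∀ u, N u ≤ ENNReal.ofReal C * N' u) (h' : ∀ u, N' u ≤ ENNReal.ofReal C' * N u) :
    SpacesEquivalent N N' := by
  refine ⟨ext fun u => ⟨fun hu => ?_, fun hu => ?_⟩, C'⁻¹, C, inv_pos.2 hC', hC,
    fun u _ => ⟨?_, h u⟩⟩
  · exact (h' u).trans_lt (ENNReal.mul_lt_top ENNReal.ofReal_lt_top hu)
  · exact (h u).trans_lt (ENNReal.mul_lt_top ENNReal.ofReal_lt_top hu)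
  · calc ENNReal.ofReal C'⁻¹ * N' u ≤ ENNReal.ofReal C'⁻¹ * (ENNReal.ofReal C' * N u) := by
          gcongr; exact h' u
      _ = N u := by
          rw [← mul_assoc, ← ENNReal.ofReal_mul (inv_pos.2 hC').le, inv_mul_cancel₀ hC'.ne']
          simp

/-- The equivalence of the norms for integer order. -/
theorem exists_sobolevNorm_le_jacobiNorm (hγ : 0 ≤ γ) (s : ℕ) : ∃ C C' : ℝ, 0 < C ∧ 0 < C' ∧
    (∀ u : L2w γ, sobolevNorm γ s u ≤ ENNReal.ofReal C * jacobiNorm γ s u) ∧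
    ∀ u : L2w γ, jacobiNorm γ s u ≤ ENNReal.ofReal C' * sobolevNorm γ s u := by
  obtain ⟨C, hC, h1⟩ := eigenvalue_le s hγ
  obtain ⟨c, hc, h2⟩ := le_one_add_eigenvalue s
  have hw : ∀ i : BasisIndex, (((i.1.2.1 + i.1.1 : ℕ) : ℝ) + 1) * ((i.1.2.1 : ℝ) + 1) =
      basisWeight i := fun i => by rw [basisWeight]; push_cast; ring
  refine ⟨√(1 + C), √(c⁻¹), by positivity, by positivity, fun u => ?_, fun u => ?_⟩
  · refine le_ofReal_sqrt_mul (by positivity) ?_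
    rw [sobolevNorm_sq hγ, jacobiNorm_sq hγ]
    refine tsum_ofReal_le_mul (by positivity) fun i => ?_
    have h3 := h1 (i.1.2.1 + i.1.1) i.1.2.1
    rw [hw] at h3
    have h4 : 1 ≤ basisWeight i ^ s := one_le_pow₀ (one_le_basisWeight i)
    rw [Real.rpow_natCast, basisEigenvalue]
    linarith
  · refine le_ofReal_sqrt_mul (by positivity) ?_
    rw [sobolevNorm_sq hγ, jacobiNorm_sq hγ]
    refine tsum_ofReal_le_mul (by positivity) fun i => ?_
    have h3 := h2 γ hγ (i.1.2.1 + i.1.1) i.1.2.1 (by omega)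
    rw [hw] at h3
    rw [Real.rpow_natCast, basisEigenvalue, le_inv_mul_iff₀ hc]
    exact h3

/-! ### Interpolation of weighted sequence spaces -/

/-- The minimum switches from one argument to the other at `t = T`. -/
theorem lintegral_rpow_mul_min {θ a c T : ℝ} (hθ : 0 < θ) (hθ1 : θ < 1) (ha : 0 < a) (hc : 0 < c)
    (hT : 0 < T) (h : T ^ 2 * c = a) :
    ∫⁻ t in Ioi (0 : ℝ), ENNReal.ofReal (t ^ (-2 * θ) * min a (t ^ 2 * c) * t⁻¹) =
      ENNReal.ofReal ((1 / (2 - 2 * θ) + 1 / (2 * θ)) * (a * T ^ (-2 * θ))) := by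
  have i1 : IntegrableOn (fun t : ℝ => c * t ^ (1 - 2 * θ)) (Ioc 0 T) :=
    ((intervalIntegral.intervalIntegrable_rpow' (by linarith) (a := 0) (b := T)).1).const_mul c
  have i2 : IntegrableOn (fun t : ℝ => a * t ^ (-2 * θ - 1)) (Ioi T) :=
    (integrableOn_Ioi_rpow_of_lt (by linarith) hT).const_mul a
  have e1 : ∫⁻ t in Ioc 0 T, ENNReal.ofReal (t ^ (-2 * θ) * min a (t ^ 2 * c) * t⁻¹) =
      ENNReal.ofReal (1 / (2 - 2 * θ) * (a * T ^ (-2 * θ))) := by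
    have : ∫ t in Ioc 0 T, c * t ^ (1 - 2 * θ) = 1 / (2 - 2 * θ) * (a * T ^ (-2 * θ)) := by
      rw [integral_const_mul, ← intervalIntegral.integral_of_le hT.le,
        integral_rpow (Or.inl (by linarith)), Real.zero_rpow (by linarith),
        show 1 - 2 * θ + 1 = 2 + -2 * θ by ring, Real.rpow_add hT, ← h]
      norm_num
      ring
    rw [← this, ofReal_integral_eq_lintegral_ofReal i1
      ((ae_restrict_mem measurableSet_Ioc).mono fun t ht =>
        mul_nonneg hc.le (Real.rpow_nonneg ht.1.le _))]
    refine setLIntegral_congr_fun measurableSet_Ioc fun t ht => ?_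
    have ht0 : 0 < t := ht.1
    have hm : t ^ 2 * c ≤ a := by
      rw [← h]
      have := ht.2
      gcongr
    simp only [min_eq_right hm]
    congr 1
    rw [show 1 - 2 * θ = -2 * θ + 1 by ring, Real.rpow_add_one ht0.ne']
    field_simp
  have e2 : ∫⁻ t in Ioi T, ENNReal.ofReal (t ^ (-2 * θ) * min a (t ^ 2 * c) * t⁻¹) =
      ENNReal.ofReal (1 / (2 * θ) * (a * T ^ (-2 * θ))) := by
    have : ∫ t in Ioi T, a * t ^ (-2 * θ - 1) = 1 / (2 * θ) * (a * T ^ (-2 * θ)) := by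
      rw [integral_const_mul, integral_Ioi_rpow_of_lt (by linarith) hT,
        show -2 * θ - 1 + 1 = -2 * θ by ring]
      field_simp
    rw [← this, ofReal_integral_eq_lintegral_ofReal i2
      ((ae_restrict_mem measurableSet_Ioi).mono fun t ht =>
        mul_nonneg ha.le (Real.rpow_nonneg (hT.trans ht).le _))]
    refine setLIntegral_congr_fun measurableSet_Ioi fun t ht => ?_
    have ht' : T < t := ht
    have ht0 : 0 < t := hT.trans ht'
    have hm : a ≤ t ^ 2 * c := by
      rw [← h]
      gcongr
    simp only [min_eq_left hm]
    congr 1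
    rw [Real.rpow_sub_one ht0.ne']
    field_simp
  rw [← Ioc_union_Ioi_eq_Ioi hT.le, lintegral_union measurableSet_Ioi
    (disjoint_left.2 fun t ht ht' => not_lt.2 ht.2 ht'), e1, e2, ← ENNReal.ofReal_add]
  · congr 1
    ring
  · have : 0 < 2 - 2 * θ := by linarith
    positivity
  · positivity

/-- The integral which turns the weights of the K-functional into those of the interpolation
space. -/
theorem lintegral_rpow_mul_min_rpow {x κ m θ : ℝ} (hx : 0 < x) (hθ : 0 < θ) (hθ1 : θ < 1) :
    ∫⁻ t in Ioi (0 : ℝ),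
        ENNReal.ofReal (t ^ (-2 * θ) * min (x ^ κ) (t ^ 2 * x ^ m) * t⁻¹) =
      ENNReal.ofReal ((1 / (2 - 2 * θ) + 1 / (2 * θ)) * x ^ ((1 - θ) * κ + θ * m)) := by
  rw [lintegral_rpow_mul_min hθ hθ1 (Real.rpow_pos_of_pos hx κ) (Real.rpow_pos_of_pos hx m)
    (Real.rpow_pos_of_pos hx ((κ - m) / 2)), ← Real.rpow_mul hx.le, ← Real.rpow_add hx]
  · congr 3
    ring
  · rw [← Real.rpow_natCast, ← Real.rpow_mul hx.le, ← Real.rpow_add hx]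
    congr 1
    push_cast
    ring

theorem fourierCoeff_sub (hγ : 0 ≤ γ) (u v : L2w γ) (i : BasisIndex) :
    fourierCoeff hγ (u - v) i = fourierCoeff hγ u i - fourierCoeff hγ v i := by
  simp [fourierCoeff, map_sub]

/-- Restriction of the Fourier-Jacobi expansion to a set of indices. -/
theorem exists_fourierCoeff_eq_indicator (hγ : 0 ≤ γ) (u : L2w γ) (A : Set BasisIndex) :
    ∃ v : L2w γ, ∀ i, fourierCoeff hγ v i = A.indicator (fourierCoeff hγ u) i := by
  have hm : Memℓp (fun i => A.indicator (fourierCoeff hγ u) i) 2 := by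
    refine memℓp_gen ?_
    have h := (hasSum_fourierCoeff_sq hγ u).summable
    simp only [ENNReal.toReal_ofNat, Real.rpow_ofNat, Real.norm_eq_abs, sq_abs]
    refine Summable.of_nonneg_of_le (fun i => sq_nonneg _) (fun i => ?_) h
    by_cases hi : i ∈ A
    · rw [indicator_of_mem hi]
    · rw [indicator_of_notMem hi]
      simpa using sq_nonneg (fourierCoeff hγ u i)
  refine ⟨(diskBasis hγ).repr.symm ⟨_, hm⟩, fun i => ?_⟩
  rw [fourierCoeff, LinearIsometryEquiv.apply_symm_apply]

/-- The square of the K-functional of the pair of weighted sequence spaces with weights `w^κ` and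
`w^m`, up to constant factors. -/
def kSum (hγ : 0 ≤ γ) (κ m t : ℝ) (u : L2w γ) : ℝ≥0∞ :=
  ∑' i, ENNReal.ofReal (min (basisWeight i ^ κ) (t ^ 2 * basisWeight i ^ m)
    * fourierCoeff hγ u i ^ 2)

theorem basisWeight_rpow_pos (i : BasisIndex) (σ : ℝ) : 0 < basisWeight i ^ σ :=
  Real.rpow_pos_of_pos (zero_lt_one.trans_le (one_le_basisWeight i)) σ

/-- The splitting of `u` which is optimal up to a constant: `v` collects the coefficients for which
the second weight is the smaller one. -/
theorem exists_split_le_kSum (hγ : 0 ≤ γ) (κ m : ℝ) {t : ℝ} (ht : 0 < t) (u : L2w γ) :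
    ∃ v : L2w γ, jacobiNorm γ κ (u - v) ^ 2 ≤ kSum hγ κ m t u ∧
      (ENNReal.ofReal t * jacobiNorm γ m v) ^ 2 ≤ kSum hγ κ m t u := by
  obtain ⟨v, hv⟩ := exists_fourierCoeff_eq_indicator hγ u
    {i | t ^ 2 * basisWeight i ^ m ≤ basisWeight i ^ κ}
  refine ⟨v, ?_, ?_⟩
  · rw [jacobiNorm_sq hγ]
    refine ENNReal.tsum_le_tsum fun i => ENNReal.ofReal_le_ofReal ?_
    rw [fourierCoeff_sub, hv]
    by_cases hi : t ^ 2 * basisWeight i ^ m ≤ basisWeight i ^ κ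
    · rw [indicator_of_mem (by exact hi), sub_self, zero_pow two_ne_zero, mul_zero]
      have := basisWeight_rpow_pos i κ
      have := basisWeight_rpow_pos i m
      positivity
    · rw [indicator_of_notMem (by exact hi), sub_zero, min_eq_left (not_le.1 hi).le]
  · rw [mul_pow, jacobiNorm_sq hγ, ← ENNReal.ofReal_pow ht.le, ← ENNReal.tsum_mul_left]
    refine ENNReal.tsum_le_tsum fun i => ?_
    rw [← ENNReal.ofReal_mul (by positivity)]
    refine ENNReal.ofReal_le_ofReal ?_
    rw [hv]
    by_cases hi : t ^ 2 * basisWeight i ^ m ≤ basisWeight i ^ κ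
    · rw [indicator_of_mem (by exact hi), min_eq_right hi, mul_assoc]
    · rw [indicator_of_notMem (by exact hi), zero_pow two_ne_zero, mul_zero, mul_zero]
      have := basisWeight_rpow_pos i κ
      have := basisWeight_rpow_pos i m
      positivity

/-- No splitting does better by more than a constant factor, since
`x² ≤ 2 ((x - y)² + y²)` for each coefficient. -/
theorem kSum_le (hγ : 0 ≤ γ) (κ m : ℝ) {t : ℝ} (ht : 0 < t) (u v : L2w γ) :
    kSum hγ κ m t u ≤
      2 * (jacobiNorm γ κ (u - v) + ENNReal.ofReal t * jacobiNorm γ m v) ^ 2 := by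
  have h1 : kSum hγ κ m t u ≤ 2 * (jacobiNorm γ κ (u - v) ^ 2
      + (ENNReal.ofReal t * jacobiNorm γ m v) ^ 2) := by
    rw [mul_pow, jacobiNorm_sq hγ, jacobiNorm_sq hγ, ← ENNReal.ofReal_pow ht.le,
      ← ENNReal.tsum_mul_left, ← ENNReal.tsum_add, ← ENNReal.tsum_mul_left]
    refine ENNReal.tsum_le_tsum fun i => ?_
    have p1 := basisWeight_rpow_pos i κ
    have p2 := basisWeight_rpow_pos i m
    rw [← ENNReal.ofReal_mul (by positivity), ← ENNReal.ofReal_add (by positivity) (by positivity),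
      show (2 : ℝ≥0∞) = ENNReal.ofReal 2 by simp, ← ENNReal.ofReal_mul (by positivity)]
    refine ENNReal.ofReal_le_ofReal ?_
    rw [fourierCoeff_sub]
    set x := fourierCoeff hγ u i
    set y := fourierCoeff hγ v i
    set M := min (basisWeight i ^ κ) (t ^ 2 * basisWeight i ^ m) with hM
    have hM0 : 0 ≤ M := le_min p1.le (by positivity)
    have m1 : M * (x - y) ^ 2 ≤ basisWeight i ^ κ * (x - y) ^ 2 :=
      mul_le_mul_of_nonneg_right (min_le_left _ _) (sq_nonneg _)
    have m2 : M * y ^ 2 ≤ t ^ 2 * basisWeight i ^ m * y ^ 2 :=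
      mul_le_mul_of_nonneg_right (min_le_right _ _) (sq_nonneg _)
    have m3 : M * x ^ 2 ≤ M * (2 * ((x - y) ^ 2 + y ^ 2)) :=
      mul_le_mul_of_nonneg_left (by nlinarith [sq_nonneg (x - 2 * y)]) hM0
    nlinarith
  refine h1.trans ?_
  gcongr
  generalize jacobiNorm γ κ (u - v) = x
  generalize ENNReal.ofReal t * jacobiNorm γ m v = y
  calc x ^ 2 + y ^ 2 ≤ x ^ 2 + y ^ 2 + 2 * x * y := le_self_add
    _ = (x + y) ^ 2 := by ring

/-- The interpolation integral of `kSum`, computed term by term. -/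
theorem lintegral_kSum (hγ : 0 ≤ γ) (κ m : ℝ) {θ : ℝ} (hθ : 0 < θ) (hθ1 : θ < 1) (u : L2w γ) :
    ∫⁻ t in Ioi (0 : ℝ), ENNReal.ofReal (t ^ (-2 * θ)) * kSum hγ κ m t u * ENNReal.ofReal t⁻¹ =
      ENNReal.ofReal (1 / (2 - 2 * θ) + 1 / (2 * θ)) *
        jacobiNorm γ ((1 - θ) * κ + θ * m) u ^ 2 := by
  have h1 : ∀ t ∈ Ioi (0 : ℝ),
      ENNReal.ofReal (t ^ (-2 * θ)) * kSum hγ κ m t u * ENNReal.ofReal t⁻¹ =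
      ∑' i, ENNReal.ofReal (t ^ (-2 * θ) * min (basisWeight i ^ κ) (t ^ 2 * basisWeight i ^ m)
        * t⁻¹) * ENNReal.ofReal (fourierCoeff hγ u i ^ 2) := by
    intro t ht
    have ht : 0 < t := ht
    rw [kSum, ← ENNReal.tsum_mul_left, ← ENNReal.tsum_mul_right]
    refine tsum_congr fun i => ?_
    have p1 := basisWeight_rpow_pos i κ
    have p2 := basisWeight_rpow_pos i m
    have p3 : 0 ≤ t ^ (-2 * θ) := Real.rpow_nonneg ht.le _
    have p4 : 0 ≤ min (basisWeight i ^ κ) (t ^ 2 * basisWeight i ^ m) :=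
      le_min p1.le (by positivity)
    rw [← ENNReal.ofReal_mul p3, ← ENNReal.ofReal_mul (by positivity),
      ← ENNReal.ofReal_mul (by positivity)]
    congr 1
    ring
  rw [setLIntegral_congr_fun measurableSet_Ioi h1, lintegral_tsum fun i => by fun_prop,
    jacobiNorm_sq hγ, ← ENNReal.tsum_mul_left]
  refine tsum_congr fun i => ?_
  have hC : 0 ≤ 1 / (2 - 2 * θ) + 1 / (2 * θ) := by
    have : 0 < 2 - 2 * θ := by linarith
    positivity
  rw [lintegral_mul_const' _ _ ENNReal.ofReal_ne_top, lintegral_rpow_mul_min_rpow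
    (zero_lt_one.trans_le (one_le_basisWeight i)) hθ hθ1, ← ENNReal.ofReal_mul
    (mul_nonneg hC (basisWeight_rpow_pos i _).le), ← ENNReal.ofReal_mul hC, mul_assoc]

/-- The upper bound of the K-functional. If `kSum` is finite, the splitting lies in the spaces over
which the infimum is taken. -/
theorem kFunctional_sq_le (hγ : 0 ≤ γ) {κ m C₀ C₁ : ℝ} (hC₀ : 0 < C₀) (hC₁ : 0 < C₁)
    {N₀ N₁ : L2w γ → ℝ≥0∞} (h₀ : ∀ u, N₀ u ≤ ENNReal.ofReal C₀ * jacobiNorm γ κ u)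
    (h₁ : ∀ u, N₁ u ≤ ENNReal.ofReal C₁ * jacobiNorm γ m u) {t : ℝ} (ht : 0 < t) (u : L2w γ) :
    kFunctional N₀ N₁ t u ^ 2 ≤ ENNReal.ofReal ((C₀ + C₁) ^ 2) * kSum hγ κ m t u := by
  rcases eq_or_ne (kSum hγ κ m t u) ⊤ with htop | hfin
  · rw [htop, ENNReal.mul_top (by positivity)]
    exact le_top
  obtain ⟨v, hv0, hv1⟩ := exists_split_le_kSum hγ κ m ht u
  set S := kSum hγ κ m t u ^ (1 / 2 : ℝ) with hS
  have hS2 : S ^ 2 = kSum hγ κ m t u := sq_rpow_half _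
  rw [← hS2] at hv0 hv1 ⊢
  have a0 := (ENNReal.pow_le_pow_left_iff two_ne_zero).1 hv0
  have a1 := (ENNReal.pow_le_pow_left_iff two_ne_zero).1 hv1
  have hSfin : S ≠ ⊤ := fun h => hfin (by rw [← hS2, h, ENNReal.top_pow two_ne_zero])
  have hv : N₁ v < ⊤ := by
    refine (h₁ v).trans_lt (ENNReal.mul_lt_top ENNReal.ofReal_lt_top ?_)
    rw [lt_top_iff_ne_top]
    intro h
    rw [h, ENNReal.mul_top (by positivity)] at a1
    exact hSfin (top_le_iff.1 a1)
  rw [ENNReal.ofReal_pow (by positivity), ← mul_pow]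
  refine pow_le_pow_left' ?_ 2
  refine (iInf₂_le v hv).trans ?_
  calc N₀ (u - v) + ENNReal.ofReal t * N₁ v
      ≤ ENNReal.ofReal C₀ * jacobiNorm γ κ (u - v)
        + ENNReal.ofReal t * (ENNReal.ofReal C₁ * jacobiNorm γ m v) := by
        gcongr
        · exact h₀ _
        · exact h₁ _
    _ = ENNReal.ofReal C₀ * jacobiNorm γ κ (u - v)
        + ENNReal.ofReal C₁ * (ENNReal.ofReal t * jacobiNorm γ m v) := by ring
    _ ≤ ENNReal.ofReal C₀ * S + ENNReal.ofReal C₁ * S := by gcongr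
    _ = _ := by rw [ENNReal.ofReal_add hC₀.le hC₁.le]; ring

theorem kSum_le_kFunctional_sq (hγ : 0 ≤ γ) {κ m C₀ C₁ : ℝ} (hC₀ : 0 < C₀) (hC₁ : 0 < C₁)
    {N₀ N₁ : L2w γ → ℝ≥0∞} (h₀ : ∀ u, jacobiNorm γ κ u ≤ ENNReal.ofReal C₀ * N₀ u)
    (h₁ : ∀ u, jacobiNorm γ m u ≤ ENNReal.ofReal C₁ * N₁ u) {t : ℝ} (ht : 0 < t) (u : L2w γ) :
    kSum hγ κ m t u ≤ ENNReal.ofReal (2 * (C₀ + C₁) ^ 2) * kFunctional N₀ N₁ t u ^ 2 := by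
  set c := √2 * (C₀ + C₁) with hc
  have hc0 : 0 < c := by positivity
  have hc2 : c ^ 2 = 2 * (C₀ + C₁) ^ 2 := by rw [hc, mul_pow, Real.sq_sqrt zero_le_two]
  set S := kSum hγ κ m t u ^ (1 / 2 : ℝ) with hS
  have hS2 : S ^ 2 = kSum hγ κ m t u := sq_rpow_half _
  rw [← hc2, ← hS2, ENNReal.ofReal_pow hc0.le, ← mul_pow]
  refine pow_le_pow_left' ?_ 2
  have hle : ∀ v, S ≤ ENNReal.ofReal c * (N₀ (u - v) + ENNReal.ofReal t * N₁ v) := by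
    intro v
    have h := kSum_le hγ κ m ht u v
    have h2 : S ^ 2 ≤ (ENNReal.ofReal (√2) *
        (jacobiNorm γ κ (u - v) + ENNReal.ofReal t * jacobiNorm γ m v)) ^ 2 := by
      rw [hS2, mul_pow, ← ENNReal.ofReal_pow (Real.sqrt_nonneg _), Real.sq_sqrt zero_le_two]
      simpa using h
    refine ((ENNReal.pow_le_pow_left_iff two_ne_zero).1 h2).trans ?_
    rw [hc, ENNReal.ofReal_mul (Real.sqrt_nonneg _), mul_assoc]
    gcongr
    calc jacobiNorm γ κ (u - v) + ENNReal.ofReal t * jacobiNorm γ m v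
        ≤ ENNReal.ofReal C₀ * N₀ (u - v) + ENNReal.ofReal t * (ENNReal.ofReal C₁ * N₁ v) := by
          gcongr
          · exact h₀ _
          · exact h₁ _
      _ ≤ ENNReal.ofReal (C₀ + C₁) * N₀ (u - v)
          + ENNReal.ofReal t * (ENNReal.ofReal (C₀ + C₁) * N₁ v) := by
          gcongr <;> linarith
      _ = _ := by ring
  rw [mul_comm, ← ENNReal.div_le_iff (by positivity) ENNReal.ofReal_ne_top]
  refine le_iInf₂ fun v _ => ?_
  rw [ENNReal.div_le_iff (by positivity) ENNReal.ofReal_ne_top, mul_comm]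
  exact hle v

/-- Interpolation between two norms which are equivalent to Fourier-Jacobi norms. -/
theorem spacesEquivalent_interpNorm (hγ : 0 ≤ γ) {κ m θ C₀ C₁ C₀' C₁' : ℝ}
    (hθ : 0 < θ) (hθ1 : θ < 1) {N₀ N₁ : L2w γ → ℝ≥0∞}
    (hC₀ : 0 < C₀) (hC₁ : 0 < C₁) (hC₀' : 0 < C₀') (hC₁' : 0 < C₁')
    (h₀ : ∀ u, N₀ u ≤ ENNReal.ofReal C₀ * jacobiNorm γ κ u)
    (h₁ : ∀ u, N₁ u ≤ ENNReal.ofReal C₁ * jacobiNorm γ m u)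
    (h₀' : ∀ u, jacobiNorm γ κ u ≤ ENNReal.ofReal C₀' * N₀ u)
    (h₁' : ∀ u, jacobiNorm γ m u ≤ ENNReal.ofReal C₁' * N₁ u) :
    SpacesEquivalent (interpNorm N₀ N₁ θ) (jacobiNorm γ ((1 - θ) * κ + θ * m)) := by
  set B := 1 / (2 - 2 * θ) + 1 / (2 * θ) with hB
  have hB0 : 0 < B := by
    have : 0 < 2 - 2 * θ := by linarith
    positivity
  -- the interpolation integral is monotone in the square of the K-functional
  have hmono : ∀ {f g : ℝ → ℝ≥0∞} {C : ℝ}, (∀ t > 0, f t ≤ ENNReal.ofReal C * g t) →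
      ∫⁻ t in Ioi (0 : ℝ), ENNReal.ofReal (t ^ (-2 * θ)) * f t * ENNReal.ofReal t⁻¹ ≤
        ENNReal.ofReal C *
          ∫⁻ t in Ioi (0 : ℝ), ENNReal.ofReal (t ^ (-2 * θ)) * g t * ENNReal.ofReal t⁻¹ := by
    intro f g C h
    rw [← lintegral_const_mul' _ _ ENNReal.ofReal_ne_top]
    refine setLIntegral_mono' measurableSet_Ioi fun t ht => ?_
    calc ENNReal.ofReal (t ^ (-2 * θ)) * f t * ENNReal.ofReal t⁻¹
        ≤ ENNReal.ofReal (t ^ (-2 * θ)) * (ENNReal.ofReal C * g t) * ENNReal.ofReal t⁻¹ := by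
          gcongr
          exact h t ht
      _ = _ := by ring
  refine spacesEquivalent_of_le (C := √((C₀ + C₁) ^ 2 * B))
    (C' := √(B⁻¹ * (2 * (C₀' + C₁') ^ 2))) (by positivity) (by positivity)
    (fun u => le_ofReal_sqrt_mul (by positivity) ?_) fun u => le_ofReal_sqrt_mul (by positivity) ?_
  · rw [interpNorm, sq_rpow_half, ENNReal.ofReal_mul (by positivity), mul_assoc,
      ← lintegral_kSum hγ κ m hθ hθ1]
    exact hmono fun t ht => kFunctional_sq_le hγ hC₀ hC₁ h₀ h₁ ht u
  · have h := hmono (f := fun t => kSum hγ κ m t u) (g := fun t => kFunctional N₀ N₁ t u ^ 2)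
      fun t ht => kSum_le_kFunctional_sq hγ hC₀' hC₁' h₀' h₁' ht u
    rw [lintegral_kSum hγ κ m hθ hθ1] at h
    rw [interpNorm, sq_rpow_half, ENNReal.ofReal_mul (by positivity), mul_assoc]
    calc jacobiNorm γ ((1 - θ) * κ + θ * m) u ^ 2
        = ENNReal.ofReal B⁻¹ * (ENNReal.ofReal B *
            jacobiNorm γ ((1 - θ) * κ + θ * m) u ^ 2) := by
          rw [← mul_assoc, ← ENNReal.ofReal_mul (by positivity), inv_mul_cancel₀ hB0.ne']
          simp
      _ ≤ _ := by gcongr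

end DiskSobolev

end

/-- For `γ ≥ 0` and `s ≥ 0` the spaces `H^s_γ` and `H̃^s_γ` on the unit disk coincide, with
equivalent norms: first for integer `s`, then for non-integer `s` and for every choice of integers
`k < s < m` between which `H^s_γ` is defined by interpolation. -/
theorem mainTheorem1 (γ : ℝ) (hγ : 0 ≤ γ) :
    (∀ s : ℕ,
      DiskSobolev.SpacesEquivalent
        (DiskSobolev.sobolevNorm γ s) (DiskSobolev.jacobiNorm γ (s : ℝ))) ∧
    (∀ s : ℝ, 0 < s → (∀ n : ℕ, s ≠ (n : ℝ)) →
      ∀ k m : ℕ, (k : ℝ) < s → s < (m : ℝ) →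
        DiskSobolev.SpacesEquivalent
          (DiskSobolev.fracSobolevNorm γ k m s) (DiskSobolev.jacobiNorm γ s)) := by
  refine ⟨fun s => ?_, fun s _ _ k m hk hm => ?_⟩
  · obtain ⟨C, C', hC, hC', h, h'⟩ := DiskSobolev.exists_sobolevNorm_le_jacobiNorm hγ s
    exact DiskSobolev.spacesEquivalent_of_le hC hC' h h'
  · obtain ⟨C₀, C₀', hC₀, hC₀', h₀, h₀'⟩ := DiskSobolev.exists_sobolevNorm_le_jacobiNorm hγ k
    obtain ⟨C₁, C₁', hC₁, hC₁', h₁, h₁'⟩ := DiskSobolev.exists_sobolevNorm_le_jacobiNorm hγ m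
    have hkm : 0 < (m : ℝ) - k := by linarith
    have hθ : 0 < (s - k) / ((m : ℝ) - k) := div_pos (by linarith) hkm
    have hθ1 : (s - k) / ((m : ℝ) - k) < 1 := (div_lt_one hkm).2 (by linarith)
    have key := DiskSobolev.spacesEquivalent_interpNorm hγ hθ hθ1 hC₀ hC₁ hC₀' hC₁' h₀ h₁ h₀' h₁'
    rw [show (1 - (s - k) / ((m : ℝ) - k)) * k + (s - k) / ((m : ℝ) - k) * m = s by
      field_simp; ring] at key
    exact key
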